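/- **Setting.** Let $\Sigma\subset\mathbb{R}^n$ be a smooth boundaryless submanifold of codimension $d\ge 1$ that is closed as a subset. Fix a continuous $\epsilon:\Sigma\to(0,\infty)$ such that every point $x$ of $\Sigma^{\epsilon}=\{x:\|x-\xi\|<\epsilon(\xi)\text{ for some }\xi\in\Sigma\}$ has a unique closest point $\pi(x)\in\Sigma$ and $\pi:\Sigma^\epsilon\to\Sigma$ is a smooth submersion. Fix bounded open sets $U_\nu\subseteq\Sigma^\epsilon$ ($\nu\in\mathbb{N}$) meeting and covering $\Sigma$, with smooth orthonormal frames $\mathbf n^\nu_1,\dots,\mathbf n^\nu_d$ of the normal spaces over $\Sigma\cap U_\nu$ and numbers $\rho_\nu>0$, such that $(\xi,\omega,\rho)\mapsto \xi+\rho\sum_k\omega_k\mathbf n^\nu_k(\xi)$ is a diffeomorphism of $(\Sigma\cap U_\nu)\times\mathbb{S}^{d-1}\times(0,\rho_\nu)$ onto $U_\nu\setminus\Sigma$ with inverse $x\mapsto(\xi_x,\omega_x,\rho_x)$, where $\xi_x=\pi(x)$, $\rho_x=\|x-\pi(x)\|$, $\omega_{x,k}=\mathbf n^\nu_k(\pi(x))\cdot(x-\pi(x))/\rho_x$.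 Let $\Omega\subseteq\mathbb{R}^n$ be open with $\Omega\cap\Sigma\neq\emptyset$. All functions are complex valued, and functions on $\Omega\setminus\Sigma$ are identified with their extensions by zero. **Test functions.** For $m\in\mathbb{Z}$ and compact $K\subset\Omega$, $\mathcal D^{[m;K]}_{*,\Sigma}(\Omega)$ is the space of $\phi\in C^\infty(\Omega\setminus\Sigma)$ vanishing outside $K$ such that for each $\nu$ there are $a_j\in C^\infty((\Sigma\cap U_\nu)\times\mathbb S^{d-1})$, $j\ge m$, with $$\phi(x)\sim\sum_{j=m}^\infty a_j(\xi_x,\omega_x)\rho_x^j\quad(\rho_x\to0)$$ uniformly and strongly on $U_\nu\setminus\Sigma$, i.e. for all $\alpha\in\mathbb{N}^n$ and $N\in\mathbb Z$, $\partial^\alpha\phi(x)-\sum_{m\le j<N}\partial^\alpha\big(a_j(\xi_x,\omega_x)\rho_x^j\big)=O(\rho_x^{N-|\alpha|})$ as $\rho_x\to0$, uniformly in $x\in U_\nu\setminus\Sigma$. Its topology is given by the seminorms ($q\in\mathbb Z$, $k,\nu\in\mathbb N$) $$\sup_{x\in (K\cap U_\nu)\setminus\Sigma,\,|\alpha|\le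 k}\rho_x^{-q}\Big|\partial^\alpha\phi(x)-\sum_{j=m-|\alpha|}^{q-1}a_{j,\alpha}(\xi_x,\omega_x)\rho_x^j\Big|+\sup_{x\in K\setminus\bigcup_\mu U_\mu,\,|\alpha|\le k}|\partial^\alpha\phi(x)|,$$ where $a_{j,\alpha}$ are the coefficients of the strong expansion of $\partial^\alpha\phi$ on $U_\nu\setminus\Sigma$. The space $\mathcal D_{*,\Sigma}(\Omega)=\bigcup_{m,K}\mathcal D^{[m;K]}_{*,\Sigma}(\Omega)$ carries the locally convex inductive limit topology. Let $\mathcal E_{*,\Sigma}(\Omega)$ be the space of $\psi\in C^\infty(\Omega\setminus\Sigma)$ with $\varphi\psi\in\mathcal D_{*,\Sigma}(\Omega)$ for all $\varphi\in\mathcal D(\Omega)$. **Thick distributions.** $\mathcal D'_{*,\Sigma}(\Omega)$ is the topological dual of $\mathcal D_{*,\Sigma}(\Omega)$. The map $\Pi:\mathcal D'_{*,\Sigma}(\Omega)\to\mathcal D'(\Omega)$ is the transpose of the inclusion $\mathcal D(\Omega)\to\mathcal D_{*,\Sigma}(\Omega)$. For $\alpha\in\mathbb{N}^n$ and $\psi\in\mathcal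 E_{*,\Sigma}(\Omega)$ put $\langle\partial_*^\alpha f,\phi\rangle=(-1)^{|\alpha|}\langle f,\partial^\alpha\phi\rangle$ and $\langle\psi f,\phi\rangle=\langle f,\psi\phi\rangle$; $\bar\partial^\alpha$ is the usual distributional derivative on $\mathcal D'(\Omega)$. **Proposition.** The operations $\Pi$, $\partial_*^\alpha$ and $f\mapsto\psi f$ are well defined, $\mathcal E_{*,\Sigma}(\Omega)$ is closed under $\partial^\alpha$, and for every $f\in\mathcal D'_{*,\Sigma}(\Omega)$ and $\alpha\in\mathbb N^n$, $$\Pi(\partial_*^\alpha f)=\bar\partial^\alpha\,\Pi(f),$$ and, for every $\psi\in\mathcal E_{*,\Sigma}(\Omega)$, $$\partial_*^\alpha(\psi f)=\sum_{\beta\le\alpha}\binom{\alpha}{\beta}\,(\partial^\beta\psi)\,\partial_*^{\alpha-\beta}f .$$ -/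

import Mathlib

open Set Metric TopologicalSpace
open scoped ContDiff Distributions Topology ENNReal

namespace ThickDist

noncomputable section

/-- The Euclidean space `ℝⁿ`. -/
abbrev Eu (n : ℕ) := EuclideanSpace ℝ (Fin n)

/-! ### Partial derivatives -/

/-- The classical partial derivative `∂φ/∂xᵢ`. -/
def pderiv {n : ℕ} (i : Fin n) (φ : Eu n → ℂ) : Eu n → ℂ :=
  fun x => fderiv ℝ φ x (EuclideanSpace.single i 1)

/-- The classical partial derivative `∂^α φ/∂x^α` for a multi-index `α`. -/
def mderiv {n : ℕ} (α : Fin n → ℕ) (φ : Eu n → ℂ) : Eu n → ℂ :=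
  (List.finRange n).foldr (fun i g => (pderiv i)^[α i] g) φ

/-- The length `|α|` of a multi-index. -/
def mlen {n : ℕ} (α : Fin n → ℕ) : ℕ := ∑ i, α i

theorem pderiv_smooth {n : ℕ} {O : Set (Eu n)} (hO : IsOpen O) (i : Fin n) {f : Eu n → ℂ}
    (hf : ContDiffOn ℝ ∞ f O) : ContDiffOn ℝ ∞ (pderiv i f) O :=
  (hf.fderiv_of_isOpen hO (by simp)).clm_apply contDiffOn_const

theorem pderiv_comb {n : ℕ} {O : Set (Eu n)} (hO : IsOpen O) (i : Fin n) {f g h : Eu n → ℂ}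
    (hf : ContDiffOn ℝ ∞ f O) (hg : ContDiffOn ℝ ∞ g O) (a b : ℂ)
    (hh : EqOn h (fun x => a * f x + b * g x) O) :
    EqOn (pderiv i h) (fun x => a * pderiv i f x + b * pderiv i g x) O := by
  intro x hx
  have hfx : DifferentiableAt ℝ f x :=
    (hf.contDiffAt (hO.mem_nhds hx)).differentiableAt (by simp)
  have hgx : DifferentiableAt ℝ g x :=
    (hg.contDiffAt (hO.mem_nhds hx)).differentiableAt (by simp)
  have hev : h =ᶠ[𝓝 x] fun x => a * f x + b * g x :=
    Filter.eventuallyEq_of_mem (hO.mem_nhds hx) hh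
  have hd : HasFDerivAt (fun x => a * f x + b * g x)
      (a • fderiv ℝ f x + b • fderiv ℝ g x) x :=
    (hfx.hasFDerivAt.const_mul a).add (hgx.hasFDerivAt.const_mul b)
  simp only [pderiv]
  rw [hev.fderiv_eq, hd.fderiv]
  simp

theorem pderiv_iter_comb {n : ℕ} {O : Set (Eu n)} (hO : IsOpen O) (i : Fin n) (a b : ℂ) (k : ℕ) :
    ∀ {f g h : Eu n → ℂ}, ContDiffOn ℝ ∞ f O → ContDiffOn ℝ ∞ g O →
      EqOn h (fun x => a * f x + b * g x) O →
      ContDiffOn ℝ ∞ ((pderiv i)^[k] f) O ∧ ContDiffOn ℝ ∞ ((pderiv i)^[k] g) O ∧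
      EqOn ((pderiv i)^[k] h)
        (fun x => a * (pderiv i)^[k] f x + b * (pderiv i)^[k] g x) O := by
  induction k with
  | zero => intro f g h hf hg hh; exact ⟨hf, hg, hh⟩
  | succ k ih =>
    intro f g h hf hg hh
    simp only [Function.iterate_succ, Function.comp_apply]
    exact ih (pderiv_smooth hO i hf) (pderiv_smooth hO i hg) (pderiv_comb hO i hf hg a b hh)

theorem mderiv_comb {n : ℕ} {O : Set (Eu n)} (hO : IsOpen O) (α : Fin n → ℕ) (a b : ℂ)
    {f g h : Eu n → ℂ} (hf : ContDiffOn ℝ ∞ f O) (hg : ContDiffOn ℝ ∞ g O)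
    (hh : EqOn h (fun x => a * f x + b * g x) O) :
    EqOn (mderiv α h) (fun x => a * mderiv α f x + b * mderiv α g x) O := by
  have key : ∀ l : List (Fin n),
      ContDiffOn ℝ ∞ (l.foldr (fun i g => (pderiv i)^[α i] g) f) O ∧
      ContDiffOn ℝ ∞ (l.foldr (fun i g => (pderiv i)^[α i] g) g) O ∧
      EqOn (l.foldr (fun i g => (pderiv i)^[α i] g) h)
        (fun x => a * l.foldr (fun i g => (pderiv i)^[α i] g) f x +
          b * l.foldr (fun i g => (pderiv i)^[α i] g) g x) O := by
    intro l
    induction l with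
    | nil => exact ⟨hf, hg, hh⟩
    | cons i l ih =>
      simp only [List.foldr_cons]
      exact pderiv_iter_comb hO i a b (α i) ih.1 ih.2.1 ih.2.2
  exact (key _).2.2

/-! ### Submanifolds and tubular coordinates -/

/-- `S ⊆ ℝⁿ` is a smooth (embedded, boundaryless) submanifold of codimension `d`. -/
def IsSubmanifold {n : ℕ} (S : Set (Eu n)) (d : ℕ) : Prop :=
  ∀ ξ ∈ S, ∃ V : Set (Eu n), IsOpen V ∧ ξ ∈ V ∧ ∃ g : Eu n → Eu d,
    ContDiffOn ℝ ∞ g V ∧ (∀ x ∈ V, Function.Surjective (fderiv ℝ g x)) ∧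
      S ∩ V = {x ∈ V | g x = 0}

/-- The tangent space `T_ξ(S)`: the span of the tangent cone (for a submanifold the tangent cone
is already a linear space). -/
def tangentSp {n : ℕ} (S : Set (Eu n)) (ξ : Eu n) : Submodule ℝ (Eu n) :=
  Submodule.span ℝ (tangentConeAt ℝ S ξ)

/-- The normal space `N_ξ(S)`. -/
def normalSp {n : ℕ} (S : Set (Eu n)) (ξ : Eu n) : Submodule ℝ (Eu n) := (tangentSp S ξ)ᗮ

/-- The `ε`-neighbourhood of `S` for a function `ε` on `S`. -/
def tube {n : ℕ} (S : Set (Eu n)) (ε : Eu n → ℝ) : Set (Eu n) :=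
  {x | ∃ ξ ∈ S, ‖x - ξ‖ < ε ξ}

/-- A tubular neighbourhood of `S`: an `ε`-neighbourhood on which the nearest point projection
onto `S` is well defined, smooth and submersive. -/
structure TubularNbhd {n : ℕ} (S : Set (Eu n)) where
  eps : Eu n → ℝ
  eps_pos : ∀ ξ ∈ S, 0 < eps ξ
  eps_cont : ContinuousOn eps S
  proj : Eu n → Eu n
  proj_mem : ∀ x ∈ tube S eps, proj x ∈ S
  proj_closest : ∀ x ∈ tube S eps, ∀ y ∈ S, y ≠ proj x → ‖x - proj x‖ < ‖x - y‖
  proj_smooth : ContDiffOn ℝ ∞ proj (tube S eps)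
  proj_submersion : ∀ x ∈ tube S eps,
    LinearMap.range (fderiv ℝ proj x : Eu n →ₗ[ℝ] Eu n) = tangentSp S (proj x)

/-- The distance coordinate `ρ_x = ‖x - π(x)‖`. -/
def TubularNbhd.rho {n : ℕ} {S : Set (Eu n)} (T : TubularNbhd S) (x : Eu n) : ℝ :=
  ‖x - T.proj x‖

/-- The angular coordinate `ω_x` with respect to a frame `e₁, …, e_d` of the normal spaces. -/
def TubularNbhd.omega {n d : ℕ} {S : Set (Eu n)} (T : TubularNbhd S) (e : Fin d → Eu n → Eu n)
    (x : Eu n) : Eu d :=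
  WithLp.toLp 2 fun k => inner ℝ (e k (T.proj x)) (x - T.proj x) / T.rho x

/-- A tubular neighbourhood of `S` together with a countable family of bounded open sets
`U ν ⊆ S^ε` covering `S`, each equipped with a smooth orthonormal frame of the normal spaces and
with tube coordinates `(ξ, ω, ρ) ∈ (S ∩ U ν) × 𝕊^{d-1} × (0, ρ_ν)`, whose inverse is
`x ↦ (π(x), ω_x, ρ_x)` (both maps are then smooth).
Smoothness on a subset of the submanifold `S` is `ContDiffOn`, which there means being locally the
restriction of a smooth function on an open subset of `ℝⁿ`. -/
structure TubularSystem {n : ℕ} (S : Set (Eu n)) (d : ℕ) extends TubularNbhd S where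
  U : ℕ → Set (Eu n)
  U_open : ∀ ν, IsOpen (U ν)
  U_bounded : ∀ ν, Bornology.IsBounded (U ν)
  U_sub : ∀ ν, U ν ⊆ tube S eps
  U_cover : S ⊆ ⋃ ν, U ν
  U_meets : ∀ ν, (S ∩ U ν).Nonempty
  frame : ℕ → Fin d → Eu n → Eu n
  frame_smooth : ∀ ν k, ContDiffOn ℝ ∞ (frame ν k) (S ∩ U ν)
  frame_orthonormal : ∀ ν, ∀ ξ ∈ S ∩ U ν, Orthonormal ℝ fun k => frame ν k ξ
  frame_span : ∀ ν, ∀ ξ ∈ S ∩ U ν,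
    Submodule.span ℝ (range fun k => frame ν k ξ) = normalSp S ξ
  radius : ℕ → ℝ
  radius_pos : ∀ ν, 0 < radius ν
  coord_bij : ∀ ν, BijOn
    (fun p : Eu n × Eu d × ℝ => p.1 + p.2.2 • ∑ k, p.2.1 k • frame ν k p.1)
    ((S ∩ U ν) ×ˢ (sphere (0 : Eu d) 1 ×ˢ Ioo 0 (radius ν))) (U ν \ S)
  coord_inv : ∀ ν, LeftInvOn
    (fun x => (proj x, toTubularNbhd.omega (frame ν) x, toTubularNbhd.rho x))
    (fun p : Eu n × Eu d × ℝ => p.1 + p.2.2 • ∑ k, p.2.1 k • frame ν k p.1)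
    ((S ∩ U ν) ×ˢ (sphere (0 : Eu d) 1 ×ˢ Ioo 0 (radius ν)))

section

variable {n d : ℕ} {S : Set (Eu n)} (T : TubularSystem S d)

/-- The function `x ↦ a(ξ_x, ω_x) ρ_x^j`, meaningful on `U ν \ S`. -/
def TubularSystem.term (ν : ℕ) (a : Eu n × Eu d → ℂ) (j : ℤ) (x : Eu n) : ℂ :=
  a (T.proj x, T.omega (T.frame ν) x) * (T.rho x : ℂ) ^ j

/-- The uniform strong asymptotic expansion `φ(x) ∼ ∑_{j ≥ m} a_j(ξ_x, ω_x) ρ_x^j` as `ρ_x → 0`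
on `U ν \ S`: the `a_j` are smooth on `(S ∩ U ν) × 𝕊^{d-1}` (with the convention `a_j = 0` for
`j < m`), and for every `α` the expansion may be differentiated termwise, the remainder after the
terms with `j < N` being `O(ρ_x^{N - |α|})` uniformly. -/
structure TubularSystem.StrongExp (ν : ℕ) (φ : Eu n → ℂ) (m : ℤ)
    (a : ℤ → Eu n × Eu d → ℂ) : Prop where
  smooth : ∀ j, ContDiffOn ℝ ∞ (a j) ((S ∩ T.U ν) ×ˢ sphere (0 : Eu d) 1)
  eq_zero : ∀ j < m, ∀ p ∈ (S ∩ T.U ν) ×ˢ sphere (0 : Eu d) 1, a j p = 0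
  remainder : ∀ (α : Fin n → ℕ) (N : ℤ), ∃ C δ : ℝ, 0 < δ ∧ ∀ x ∈ T.U ν \ S, T.rho x < δ →
    ‖mderiv α φ x - ∑ j ∈ Finset.Ico m N, mderiv α (T.term ν (a j) j) x‖
      ≤ C * T.rho x ^ (N - (mlen α : ℤ))

variable {T}

theorem TubularSystem.diff_open (hS : IsClosed S) (ν : ℕ) : IsOpen (T.U ν \ S) :=
  (T.U_open ν).sdiff hS

theorem TubularSystem.coord_mem {ν : ℕ} {x : Eu n} (hx : x ∈ T.U ν \ S) :
    (T.proj x, T.omega (T.frame ν) x) ∈ (S ∩ T.U ν) ×ˢ sphere (0 : Eu d) 1 ∧ 0 < T.rho x := by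
  obtain ⟨p, hp, rfl⟩ := (T.coord_bij ν).surjOn hx
  have h := T.coord_inv ν hp
  simp only [Prod.ext_iff] at h
  obtain ⟨h1, h2, h3⟩ := h
  refine ⟨⟨?_, ?_⟩, ?_⟩
  · simpa only [h1] using hp.1
  · simpa only [h2] using hp.2.1
  · rw [h3]; exact hp.2.2.1

theorem TubularSystem.term_smooth {ν : ℕ} {a : Eu n × Eu d → ℂ}
    (ha : ContDiffOn ℝ ∞ a ((S ∩ T.U ν) ×ˢ sphere (0 : Eu d) 1)) (j : ℤ) :
    ContDiffOn ℝ ∞ (T.term ν a j) (T.U ν \ S) := by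
  have hpi : ContDiffOn ℝ ∞ T.proj (T.U ν \ S) :=
    T.proj_smooth.mono (sdiff_subset.trans (T.U_sub ν))
  have hsub : ContDiffOn ℝ ∞ (fun x => x - T.proj x) (T.U ν \ S) := contDiffOn_id.sub hpi
  have hne : ∀ x ∈ T.U ν \ S, x - T.proj x ≠ 0 := fun x hx =>
    norm_pos_iff.1 (TubularSystem.coord_mem hx).2
  have hrho : ContDiffOn ℝ ∞ T.rho (T.U ν \ S) := hsub.norm ℝ hne
  have hrho0 : ∀ x ∈ T.U ν \ S, T.rho x ≠ 0 := fun x hx => (TubularSystem.coord_mem hx).2.ne'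
  have hom : ContDiffOn ℝ ∞ (T.omega (T.frame ν)) (T.U ν \ S) := by
    rw [contDiffOn_euclidean]
    intro k
    refine ContDiffOn.div (ContDiffOn.inner ℝ ?_ hsub) hrho hrho0
    exact (T.frame_smooth ν k).comp hpi fun x hx => (TubularSystem.coord_mem hx).1.1
  refine ContDiffOn.mul (ha.comp (hpi.prodMk hom) fun x hx => (TubularSystem.coord_mem hx).1) ?_
  have hc : ContDiffOn ℝ ∞ (fun x => (T.rho x : ℂ)) (T.U ν \ S) :=
    Complex.ofRealCLM.contDiff.comp_contDiffOn hrho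
  have hc0 : ∀ x ∈ T.U ν \ S, (T.rho x : ℂ) ≠ 0 := fun x hx =>
    Complex.ofReal_ne_zero.2 (hrho0 x hx)
  cases j with
  | ofNat k => simpa using hc.pow k
  | negSucc k =>
    simp only [zpow_negSucc]
    exact (hc.pow (k + 1)).inv fun x hx => pow_ne_zero _ (hc0 x hx)

end

section

variable {n d : ℕ} {S : Set (Eu n)}

/-- Functions on `Ω \ S` are identified with their extensions by zero to `ℝⁿ`; this is the partial
derivative `∂^α` of such a function. -/
def derivOff (S : Set (Eu n)) (Ω : Opens (Eu n)) (α : Fin n → ℕ) (φ : Eu n → ℂ) : Eu n → ℂ :=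
  ((Ω : Set (Eu n)) \ S).indicator (mderiv α φ)

/-- `φ` belongs to `𝒟_*^{[m;K]}(Ω)`: it is smooth on `Ω \ S`, vanishes outside `K`, and has strong
asymptotic expansions starting at `m` on all `U ν \ S`. -/
structure IsStep (T : TubularSystem S d) (Ω : Opens (Eu n)) (m : ℤ) (K : Compacts (Eu n))
    (φ : Eu n → ℂ) : Prop where
  smooth : ContDiffOn ℝ ∞ φ ((Ω : Set (Eu n)) \ S)
  eq_zero : ∀ x ∉ (K : Set (Eu n)) \ S, φ x = 0
  expansion : ∀ ν, ∃ a, T.StrongExp ν φ m a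

theorem IsStep.smooth_compl {T : TubularSystem S d} {Ω : Opens (Eu n)} {m : ℤ}
    {K : Compacts (Eu n)} {φ : Eu n → ℂ} (hS : IsClosed S) (hK : (K : Set (Eu n)) ⊆ Ω)
    (h : IsStep T Ω m K φ) : ContDiffOn ℝ ∞ φ Sᶜ := by
  intro x hx
  by_cases hxK : x ∈ (K : Set (Eu n))
  · exact (h.smooth.contDiffAt ((Ω.isOpen.sdiff hS).mem_nhds ⟨hK hxK, hx⟩)).contDiffWithinAt
  · have : φ =ᶠ[𝓝 x] fun _ => 0 := by
      filter_upwards [K.isCompact.isClosed.isOpen_compl.mem_nhds hxK] with y hy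
      exact h.eq_zero y fun hy' => hy hy'.1
    exact ((contDiffAt_const (c := (0 : ℂ))).congr_of_eventuallyEq this).contDiffWithinAt

theorem IsStep.comb {T : TubularSystem S d} {Ω : Opens (Eu n)} {m : ℤ}
    {K : Compacts (Eu n)} {φ ψ : Eu n → ℂ} (hS : IsClosed S) (hK : (K : Set (Eu n)) ⊆ Ω)
    (hφ : IsStep T Ω m K φ) (hψ : IsStep T Ω m K ψ) (c e : ℂ) :
    IsStep T Ω m K (fun x => c * φ x + e * ψ x) where
  smooth := (contDiffOn_const.mul hφ.smooth).add (contDiffOn_const.mul hψ.smooth)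
  eq_zero x hx := by simp [hφ.eq_zero x hx, hψ.eq_zero x hx]
  expansion ν := by
    obtain ⟨a, ha⟩ := hφ.expansion ν
    obtain ⟨b, hb⟩ := hψ.expansion ν
    refine ⟨fun j p => c * a j p + e * b j p, fun j => ?_, fun j hj p hp => ?_, fun α N => ?_⟩
    · exact (contDiffOn_const.mul (ha.smooth j)).add (contDiffOn_const.mul (hb.smooth j))
    · simp [ha.eq_zero j hj p hp, hb.eq_zero j hj p hp]
    · obtain ⟨C₁, δ₁, h₁, H₁⟩ := ha.remainder α N
      obtain ⟨C₂, δ₂, h₂, H₂⟩ := hb.remainder α N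
      refine ⟨‖c‖ * C₁ + ‖e‖ * C₂, min δ₁ δ₂, lt_min h₁ h₂, fun x hx hr => ?_⟩
      have e1 := mderiv_comb (TubularSystem.diff_open (T := T) hS ν) α c e
        ((hφ.smooth_compl hS hK).mono fun y hy => hy.2)
        ((hψ.smooth_compl hS hK).mono fun y hy => hy.2)
        (h := fun x => c * φ x + e * ψ x) (fun y _ => rfl) hx
      have e2 : ∀ j, mderiv α (T.term ν (fun p => c * a j p + e * b j p) j) x =
          c * mderiv α (T.term ν (a j) j) x + e * mderiv α (T.term ν (b j) j) x := fun j =>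
        mderiv_comb (TubularSystem.diff_open (T := T) hS ν) α c e
          (TubularSystem.term_smooth (ha.smooth j) j) (TubularSystem.term_smooth (hb.smooth j) j)
          (fun y _ => by simp only [TubularSystem.term]; ring) hx
      rw [e1, Finset.sum_congr rfl fun j _ => e2 j, Finset.sum_add_distrib, ← Finset.mul_sum,
        ← Finset.mul_sum]
      have e3 : ∀ p q r s : ℂ, c * p + e * q - (c * r + e * s) = c * (p - r) + e * (q - s) := by
        intros; ring
      rw [e3]
      refine (norm_add_le _ _).trans ?_
      rw [norm_mul, norm_mul, add_mul, mul_assoc, mul_assoc]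
      gcongr
      · exact H₁ x hx (hr.trans_le (min_le_left _ _))
      · exact H₂ x hx (hr.trans_le (min_le_right _ _))

theorem IsStep.mono {T : TubularSystem S d} {Ω : Opens (Eu n)} {m m' : ℤ}
    {K K' : Compacts (Eu n)} {φ : Eu n → ℂ} (hS : IsClosed S)
    (hφ : IsStep T Ω m K φ) (hm : m' ≤ m) (hK : K ≤ K') : IsStep T Ω m' K' φ where
  smooth := hφ.smooth
  eq_zero x hx := hφ.eq_zero x fun h => hx ⟨hK h.1, h.2⟩
  expansion ν := by
    obtain ⟨a, ha⟩ := hφ.expansion ν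
    refine ⟨a, ha.smooth, fun j hj => ha.eq_zero j (hj.trans_le hm), fun α N => ?_⟩
    obtain ⟨C, δ, h, H⟩ := ha.remainder α N
    refine ⟨C, δ, h, fun x hx hr => ?_⟩
    rw [← Finset.sum_subset (Finset.Ico_subset_Ico_left hm)]
    · exact H x hx hr
    · intro j hj hj'
      have hjm : j < m := by
        simp only [Finset.mem_Ico] at hj hj'; omega
      have := mderiv_comb (TubularSystem.diff_open (T := T) hS ν) α 0 0
        (contDiffOn_const (c := (0 : ℂ))) (contDiffOn_const (c := (0 : ℂ)))
        (h := T.term ν (a j) j) (fun y hy => by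
          simp [TubularSystem.term, ha.eq_zero j hjm _ (TubularSystem.coord_mem hy).1]) hx
      simpa using this

theorem IsStep.zero (T : TubularSystem S d) (Ω : Opens (Eu n)) (hS : IsClosed S) :
    IsStep T Ω 0 ⊥ 0 where
  smooth := contDiffOn_const
  eq_zero _ _ := rfl
  expansion ν := by
    refine ⟨0, fun j => contDiffOn_const, fun _ _ _ _ => rfl, fun α N => ⟨0, 1, one_pos, ?_⟩⟩
    intro x hx _
    have hz : ∀ h : Eu n → ℂ, EqOn h (fun _ => 0) (T.U ν \ S) → mderiv α h x = 0 := fun h hh => by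
      have := mderiv_comb (TubularSystem.diff_open (T := T) hS ν) α 0 0
        (contDiffOn_const (c := (0 : ℂ))) (contDiffOn_const (c := (0 : ℂ)))
        (h := h) (fun y hy => by simp [hh hy]) hx
      simpa using this
    rw [hz 0 fun _ _ => rfl, Finset.sum_eq_zero fun j _ => hz _ fun y _ => by
      simp [TubularSystem.term]]
    simp

/-- The space `𝒟_{*,S}(Ω) = ⋃_{m,K} 𝒟_*^{[m;K]}(Ω)` as a linear space of functions. -/
def testSubmodule (hS : IsClosed S) (T : TubularSystem S d) (Ω : Opens (Eu n)) :
    Submodule ℂ (Eu n → ℂ) where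
  carrier := {φ | ∃ (m : ℤ) (K : Compacts (Eu n)), (K : Set (Eu n)) ⊆ Ω ∧ IsStep T Ω m K φ}
  zero_mem' := ⟨0, ⊥, by simp, IsStep.zero T Ω hS⟩
  add_mem' := by
    rintro φ ψ ⟨m, K, hK, hφ⟩ ⟨m', K', hK', hψ⟩
    have hKK : ((K ⊔ K' : Compacts (Eu n)) : Set (Eu n)) ⊆ Ω := by
      rw [Compacts.coe_sup]; exact union_subset hK hK'
    refine ⟨min m m', K ⊔ K', hKK, ?_⟩
    have := IsStep.comb hS hKK (hφ.mono hS (min_le_left m m') (le_sup_left (b := K')))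
      (hψ.mono hS (min_le_right m m') (le_sup_right (a := K))) 1 1
    simp only [one_mul] at this
    exact this
  smul_mem' := by
    rintro c φ ⟨m, K, hK, hφ⟩
    refine ⟨m, K, hK, ?_⟩
    have := IsStep.comb hS hK hφ hφ c 0
    simp only [zero_mul, add_zero] at this
    exact this

/-- The space of test functions `𝒟_{*,S}(Ω)`. -/
def ThickTest (hS : IsClosed S) (T : TubularSystem S d) (Ω : Opens (Eu n)) : Type :=
  testSubmodule hS T Ω

instance (hS : IsClosed S) (T : TubularSystem S d) (Ω : Opens (Eu n)) :
    AddCommGroup (ThickTest hS T Ω) :=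
  inferInstanceAs (AddCommGroup (testSubmodule hS T Ω))

instance (hS : IsClosed S) (T : TubularSystem S d) (Ω : Opens (Eu n)) :
    Module ℂ (ThickTest hS T Ω) :=
  inferInstanceAs (Module ℂ (testSubmodule hS T Ω))

instance (hS : IsClosed S) (T : TubularSystem S d) (Ω : Opens (Eu n)) :
    Module ℝ (ThickTest hS T Ω) :=
  inferInstanceAs (Module ℝ (testSubmodule hS T Ω))

/-! ### The topology of the test function space -/

open Classical in
/-- The coefficients `a_j^{φ,ν}` of the strong asymptotic expansion of `φ` on `U ν \ S`
(on `(S ∩ U ν) × 𝕊^{d-1}` they are uniquely determined by `φ`). -/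
def coeff (T : TubularSystem S d) (ν : ℕ) (φ : Eu n → ℂ) : ℤ → Eu n × Eu d → ℂ :=
  if h : ∃ (m : ℤ) (a : ℤ → Eu n × Eu d → ℂ), T.StrongExp ν φ m a then h.choose_spec.choose else 0

/-- The seminorm `‖φ‖_{q,k,ν,K,m}` on `𝒟_*^{[m;K]}(Ω)`; here `coeff T ν (mderiv α φ) j` is the
`j`-th coefficient of the expansion of `∂^α φ`. -/
def stepNorm (T : TubularSystem S d) (m : ℤ) (K : Compacts (Eu n)) (q : ℤ) (k ν : ℕ)
    (φ : Eu n → ℂ) : ℝ≥0∞ :=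
  (⨆ (α : Fin n → ℕ) (_ : mlen α ≤ k) (x : Eu n) (_ : x ∈ ((K : Set (Eu n)) ∩ T.U ν) \ S),
    ENNReal.ofReal (T.rho x ^ (-q) * ‖mderiv α φ x -
      ∑ j ∈ Finset.Ico (m - (mlen α : ℤ)) q, T.term ν (coeff T ν (mderiv α φ) j) j x‖)) +
  (⨆ (α : Fin n → ℕ) (_ : mlen α ≤ k) (x : Eu n) (_ : x ∈ (K : Set (Eu n)) \ ⋃ μ, T.U μ),
    ENNReal.ofReal ‖mderiv α φ x‖)

/-- The space `𝒟_*^{[m;K]}(Ω)`. -/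
def Step (T : TubularSystem S d) (Ω : Opens (Eu n)) (m : ℤ) (K : Compacts (Eu n)) : Type :=
  {φ : Eu n → ℂ // IsStep T Ω m K φ}

/-- The topology of `𝒟_*^{[m;K]}(Ω)`, generated by the open balls of the seminorms. -/
instance (T : TubularSystem S d) (Ω : Opens (Eu n)) (m : ℤ) (K : Compacts (Eu n)) :
    TopologicalSpace (Step T Ω m K) :=
  generateFrom {B | ∃ (φ : Step T Ω m K) (q : ℤ) (k ν : ℕ) (r : ℝ≥0∞), 0 < r ∧
    B = {ψ : Step T Ω m K | stepNorm T m K q k ν (ψ.1 - φ.1) < r}}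

/-- The inclusion of `𝒟_*^{[m;K]}(Ω)` into `𝒟_{*,S}(Ω)`. -/
def Step.incl (hS : IsClosed S) {T : TubularSystem S d} {Ω : Opens (Eu n)} (m : ℤ)
    {K : Compacts (Eu n)} (hK : (K : Set (Eu n)) ⊆ Ω) (φ : Step T Ω m K) : ThickTest hS T Ω :=
  ⟨φ.1, m, K, hK, φ.2⟩

/-- The inductive limit topology of `𝒟_{*,S}(Ω)`: the finest locally convex vector space topology
for which all inclusions of the spaces `𝒟_*^{[m;K]}(Ω)` are continuous. -/
instance (hS : IsClosed S) (T : TubularSystem S d) (Ω : Opens (Eu n)) :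
    TopologicalSpace (ThickTest hS T Ω) :=
  sInf {t : TopologicalSpace (ThickTest hS T Ω) |
    (∀ (m : ℤ) (K : Compacts (Eu n)) (hK : (K : Set (Eu n)) ⊆ Ω),
      @Continuous (Step T Ω m K) (ThickTest hS T Ω) _ t (Step.incl hS m hK)) ∧
    @IsTopologicalAddGroup (ThickTest hS T Ω) t _ ∧
    @ContinuousSMul ℂ (ThickTest hS T Ω) _ _ t ∧
    @LocallyConvexSpace ℝ (ThickTest hS T Ω) _ _ _ _ t}

/-! ### Thick distributions -/

/-- The space `𝒟'_{*,S}(Ω)` of thick distributions: the topological dual of `𝒟_{*,S}(Ω)`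
(with Mathlib's topology of bounded convergence, i.e. the strong dual topology). -/
abbrev ThickDistribution (hS : IsClosed S) (T : TubularSystem S d) (Ω : Opens (Eu n)) :=
  ThickTest hS T Ω →L[ℂ] ℂ

/-- `g` is the transpose image of `f` under `A : V → 𝒟_{*,S}(Ω)`: the function `A v` is a test
function and `⟨g, v⟩ = ⟨f, A v⟩` for all `v`. -/
def IsTranspose {hS : IsClosed S} {T : TubularSystem S d} {Ω : Opens (Eu n)}
    {V : Type} [AddCommGroup V] [Module ℂ V] [TopologicalSpace V] (A : V → Eu n → ℂ)
    (f : ThickDistribution hS T Ω) (g : V →L[ℂ] ℂ) : Prop :=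
  ∀ v, ∃ h : A v ∈ testSubmodule hS T Ω, g v = f ⟨A v, h⟩

open Classical in
/-- The functional `v ↦ ⟨f, A v⟩`, for `A : V → 𝒟_{*,S}(Ω)`. -/
def transpose {hS : IsClosed S} {T : TubularSystem S d} {Ω : Opens (Eu n)}
    {V : Type} [AddCommGroup V] [Module ℂ V] [TopologicalSpace V] (A : V → Eu n → ℂ)
    (f : ThickDistribution hS T Ω) : V →L[ℂ] ℂ :=
  if h : ∃ g, IsTranspose A f g then h.choose else 0

/-- The inclusion `ι : 𝒟(Ω) → 𝒟_{*,S}(Ω)`, i.e. restriction of functions to the complement of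
`S`. -/
def restrictOff (S : Set (Eu n)) (Ω : Opens (Eu n)) (φ : 𝓓(Ω, ℂ)) : Eu n → ℂ :=
  ((Ω : Set (Eu n)) \ S).indicator φ

/-- The projection `Π : 𝒟'_{*,S}(Ω) → 𝒟'(Ω)`, the transpose of the inclusion. -/
def thickProj {hS : IsClosed S} {T : TubularSystem S d} {Ω : Opens (Eu n)}
    (f : ThickDistribution hS T Ω) : 𝓓(Ω, ℂ) →L[ℂ] ℂ :=
  transpose (restrictOff S Ω) f

/-- The thick derivative `∂_*^α f`, with `⟨∂_*^α f, φ⟩ = (-1)^{|α|} ⟨f, ∂^α φ⟩`. -/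
def thickDeriv {hS : IsClosed S} {T : TubularSystem S d} {Ω : Opens (Eu n)} (α : Fin n → ℕ)
    (f : ThickDistribution hS T Ω) : ThickDistribution hS T Ω :=
  (-1 : ℂ) ^ mlen α • transpose (fun φ : ThickTest hS T Ω => derivOff S Ω α φ.1) f

/-- The product `ψ f`, with `⟨ψ f, φ⟩ = ⟨f, ψ φ⟩`. -/
def thickMul {hS : IsClosed S} {T : TubularSystem S d} {Ω : Opens (Eu n)} (ψ : Eu n → ℂ)
    (f : ThickDistribution hS T Ω) : ThickDistribution hS T Ω :=
  transpose (fun φ : ThickTest hS T Ω => ψ * φ.1) f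

/-- The space `ℰ_{*,S}(Ω)`, its elements being extended by zero to `ℝⁿ`. -/
def multipliers (hS : IsClosed S) (T : TubularSystem S d) (Ω : Opens (Eu n)) :
    Set (Eu n → ℂ) :=
  {ψ | ContDiffOn ℝ ∞ ψ ((Ω : Set (Eu n)) \ S) ∧ (∀ x ∉ (Ω : Set (Eu n)) \ S, ψ x = 0) ∧
    ∀ φ : 𝓓(Ω, ℂ), (fun x => φ x * ψ x) ∈ testSubmodule hS T Ω}

/-- The partial derivative `∂^α` on the classical test function space `𝒟(Ω)`. -/
def testDeriv (Ω : Opens (Eu n)) (α : Fin n → ℕ) : 𝓓(Ω, ℂ) →L[ℂ] 𝓓(Ω, ℂ) :=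
  ((List.finRange n).map fun i =>
    (TestFunction.lineDerivCLM ℂ (EuclideanSpace.single i 1) : 𝓓(Ω, ℂ) →L[ℂ] 𝓓(Ω, ℂ)) ^ α i).prod

/-- The distributional derivative `⟨∂̄^α u, φ⟩ = (-1)^{|α|} ⟨u, ∂^α φ⟩` of a classical
distribution. -/
def distDeriv {Ω : Opens (Eu n)} (α : Fin n → ℕ) (u : 𝓓(Ω, ℂ) →L[ℂ] ℂ) : 𝓓(Ω, ℂ) →L[ℂ] ℂ :=
  (-1 : ℂ) ^ mlen α • u.comp (testDeriv Ω α)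

end

end

end ThickDist

open Set Metric TopologicalSpace
open scoped ContDiff Distributions Topology ENNReal

namespace ThickDist

noncomputable section

/-! ### Calculus of partial derivatives on open sets -/

section PartialDerivatives

variable {n : ℕ} {O : Set (Eu n)}

/-! Everything is duality: if a linear operator A on test functions is continuous, then f ∘ A is
again a continuous functional, and both identities become identities between operators on test
functions. Restriction to the complement of S commutes with ∂^α because a derivative on the open set
Ω \ S sees only nearby values (`derivOff_restrictOff`); this is the statement about Π. The Leibniz
rule transposes to ∑ C(α,β) (-1)^|α-β| ∂^(α-β)(∂^β ψ · φ) = (-1)^|α| ψ ∂^α φ. With x, y, x + y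
standing for differentiation of the first factor, of the second factor and of the product, this is
the binomial expansion of (-y)^α = (x - (x + y))^α (`binomial_prod`, `leibniz_transposed`).

The substance is that differentiation and multiplication preserve the test functions and are
continuous. A strong expansion may be differentiated termwise, but ∂_i(a_j ρ^j) is not again a
single term and must itself be expanded. The coefficients are therefore regarded as radial
functions, constant along the normal rays. A radial A satisfies A = A ∘ r_s, where r_s moves a point
along its ray to distance s from S, so ∂_i A = ∑_l ∂_i(r_s)_l · (∂_l A ∘ r_s). The second factor is
radial again, and the first is explicit, since r_s = π + s ρ⁻¹ (x - π) (`Expandable.pderiv_radial`).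
What remains to be expanded are functions smooth across S, by Taylor's formula at π(x) with a
remainder that may be differentiated (`OrdOn.taylorRem`), and powers of ρ, by differentiating ρ² =
|x - π(x)|² (`TubularSystem.pderiv_rhoPow`). Products are expanded by the Cauchy product
(`cauchy_identity`).

The definition of an expansion contains no bounds on the coefficients over the noncompact S ∩ U_ν.
They are recovered by writing a_j ρ^j as a difference of consecutive remainders (`HasExp.term_ord`)
and moving the resulting bounds along the rays (`IsRadial.ordOn_core`). Uniqueness of the
coefficients (`HasExp.unique`) makes the chosen ones in the seminorms computable.

Continuity of a functional may be tested on each step space (`continuous_of_incl`), seminorm by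
seminorm (`StepMap.continuous`). For products the Cauchy identity bounds each seminorm by finitely
many others (`Expandable.expRem_mul_bound`); on functions supported in K a multiplier acts as a test
function that agrees with it near K (`mul_isStep`). -/

theorem pderiv_congr (hO : IsOpen O) (i : Fin n) {f g : Eu n → ℂ} (h : EqOn f g O) :
    EqOn (pderiv i f) (pderiv i g) O := fun x hx => by
  simp only [pderiv]
  rw [(Filter.eventuallyEq_of_mem (hO.mem_nhds hx) h).fderiv_eq]

theorem pderiv_iter_congr (hO : IsOpen O) (i : Fin n) (k : ℕ) {f g : Eu n → ℂ} (h : EqOn f g O) :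
    EqOn ((pderiv i)^[k] f) ((pderiv i)^[k] g) O := by
  induction k with
  | zero => exact h
  | succ k ih =>
    simp only [Function.iterate_succ_apply']
    exact pderiv_congr hO i ih

theorem mderiv_congr (hO : IsOpen O) (α : Fin n → ℕ) {f g : Eu n → ℂ} (h : EqOn f g O) :
    EqOn (mderiv α f) (mderiv α g) O := by
  unfold mderiv
  induction List.finRange n with
  | nil => exact h
  | cons i l ih => exact pderiv_iter_congr hO i (α i) ih

theorem pderiv_iter_smooth (hO : IsOpen O) (i : Fin n) (k : ℕ) {f : Eu n → ℂ}
    (hf : ContDiffOn ℝ ∞ f O) : ContDiffOn ℝ ∞ ((pderiv i)^[k] f) O := by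
  induction k with
  | zero => exact hf
  | succ k ih =>
    simp only [Function.iterate_succ_apply']
    exact pderiv_smooth hO i ih

theorem mderiv_smooth (hO : IsOpen O) (α : Fin n → ℕ) {f : Eu n → ℂ}
    (hf : ContDiffOn ℝ ∞ f O) : ContDiffOn ℝ ∞ (mderiv α f) O := by
  unfold mderiv
  induction List.finRange n with
  | nil => exact hf
  | cons i l ih => exact pderiv_iter_smooth hO i (α i) ih

theorem pderiv_mul (hO : IsOpen O) (i : Fin n) {f g : Eu n → ℂ}
    (hf : ContDiffOn ℝ ∞ f O) (hg : ContDiffOn ℝ ∞ g O) :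
    EqOn (pderiv i (fun x => f x * g x)) (fun x => pderiv i f x * g x + f x * pderiv i g x) O := by
  intro x hx
  have hfx : DifferentiableAt ℝ f x :=
    (hf.contDiffAt (hO.mem_nhds hx)).differentiableAt (by simp)
  have hgx : DifferentiableAt ℝ g x :=
    (hg.contDiffAt (hO.mem_nhds hx)).differentiableAt (by simp)
  simp only [pderiv]
  rw [fderiv_fun_mul hfx hgx]
  simp
  ring

theorem pderiv_comm (hO : IsOpen O) (i j : Fin n) {f : Eu n → ℂ} (hf : ContDiffOn ℝ ∞ f O) :
    EqOn (pderiv i (pderiv j f)) (pderiv j (pderiv i f)) O := by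
  intro x hx
  have hc := hf.contDiffAt (hO.mem_nhds hx)
  have hd : DifferentiableAt ℝ (fderiv ℝ f) x :=
    (hc.fderiv_right (m := ∞) (by simp)).differentiableAt (by simp)
  have h := (contDiffAt_infty.1 hc 2).isSymmSndFDerivAt (by simp)
  have key : ∀ v w : Eu n, fderiv ℝ (fun y => fderiv ℝ f y v) x w = fderiv ℝ (fderiv ℝ f) x w v :=
    fun v w => by
      rw [fderiv_clm_apply hd (differentiableAt_const v)]
      simp
  show fderiv ℝ (fun y => fderiv ℝ f y _) x _ = fderiv ℝ (fun y => fderiv ℝ f y _) x _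
  rw [key, key]
  exact h _ _

theorem pderiv_fun_sum (hO : IsOpen O) (i : Fin n) {ι : Type*} (s : Finset ι) {f : ι → Eu n → ℂ}
    (hf : ∀ j ∈ s, ContDiffOn ℝ ∞ (f j) O) :
    EqOn (pderiv i (fun x => ∑ j ∈ s, f j x)) (fun x => ∑ j ∈ s, pderiv i (f j) x) O := by
  intro x hx
  simp only [pderiv]
  rw [fderiv_fun_sum fun j hj =>
    ((hf j hj).contDiffAt (hO.mem_nhds hx)).differentiableAt (by simp)]
  simp

theorem pderiv_const_mul (hO : IsOpen O) (i : Fin n) {f : Eu n → ℂ} (hf : ContDiffOn ℝ ∞ f O)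
    (c : ℂ) : EqOn (pderiv i (fun x => c * f x)) (fun x => c * pderiv i f x) O := by
  have := pderiv_comb hO i hf hf c 0 (h := fun x => c * f x) (fun x _ => by simp)
  simpa using this

theorem pderiv_sub (hO : IsOpen O) (i : Fin n) {f g : Eu n → ℂ}
    (hf : ContDiffOn ℝ ∞ f O) (hg : ContDiffOn ℝ ∞ g O) :
    EqOn (pderiv i (fun x => f x - g x)) (fun x => pderiv i f x - pderiv i g x) O := by
  have := pderiv_comb hO i hf hg 1 (-1) (h := fun x => f x - g x) (fun x _ => by ring)
  intro x hx
  rw [this hx]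
  ring

/-- The smooth functions on `O`, extended by zero. -/
def smoothOn (O : Set (Eu n)) : Submodule ℂ (Eu n → ℂ) where
  carrier := {f | ContDiffOn ℝ ∞ f O ∧ ∀ x ∉ O, f x = 0}
  zero_mem' := ⟨contDiffOn_const, fun _ _ => rfl⟩
  add_mem' := fun hf hg => ⟨hf.1.add hg.1, fun x hx => by simp [hf.2 x hx, hg.2 x hx]⟩
  smul_mem' := fun c f hf => ⟨contDiffOn_const.mul hf.1, fun x hx => by simp [hf.2 x hx]⟩

theorem indicator_mem_smoothOn {f : Eu n → ℂ} (hf : ContDiffOn ℝ ∞ f O) :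
    O.indicator f ∈ smoothOn O :=
  ⟨hf.congr fun _ hx => indicator_of_mem hx f, fun _ hx => indicator_of_notMem hx f⟩

/-- The partial derivative as an operator on the smooth functions on `O`. -/
def partialOp (hO : IsOpen O) (i : Fin n) : Module.End ℂ (smoothOn O) where
  toFun f := ⟨O.indicator (pderiv i f.1), indicator_mem_smoothOn (pderiv_smooth hO i f.2.1)⟩
  map_add' f g := by
    ext x
    by_cases hx : x ∈ O
    · have := pderiv_comb hO i f.2.1 g.2.1 1 1 (h := f.1 + g.1) (fun y _ => by simp) hx
      simpa [hx] using this
    · simp [hx]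
  map_smul' c f := by
    ext x
    by_cases hx : x ∈ O
    · have := pderiv_const_mul hO i f.2.1 c hx
      show O.indicator (pderiv i (c • f.1)) x = c * O.indicator (pderiv i f.1) x
      rw [indicator_of_mem hx, indicator_of_mem hx]
      exact this
    · simp [hx]

theorem partialOp_apply (hO : IsOpen O) (i : Fin n) (f : smoothOn O) :
    (partialOp hO i f : Eu n → ℂ) = O.indicator (pderiv i f.1) := rfl

theorem partialOp_commute (hO : IsOpen O) (i j : Fin n) :
    Commute (partialOp hO i) (partialOp hO j) := by
  refine LinearMap.ext fun f => Subtype.ext (funext fun x => ?_)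
  simp only [Module.End.mul_apply, partialOp_apply]
  by_cases hx : x ∈ O
  · have h : ∀ k, EqOn (O.indicator (pderiv k f.1)) (pderiv k f.1) O := fun k y hy =>
      indicator_of_mem hy _
    rw [indicator_of_mem hx, indicator_of_mem hx, pderiv_congr hO i (h j) hx,
      pderiv_congr hO j (h i) hx, pderiv_comm hO i j f.2.1 hx]
  · rw [indicator_of_notMem hx, indicator_of_notMem hx]

/-- The operator `∂^α` on the smooth functions on `O`. -/
def multiOp (hO : IsOpen O) (α : Fin n → ℕ) : Module.End ℂ (smoothOn O) :=
  ((List.finRange n).map fun i => partialOp hO i ^ α i).prod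

theorem partialOp_pow_apply (hO : IsOpen O) (i : Fin n) (k : ℕ) (f : smoothOn O) :
    ((partialOp hO i ^ k) f : Eu n → ℂ) = O.indicator ((pderiv i)^[k] f.1) := by
  induction k with
  | zero =>
    ext x
    by_cases hx : x ∈ O
    · simp [hx]
    · simp [hx, f.2.2 x hx]
  | succ k ih =>
    rw [pow_succ', Module.End.mul_apply, partialOp_apply, ih, Function.iterate_succ_apply']
    exact indicator_congr (pderiv_congr hO i fun y hy => indicator_of_mem hy _)

theorem multiOp_apply (hO : IsOpen O) (α : Fin n → ℕ) (f : smoothOn O) :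
    (multiOp hO α f : Eu n → ℂ) = O.indicator (mderiv α f.1) := by
  unfold multiOp mderiv
  induction List.finRange n with
  | nil =>
    ext x
    by_cases hx : x ∈ O
    · simp [hx]
    · simp [hx, f.2.2 x hx]
  | cons i l ih =>
    rw [List.map_cons, List.prod_cons, Module.End.mul_apply, partialOp_pow_apply, ih,
      List.foldr_cons]
    exact indicator_congr (pderiv_iter_congr hO i _ fun y hy => indicator_of_mem hy _)

theorem commute_prod_pow {M ι : Type*} [Monoid M] {D : ι → M} (hD : ∀ i j, Commute (D i) (D j))
    (α β : ι → ℕ) (l : List ι) : (l.map fun i => D i ^ (α + β) i).prod =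
      (l.map fun i => D i ^ α i).prod * (l.map fun i => D i ^ β i).prod := by
  induction l with
  | nil => simp
  | cons i l ih =>
    have h : Commute (D i ^ β i) (l.map fun i => D i ^ α i).prod :=
      Commute.list_prod_right _ _ fun x hx => by
        obtain ⟨j, -, rfl⟩ := List.mem_map.1 hx
        exact (hD i j).pow_pow _ _
    rw [List.map_cons, List.prod_cons, ih, List.map_cons, List.prod_cons, List.map_cons,
      List.prod_cons, Pi.add_apply, pow_add, mul_assoc, mul_assoc, ← mul_assoc (D i ^ β i), h.eq,
      mul_assoc]

theorem multiOp_add (hO : IsOpen O) (α β : Fin n → ℕ) :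
    multiOp hO (α + β) = multiOp hO α * multiOp hO β :=
  commute_prod_pow (partialOp_commute hO) α β _

theorem multiOp_single (hO : IsOpen O) (i : Fin n) :
    multiOp hO (Pi.single i 1) = partialOp hO i := by
  unfold multiOp
  rw [List.prod_map_eq_pow_single i _ fun j hj _ => by rw [Pi.single_eq_of_ne hj, pow_zero],
    List.count_eq_one_of_mem (List.nodup_finRange n) (List.mem_finRange i), Pi.single_eq_same,
    pow_one, pow_one]

theorem mderiv_eqOn_multiOp (hO : IsOpen O) (α : Fin n → ℕ) {f : Eu n → ℂ}
    (hf : ContDiffOn ℝ ∞ f O) :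
    EqOn (mderiv α f) (multiOp hO α ⟨_, indicator_mem_smoothOn hf⟩ : smoothOn O).1 O := by
  intro x hx
  rw [multiOp_apply, indicator_of_mem hx]
  exact mderiv_congr hO α (fun y hy => (indicator_of_mem hy _).symm) hx

/-- `mderiv` differentiates in a fixed order of the variables, so adding multi-indices requires
reordering. This is done among the commuting operators `partialOp` and then carried back to
functions on O. -/
theorem mderiv_add (hO : IsOpen O) (α β : Fin n → ℕ) {f : Eu n → ℂ} (hf : ContDiffOn ℝ ∞ f O) :
    EqOn (mderiv α (mderiv β f)) (mderiv (α + β) f) O := by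
  intro x hx
  rw [mderiv_eqOn_multiOp hO (α + β) hf hx, multiOp_add, Module.End.mul_apply, multiOp_apply,
    indicator_of_mem hx]
  exact mderiv_congr hO α (mderiv_eqOn_multiOp hO β hf) hx

theorem mderiv_single (hO : IsOpen O) (i : Fin n) {f : Eu n → ℂ} (hf : ContDiffOn ℝ ∞ f O) :
    EqOn (mderiv (Pi.single i 1) f) (pderiv i f) O := by
  intro x hx
  rw [mderiv_eqOn_multiOp hO _ hf hx, multiOp_single, partialOp_apply, indicator_of_mem hx]
  exact pderiv_congr hO i (fun y hy => indicator_of_mem hy _) hx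

theorem mderiv_pderiv (hO : IsOpen O) (α : Fin n → ℕ) (i : Fin n) {f : Eu n → ℂ}
    (hf : ContDiffOn ℝ ∞ f O) :
    EqOn (mderiv α (pderiv i f)) (mderiv (α + Pi.single i 1) f) O := by
  intro x hx
  rw [← mderiv_add hO α _ hf hx]
  exact mderiv_congr hO α (mderiv_single hO i hf).symm hx

theorem mlen_add (α β : Fin n → ℕ) : mlen (α + β) = mlen α + mlen β :=
  Finset.sum_add_distrib

theorem mlen_single (i : Fin n) : mlen (Pi.single i 1 : Fin n → ℕ) = 1 := by
  simp [mlen]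

theorem mderiv_zero (f : Eu n → ℂ) : mderiv 0 f = f := by
  unfold mderiv
  induction List.finRange n with
  | nil => rfl
  | cons i l ih => simp only [List.foldr_cons, ih]; rfl

/-! ### The Leibniz rule in transposed form -/

/-- Pointwise multiplication of smooth functions on `O`. -/
def smoothMul (O : Set (Eu n)) : smoothOn O →ₗ[ℂ] smoothOn O →ₗ[ℂ] smoothOn O :=
  LinearMap.mk₂ ℂ
    (fun f g => ⟨f.1 * g.1, f.2.1.mul g.2.1, fun x hx => by simp [f.2.2 x hx]⟩)
    (fun f f' g => Subtype.ext (add_mul f.1 f'.1 g.1))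
    (fun c f g => Subtype.ext (smul_mul_assoc c f.1 g.1))
    (fun f g g' => Subtype.ext (mul_add f.1 g.1 g'.1))
    (fun c f g => Subtype.ext (mul_smul_comm c f.1 g.1))

theorem smoothMul_apply (f g : smoothOn O) : (smoothMul O f g : Eu n → ℂ) = f.1 * g.1 := rfl

theorem partialOp_smoothMul (hO : IsOpen O) (i : Fin n) (f g : smoothOn O) :
    partialOp hO i (smoothMul O f g) =
      smoothMul O (partialOp hO i f) g + smoothMul O f (partialOp hO i g) := by
  ext x
  by_cases hx : x ∈ O
  · have := pderiv_mul hO i f.2.1 g.2.1 hx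
    simp only [Submodule.coe_add, Pi.add_apply, smoothMul_apply, partialOp_apply, Pi.mul_apply,
      indicator_of_mem hx]
    exact this
  · simp [smoothMul_apply, partialOp_apply, hx]

/-- In each coordinate expand (-y)^a with -y = x + (-(x + y)), then multiply out the product of
sums. In the application x + y is differentiation of a product. -/
theorem binomial_prod {R : Type*} [CommRing R] (x y : Fin n → R) (α : Fin n → ℕ) :
    ∑ β ∈ Finset.Iic α, (∏ i, ((α i).choose (β i) : R)) * (-1) ^ mlen (α - β) *
      ((∏ i, (x i + y i) ^ (α - β) i) * ∏ i, x i ^ β i) =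
    (-1) ^ mlen α * ∏ i, y i ^ α i := by
  have h1 : (-1 : R) ^ mlen α * ∏ i, y i ^ α i =
      ∏ i, ∑ k ∈ Finset.Iic (α i), x i ^ k * (-(x i + y i)) ^ (α i - k) * ((α i).choose k : R) := by
    rw [mlen, ← Finset.prod_pow_eq_pow_sum, ← Finset.prod_mul_distrib]
    refine Finset.prod_congr rfl fun i _ => ?_
    rw [← mul_pow, show (-1 : R) * y i = x i + -(x i + y i) by ring, add_pow]
    exact Finset.sum_congr (by ext; simp) fun _ _ => rfl
  rw [h1, Finset.prod_univ_sum]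
  refine Finset.sum_congr (by ext; simp [Pi.le_def]) fun β _ => ?_
  rw [mlen, ← Finset.prod_pow_eq_pow_sum, ← Finset.prod_mul_distrib, ← Finset.prod_mul_distrib,
    ← Finset.prod_mul_distrib]
  refine Finset.prod_congr rfl fun i _ => ?_
  rw [Pi.sub_apply, neg_pow (x i + y i)]
  ring

open TensorProduct in
open scoped IsMulCommutative in
/-- The Leibniz rule in transposed form, for commuting derivations of a bilinear product. -/
theorem leibniz_transposed {V : Type*} [AddCommGroup V] [Module ℂ V] (D : Fin n → Module.End ℂ V)
    (hD : ∀ i j, D i * D j = D j * D i) (m : V →ₗ[ℂ] V →ₗ[ℂ] V)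
    (hm : ∀ i a b, D i (m a b) = m (D i a) b + m a (D i b)) (α : Fin n → ℕ) (f g : V) :
    ∑ β ∈ Finset.Iic α, ((∏ i, ((α i).choose (β i) : ℂ)) * (-1) ^ mlen (α - β)) •
      ((List.finRange n).map fun i => D i ^ (α - β) i).prod
        (m (((List.finRange n).map fun i => D i ^ β i).prod f) g) =
    ((-1 : ℂ) ^ mlen α) • m f (((List.finRange n).map fun i => D i ^ α i).prod g) := by
  -- The two factors are differentiated independently on the tensor square: X acts on the first, Y
  -- on the second.
  let X : Fin n → Module.End ℂ (V ⊗[ℂ] V) := fun i => (D i).rTensor V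
  let Y : Fin n → Module.End ℂ (V ⊗[ℂ] V) := fun i => (D i).lTensor V
  have hXX : ∀ i j, X i * X j = X j * X i := fun i j => by
    simp only [X, Module.End.mul_eq_comp, ← LinearMap.rTensor_comp]
    exact congrArg _ (hD i j)
  have hYY : ∀ i j, Y i * Y j = Y j * Y i := fun i j => by
    simp only [Y, Module.End.mul_eq_comp, ← LinearMap.lTensor_comp]
    exact congrArg _ (hD i j)
  have hXY : ∀ i j, X i * Y j = Y j * X i := fun i j => by
    simp only [X, Y, Module.End.mul_eq_comp]
    rw [LinearMap.rTensor_comp_lTensor, LinearMap.lTensor_comp_rTensor]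
  have hcomm : ∀ a ∈ range X ∪ range Y, ∀ b ∈ range X ∪ range Y, a * b = b * a := by
    rintro _ (⟨i, rfl⟩ | ⟨i, rfl⟩) _ (⟨j, rfl⟩ | ⟨j, rfl⟩)
    · exact hXX i j
    · exact hXY i j
    · exact (hXY j i).symm
    · exact hYY i j
  -- The binomial identity lives in a commutative ring; the subalgebra generated by these commuting
  -- operators provides one.
  have := Algebra.isMulCommutative_adjoin ℂ hcomm
  let : CommRing (Algebra.adjoin ℂ (range X ∪ range Y)) := inferInstance
  let x : Fin n → Algebra.adjoin ℂ (range X ∪ range Y) :=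
    fun i => ⟨X i, Algebra.subset_adjoin (Or.inl ⟨i, rfl⟩)⟩
  let y : Fin n → Algebra.adjoin ℂ (range X ∪ range Y) :=
    fun i => ⟨Y i, Algebra.subset_adjoin (Or.inr ⟨i, rfl⟩)⟩
  have hval : ∀ (z : Fin n → Algebra.adjoin ℂ (range X ∪ range Y)) (γ : Fin n → ℕ),
      (∏ i, z i ^ γ i).1 = ((List.finRange n).map fun i => (z i).1 ^ γ i).prod := fun z γ => by
    rw [Fin.prod_univ_def]
    change (Algebra.adjoin ℂ (range X ∪ range Y)).val _ = _
    rw [map_list_prod, List.map_map]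
    rfl
  have hx : ∀ γ : Fin n → ℕ, ((List.finRange n).map fun i => X i ^ γ i).prod (f ⊗ₜ g) =
      ((List.finRange n).map fun i => D i ^ γ i).prod f ⊗ₜ g := fun γ => by
    have : ((List.finRange n).map fun i => X i ^ γ i).prod =
        ((List.finRange n).map fun i => D i ^ γ i).prod.rTensor V := by
      induction List.finRange n with
      | nil => exact (LinearMap.rTensor_id V V).symm
      | cons i l ih =>
        rw [List.map_cons, List.prod_cons, ih, List.map_cons, List.prod_cons,
          LinearMap.rTensor_mul, LinearMap.rTensor_pow]
    rw [this, LinearMap.rTensor_tmul]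
  have hy : ∀ γ : Fin n → ℕ, ((List.finRange n).map fun i => Y i ^ γ i).prod (f ⊗ₜ g) =
      f ⊗ₜ ((List.finRange n).map fun i => D i ^ γ i).prod g := fun γ => by
    have : ((List.finRange n).map fun i => Y i ^ γ i).prod =
        ((List.finRange n).map fun i => D i ^ γ i).prod.lTensor V := by
      induction List.finRange n with
      | nil => exact (LinearMap.lTensor_id V V).symm
      | cons i l ih =>
        rw [List.map_cons, List.prod_cons, ih, List.map_cons, List.prod_cons,
          LinearMap.lTensor_mul, LinearMap.lTensor_pow]
    rw [this, LinearMap.lTensor_tmul]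
  let μ : V ⊗[ℂ] V →ₗ[ℂ] V := TensorProduct.lift m
  -- This is the product rule: the multiplication μ intertwines X + Y with D.
  have hμ1 : ∀ i, μ ∘ₗ (X i + Y i) = D i ∘ₗ μ := fun i =>
    TensorProduct.ext' fun a b => by simp [μ, X, Y, hm]
  have hμ2 : ∀ i k, μ ∘ₗ ((X i + Y i) ^ k) = (D i ^ k) ∘ₗ μ := fun i k => by
    induction k with
    | zero => rfl
    | succ k ih =>
      rw [pow_succ, pow_succ, Module.End.mul_eq_comp, ← LinearMap.comp_assoc, ih,
        LinearMap.comp_assoc, hμ1, ← LinearMap.comp_assoc]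
      rfl
  have hμ : ∀ γ : Fin n → ℕ, μ ∘ₗ ((List.finRange n).map fun i => (X i + Y i) ^ γ i).prod =
      ((List.finRange n).map fun i => D i ^ γ i).prod ∘ₗ μ := fun γ => by
    induction List.finRange n with
    | nil => rfl
    | cons i l ih =>
      simp only [List.map_cons, List.prod_cons, Module.End.mul_eq_comp]
      rw [← LinearMap.comp_assoc, hμ2, LinearMap.comp_assoc, ih, LinearMap.comp_assoc]
  -- Evaluate the operator identity at f ⊗ g and multiply.
  have key := congrArg (fun r => μ (r.1 (f ⊗ₜ g))) (binomial_prod x y α)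
  have hsc : ∀ (k l : ℕ) (r : Algebra.adjoin ℂ (range X ∪ range Y)),
      μ ((((k : Algebra.adjoin ℂ (range X ∪ range Y)) * (-1) ^ l * r).1) (f ⊗ₜ g)) =
        ((k : ℂ) * (-1) ^ l) • μ (r.1 (f ⊗ₜ g)) := by
    intro k l r
    have : (k : Algebra.adjoin ℂ (range X ∪ range Y)) * (-1) ^ l * r =
        ((k : ℂ) * (-1) ^ l) • r := by
      rw [Algebra.smul_def]; simp
    rw [this, ← map_smul]
    rfl
  simp only [← Nat.cast_prod] at key ⊢
  have h0 := hsc 1 (mlen α) (∏ i, y i ^ α i)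
  simp only [Nat.cast_one, one_mul] at h0
  rw [h0, hval y, hy] at key
  rw [← TensorProduct.lift.tmul (f' := m), ← key, AddSubmonoidClass.coe_finsetSum,
    LinearMap.sum_apply, map_sum]
  refine Finset.sum_congr rfl fun β _ => ?_
  rw [hsc]
  congr 1
  rw [MulMemClass.coe_mul, Module.End.mul_apply, hval x, hx, hval (fun i => x i + y i)]
  exact (LinearMap.congr_fun (hμ (α - β)) (_ ⊗ₜ g)).symm

/-- The Leibniz rule for smooth functions in transposed form. -/
theorem multiOp_leibniz_transposed (hO : IsOpen O) (α : Fin n → ℕ) (f g : smoothOn O) :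
    ∑ β ∈ Finset.Iic α, ((∏ i, ((α i).choose (β i) : ℂ)) * (-1) ^ mlen (α - β)) •
      multiOp hO (α - β) (smoothMul O (multiOp hO β f) g) =
    ((-1 : ℂ) ^ mlen α) • smoothMul O f (multiOp hO α g) :=
  leibniz_transposed (partialOp hO) (fun i j => (partialOp_commute hO i j).eq) (smoothMul O)
    (partialOp_smoothMul hO) α f g

end PartialDerivatives

/-! ### Weighted estimates for all derivatives up to a given order -/

section WeightedEstimates

variable {n : ℕ} {O E : Set (Eu n)} {r : Eu n → ℝ}

/-- All iterated partial derivatives of `g` of order `j ≤ p` are `O(r^(k - j))` on `E`. -/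
def OrdOn (r : Eu n → ℝ) (E : Set (Eu n)) : ℕ → ℤ → (Eu n → ℂ) → Prop
  | 0, k, g => ∃ C : ℝ, ∀ x ∈ E, ‖g x‖ ≤ C * r x ^ k
  | p + 1, k, g => (∃ C : ℝ, ∀ x ∈ E, ‖g x‖ ≤ C * r x ^ k) ∧ ∀ i, OrdOn r E p (k - 1) (pderiv i g)

theorem OrdOn.bound {p : ℕ} {k : ℤ} {g : Eu n → ℂ} (h : OrdOn r E p k g) :
    ∃ C : ℝ, ∀ x ∈ E, ‖g x‖ ≤ C * r x ^ k := by
  cases p with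
  | zero => exact h
  | succ p => exact h.1

theorem OrdOn.bound_nonneg {p : ℕ} {k : ℤ} {g : Eu n → ℂ} (hr : ∀ x ∈ E, 0 < r x)
    (h : OrdOn r E p k g) : ∃ C : ℝ, 0 ≤ C ∧ ∀ x ∈ E, ‖g x‖ ≤ C * r x ^ k := by
  obtain ⟨C, hC⟩ := h.bound
  refine ⟨max C 0, le_max_right _ _, fun x hx => (hC x hx).trans ?_⟩
  have := hr x hx
  gcongr
  exact le_max_left _ _

theorem OrdOn.congr (hO : IsOpen O) (hE : E ⊆ O) {p : ℕ} : ∀ {k : ℤ} {f g : Eu n → ℂ},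
    EqOn f g O → OrdOn r E p k f → OrdOn r E p k g := by
  induction p with
  | zero =>
    rintro k f g h ⟨C, hC⟩
    exact ⟨C, fun x hx => h (hE hx) ▸ hC x hx⟩
  | succ p ih =>
    rintro k f g h ⟨⟨C, hC⟩, h'⟩
    exact ⟨⟨C, fun x hx => h (hE hx) ▸ hC x hx⟩, fun i => ih (pderiv_congr hO i h) (h' i)⟩

theorem OrdOn.pred {p : ℕ} : ∀ {k : ℤ} {f : Eu n → ℂ}, OrdOn r E (p + 1) k f → OrdOn r E p k f := by
  induction p with
  | zero => exact fun h => h.1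
  | succ p ih => exact fun h => ⟨h.1, fun i => ih (h.2 i)⟩

theorem OrdOn.mono_set {E' : Set (Eu n)} (hE : E' ⊆ E) {p : ℕ} : ∀ {k : ℤ} {f : Eu n → ℂ},
    OrdOn r E p k f → OrdOn r E' p k f := by
  induction p with
  | zero => exact fun ⟨C, hC⟩ => ⟨C, fun x hx => hC x (hE hx)⟩
  | succ p ih => exact fun ⟨⟨C, hC⟩, h⟩ => ⟨⟨C, fun x hx => hC x (hE hx)⟩, fun i => ih (h i)⟩

/-- Each derivative lowers the exponent by one, so the two weights have to be compared for every
exponent up to k₀; the constant may depend on the exponent. -/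
theorem OrdOn.change_weight {r' : Eu n → ℝ} (hr : ∀ x ∈ E, 0 < r x) {k₀ s : ℤ}
    (hw : ∀ k ≤ k₀, ∃ M : ℝ, ∀ x ∈ E, r x ^ k ≤ M * r' x ^ (k + s)) {p : ℕ} :
    ∀ {k : ℤ} {f : Eu n → ℂ}, k ≤ k₀ → OrdOn r E p k f → OrdOn r' E p (k + s) f := by
  have key : ∀ {p : ℕ} {k : ℤ} {f : Eu n → ℂ}, k ≤ k₀ → OrdOn r E p k f →
      ∃ C : ℝ, ∀ x ∈ E, ‖f x‖ ≤ C * r' x ^ (k + s) := by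
    intro p k f hk h
    obtain ⟨C, hC0, hC⟩ := h.bound_nonneg hr
    obtain ⟨M, hM⟩ := hw k hk
    refine ⟨C * M, fun x hx => (hC x hx).trans ?_⟩
    rw [mul_assoc]
    exact mul_le_mul_of_nonneg_left (hM x hx) hC0
  induction p with
  | zero => exact fun hk h => key hk h
  | succ p ih =>
    refine fun {k f} hk h => ⟨key hk h, fun i => ?_⟩
    have := ih (k := k - 1) (by omega) (h.2 i)
    rwa [show k - 1 + s = k + s - 1 by ring] at this

theorem OrdOn.mono_exp (hr : ∀ x ∈ E, 0 < r x) {M : ℝ} (hM : ∀ x ∈ E, r x ≤ M) {p : ℕ} {k k' : ℤ}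
    (hk : k' ≤ k) {f : Eu n → ℂ} (h : OrdOn r E p k f) : OrdOn r E p k' f := by
  have := OrdOn.change_weight (r' := r) hr (k₀ := k) (s := k' - k) (fun j _ => ?_) le_rfl h
  · rwa [add_sub_cancel] at this
  · obtain ⟨l, hl⟩ := Int.eq_ofNat_of_zero_le (sub_nonneg.2 hk)
    refine ⟨M ^ l, fun x hx => ?_⟩
    have h0 := hr x hx
    rw [show j = (j + (k' - k)) + l by omega, zpow_add₀ h0.ne', mul_comm (M ^ l),
      show (j + (k' - k)) + l + (k' - k) = j + (k' - k) by omega, zpow_natCast]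
    gcongr
    exact hM x hx

theorem OrdOn.zero (p : ℕ) : ∀ k : ℤ, OrdOn r E p k 0 := by
  have hp : ∀ i : Fin n, pderiv i (0 : Eu n → ℂ) = 0 := fun i => by
    ext x
    simp [pderiv]
  have h0 : ∀ k : ℤ, ∃ C : ℝ, ∀ x ∈ E, ‖(0 : Eu n → ℂ) x‖ ≤ C * r x ^ k := fun k => ⟨0, by simp⟩
  induction p with
  | zero => exact h0
  | succ p ih => exact fun k => ⟨h0 k, fun i => by rw [hp i]; exact ih _⟩

theorem OrdOn.comb (hO : IsOpen O) (hE : E ⊆ O) (a b : ℂ) {p : ℕ} :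
    ∀ {k : ℤ} {f g : Eu n → ℂ}, ContDiffOn ℝ ∞ f O → ContDiffOn ℝ ∞ g O →
      OrdOn r E p k f → OrdOn r E p k g → OrdOn r E p k (fun x => a * f x + b * g x) := by
  have key : ∀ {p : ℕ} {k : ℤ} {f g : Eu n → ℂ}, OrdOn r E p k f → OrdOn r E p k g →
      ∃ C : ℝ, ∀ x ∈ E, ‖a * f x + b * g x‖ ≤ C * r x ^ k := by
    intro p k f g hf hg
    obtain ⟨C, hC⟩ := hf.bound
    obtain ⟨D, hD⟩ := hg.bound
    refine ⟨‖a‖ * C + ‖b‖ * D, fun x hx => (norm_add_le _ _).trans ?_⟩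
    rw [norm_mul, norm_mul, add_mul, mul_assoc, mul_assoc]
    gcongr
    exacts [hC x hx, hD x hx]
  induction p with
  | zero => exact fun _ _ => key
  | succ p ih =>
    exact fun hf hg hf' hg' => ⟨key hf' hg', fun i =>
      OrdOn.congr hO hE (pderiv_comb hO i hf hg a b fun _ _ => rfl).symm
        (ih (pderiv_smooth hO i hf) (pderiv_smooth hO i hg) (hf'.2 i) (hg'.2 i))⟩

theorem OrdOn.mul (hO : IsOpen O) (hE : E ⊆ O) (hr : ∀ x ∈ E, 0 < r x) {p : ℕ} :
    ∀ {k l : ℤ} {f g : Eu n → ℂ}, ContDiffOn ℝ ∞ f O → ContDiffOn ℝ ∞ g O →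
      OrdOn r E p k f → OrdOn r E p l g → OrdOn r E p (k + l) (fun x => f x * g x) := by
  have key : ∀ {p : ℕ} {k l : ℤ} {f g : Eu n → ℂ}, OrdOn r E p k f → OrdOn r E p l g →
      ∃ C : ℝ, ∀ x ∈ E, ‖f x * g x‖ ≤ C * r x ^ (k + l) := by
    intro p k l f g hf hg
    obtain ⟨C, hC0, hC⟩ := hf.bound_nonneg hr
    obtain ⟨D, hD0, hD⟩ := hg.bound_nonneg hr
    refine ⟨C * D, fun x hx => ?_⟩
    have h0 := hr x hx
    rw [norm_mul, zpow_add₀ h0.ne', mul_mul_mul_comm]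
    exact mul_le_mul (hC x hx) (hD x hx) (norm_nonneg _) (by positivity)
  induction p with
  | zero => exact fun _ _ => key
  | succ p ih =>
    refine fun {k l f g} hf hg hf' hg' => ⟨key hf' hg', fun i =>
      OrdOn.congr hO hE (pderiv_mul hO i hf hg).symm ?_⟩
    have h1 := ih (pderiv_smooth hO i hf) hg (hf'.2 i) hg'.pred
    have h2 := ih hf (pderiv_smooth hO i hg) hf'.pred (hg'.2 i)
    rw [show k - 1 + l = k + l - 1 by ring] at h1
    rw [show k + (l - 1) = k + l - 1 by ring] at h2
    have := OrdOn.comb hO hE 1 1 ((pderiv_smooth hO i hf).mul hg)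
      (hf.mul (pderiv_smooth hO i hg)) h1 h2
    simpa only [one_mul] using this

theorem OrdOn.sum (hO : IsOpen O) (hE : E ⊆ O) {p : ℕ} {k : ℤ} {ι : Type*} (s : Finset ι)
    {f : ι → Eu n → ℂ} (hf : ∀ j ∈ s, ContDiffOn ℝ ∞ (f j) O) (h : ∀ j ∈ s, OrdOn r E p k (f j)) :
    OrdOn r E p k (fun x => ∑ j ∈ s, f j x) := by
  classical
  induction s using Finset.induction_on with
  | empty => exact OrdOn.zero p k
  | insert a s ha ih =>
    simp only [Finset.sum_insert ha]
    have := OrdOn.comb hO hE 1 1 (hf a (by simp))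
      (ContDiffOn.sum fun j hj => hf j (by simp [hj])) (h a (by simp))
      (ih (fun j hj => hf j (by simp [hj])) fun j hj => h j (by simp [hj]))
    simpa only [one_mul] using this

theorem OrdOn.pderiv_iter (i : Fin n) {p : ℕ} (m : ℕ) {k : ℤ} {f : Eu n → ℂ}
    (h : OrdOn r E (p + m) k f) : OrdOn r E p (k - m) ((pderiv i)^[m] f) := by
  induction m generalizing p with
  | zero => simpa using h
  | succ m ih =>
    rw [Function.iterate_succ_apply']
    have := (ih (p := p + 1) (by rwa [add_assoc, add_comm 1 m])).2 i
    rwa [show k - (m : ℤ) - 1 = k - ((m + 1 : ℕ) : ℤ) by push_cast; ring] at this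

theorem OrdOn.mderiv (α : Fin n → ℕ) {p : ℕ} {k : ℤ} {f : Eu n → ℂ}
    (h : OrdOn r E (p + mlen α) k f) : OrdOn r E p (k - mlen α) (mderiv α f) := by
  unfold ThickDist.mderiv
  rw [mlen, Fin.sum_univ_def] at h ⊢
  generalize List.finRange n = l at h ⊢
  induction l generalizing p with
  | nil => simpa using h
  | cons i l ih =>
    rw [List.map_cons, List.sum_cons] at h ⊢
    rw [← add_assoc] at h
    have := (ih h).pderiv_iter i (α i)
    rwa [sub_sub, add_comm ((List.map α l).sum : ℤ), ← Nat.cast_add] at this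

/-- `OrdOn` speaks of iterated partial derivatives in any order, strong expansions of multi-index
derivatives. Splitting off the first partial derivative raises the multi-index by a unit vector,
because partial derivatives commute. -/
theorem OrdOn.of_mderiv (hO : IsOpen O) (hE : E ⊆ O) {p : ℕ} : ∀ {k : ℤ} {f : Eu n → ℂ},
    ContDiffOn ℝ ∞ f O → (∀ α : Fin n → ℕ, mlen α ≤ p →
      ∃ C : ℝ, ∀ x ∈ E, ‖ThickDist.mderiv α f x‖ ≤ C * r x ^ (k - mlen α)) → OrdOn r E p k f := by
  have key : ∀ {p : ℕ} {k : ℤ} {f : Eu n → ℂ}, (∀ α : Fin n → ℕ, mlen α ≤ p →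
      ∃ C : ℝ, ∀ x ∈ E, ‖ThickDist.mderiv α f x‖ ≤ C * r x ^ (k - mlen α)) →
      ∃ C : ℝ, ∀ x ∈ E, ‖f x‖ ≤ C * r x ^ k := fun h => by
    simpa [mderiv_zero, mlen] using h 0 (by simp [mlen])
  induction p with
  | zero => exact fun _ h => key h
  | succ p ih =>
    refine fun {k f} hf h => ⟨key h, fun i => ih (pderiv_smooth hO i hf) fun α hα => ?_⟩
    obtain ⟨C, hC⟩ := h (α + Pi.single i 1) (by rw [mlen_add, mlen_single]; omega)
    refine ⟨C, fun x hx => ?_⟩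
    rw [mderiv_pderiv hO α i hf (hE hx)]
    have := hC x hx
    rwa [mlen_add, mlen_single, Nat.cast_add, Nat.cast_one, ← sub_sub, sub_right_comm] at this

/-! ### Chain rule and weighted estimates for compositions -/

theorem fderiv_apply_eq_sum (g : Eu n → ℂ) (x v : Eu n) :
    fderiv ℝ g x v = ∑ l, (v l : ℂ) * pderiv l g x := by
  have hv : v = ∑ l, v l • EuclideanSpace.single l (1 : ℝ) := by
    ext i
    simp [Pi.single_apply]
  conv_lhs => rw [hv]
  rw [map_sum]
  exact Finset.sum_congr rfl fun l _ => by rw [map_smul]; exact Complex.real_smul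

/-- A coordinate of a map into `ℝⁿ`, as a complex valued function. -/
def coordFn (τ : Eu n → Eu n) (l : Fin n) : Eu n → ℂ := fun x => (τ x l : ℂ)

theorem coordFn_smooth {τ : Eu n → Eu n} (hτ : ContDiffOn ℝ ∞ τ O) (l : Fin n) :
    ContDiffOn ℝ ∞ (coordFn τ l) O :=
  Complex.ofRealCLM.contDiff.comp_contDiffOn ((contDiffOn_euclidean.1 hτ) l)

theorem pderiv_coordFn (hO : IsOpen O) {τ : Eu n → Eu n} (hτ : ContDiffOn ℝ ∞ τ O) (i l : Fin n) :
    EqOn (pderiv i (coordFn τ l)) (fun x => ((fderiv ℝ τ x (EuclideanSpace.single i 1)) l : ℂ)) O := by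
  intro x hx
  have hd : DifferentiableAt ℝ τ x := (hτ.contDiffAt (hO.mem_nhds hx)).differentiableAt (by simp)
  have h1 : HasFDerivAt (coordFn τ l)
      ((Complex.ofRealCLM.comp (EuclideanSpace.proj l : Eu n →L[ℝ] ℝ)).comp (fderiv ℝ τ x)) x :=
    ((Complex.ofRealCLM.comp (EuclideanSpace.proj l : Eu n →L[ℝ] ℝ)).hasFDerivAt).comp x
      hd.hasFDerivAt
  simp only [pderiv]
  rw [h1.fderiv]
  rfl

theorem pderiv_comp (hO : IsOpen O) {O' : Set (Eu n)} (hO' : IsOpen O') {τ : Eu n → Eu n}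
    (hτ : ContDiffOn ℝ ∞ τ O) (hm : MapsTo τ O O') {G : Eu n → ℂ} (hG : ContDiffOn ℝ ∞ G O')
    (i : Fin n) : EqOn (pderiv i (G ∘ τ))
      (fun x => ∑ l, pderiv i (coordFn τ l) x * (pderiv l G ∘ τ) x) O := by
  intro x hx
  have hd : DifferentiableAt ℝ τ x := (hτ.contDiffAt (hO.mem_nhds hx)).differentiableAt (by simp)
  have hGd : DifferentiableAt ℝ G (τ x) :=
    (hG.contDiffAt (hO'.mem_nhds (hm hx))).differentiableAt (by simp)
  have h1 : pderiv i (G ∘ τ) x = fderiv ℝ G (τ x) (fderiv ℝ τ x (EuclideanSpace.single i 1)) := by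
    simp only [pderiv]
    rw [fderiv_comp x hGd hd]
    rfl
  rw [h1, fderiv_apply_eq_sum]
  exact Finset.sum_congr rfl fun l _ => by rw [pderiv_coordFn hO hτ i l hx]; rfl

/-- The derivatives of G are merely bounded on the image, since the weight there is 1 and its
exponent is immaterial. All negative powers of r come from the inner map, one for each derivative.
-/
theorem OrdOn.comp (hO : IsOpen O) (hE : E ⊆ O) (hr : ∀ x ∈ E, 0 < r x) {O' E' : Set (Eu n)}
    (hO' : IsOpen O') {τ : Eu n → Eu n} (hτ : ContDiffOn ℝ ∞ τ O) (hm : MapsTo τ O O')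
    (hmE : MapsTo τ E E') {p : ℕ} (hτp : ∀ l, OrdOn r E p 0 (coordFn τ l)) :
    ∀ {G : Eu n → ℂ} {k : ℤ}, ContDiffOn ℝ ∞ G O' → OrdOn (fun _ => 1) E' p k G →
      OrdOn r E p 0 (G ∘ τ) := by
  have key : ∀ {p : ℕ} {G : Eu n → ℂ} {k : ℤ}, OrdOn (fun _ => 1) E' p k G →
      ∃ C : ℝ, ∀ x ∈ E, ‖(G ∘ τ) x‖ ≤ C * r x ^ (0 : ℤ) := fun h => by
    obtain ⟨C, hC⟩ := h.bound
    exact ⟨C, fun x hx => by simpa using hC _ (hmE hx)⟩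
  induction p with
  | zero => exact fun {_ _} _ h => key h
  | succ p ih =>
    refine fun {G k} hG h => ⟨key h, fun i => OrdOn.congr hO hE
      (pderiv_comp hO hO' hτ hm hG i).symm (OrdOn.sum hO hE _ (fun l _ => ?_) fun l _ => ?_)⟩
    · exact (pderiv_smooth hO i (coordFn_smooth hτ l)).mul ((pderiv_smooth hO' l hG).comp hτ hm)
    · have := OrdOn.mul hO hE hr (pderiv_smooth hO i (coordFn_smooth hτ l))
        ((pderiv_smooth hO' l hG).comp hτ hm) ((hτp l).2 i)
        (ih (fun l => (hτp l).pred) (pderiv_smooth hO' l hG) (h.2 l))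
      rwa [add_zero] at this

end WeightedEstimates

/-! ### Geometry of the tube coordinates -/

section Tube

variable {n d : ℕ} {S : Set (Eu n)} (T : TubularSystem S d)

theorem tube_open (S : Set (Eu n)) (ε : Eu n → ℝ) : IsOpen (tube S ε) := by
  have : tube S ε = ⋃ ξ ∈ S, ball ξ (ε ξ) := by
    ext x
    simp [tube, dist_eq_norm]
  rw [this]
  exact isOpen_biUnion fun _ _ => isOpen_ball

/-- The points of `U ν \ S` at distance less than `δ` from `S`. -/
def TubularSystem.shell (ν : ℕ) (δ : ℝ) : Set (Eu n) := {x ∈ T.U ν \ S | T.rho x < δ}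

/-- The unit direction from `π(x)` to `x`. -/
def TubularSystem.dir (x : Eu n) : Eu n := (T.rho x)⁻¹ • (x - T.proj x)

/-- The point at distance `s` from `S` on the normal ray through `x`. -/
def TubularSystem.ray (s : ℝ) (x : Eu n) : Eu n := T.proj x + s • T.dir x

variable {T} {ν : ℕ}

theorem TubularSystem.shell_sub {δ : ℝ} : T.shell ν δ ⊆ T.U ν \ S := fun _ hx => hx.1

theorem TubularSystem.shell_mono {δ δ' : ℝ} (h : δ ≤ δ') : T.shell ν δ ⊆ T.shell ν δ' :=
  fun _ hx => ⟨hx.1, hx.2.trans_le h⟩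

theorem TubularSystem.sub_tube : T.U ν \ S ⊆ tube S T.eps := sdiff_subset.trans (T.U_sub ν)

theorem TubularSystem.rho_pos {x : Eu n} (hx : x ∈ T.U ν \ S) : 0 < T.rho x :=
  (TubularSystem.coord_mem hx).2

theorem TubularSystem.proj_mem' {x : Eu n} (hx : x ∈ T.U ν \ S) : T.proj x ∈ S ∩ T.U ν :=
  (TubularSystem.coord_mem hx).1.1

theorem TubularSystem.sub_proj {x : Eu n} (hx : x ∈ T.U ν \ S) :
    x - T.proj x = T.rho x • T.dir x := by
  rw [TubularSystem.dir, smul_inv_smul₀ (TubularSystem.rho_pos hx).ne']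

theorem TubularSystem.param {p : Eu n × Eu d × ℝ}
    (hp : p ∈ (S ∩ T.U ν) ×ˢ (sphere (0 : Eu d) 1 ×ˢ Ioo 0 (T.radius ν))) :
    let x := p.1 + p.2.2 • ∑ k, p.2.1 k • T.frame ν k p.1
    x ∈ T.U ν \ S ∧ T.proj x = p.1 ∧ T.omega (T.frame ν) x = p.2.1 ∧ T.rho x = p.2.2 ∧
      T.dir x = ∑ k, p.2.1 k • T.frame ν k p.1 := by
  intro x
  have hx := (T.coord_bij ν).mapsTo hp
  have h := T.coord_inv ν hp
  simp only [Prod.ext_iff] at h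
  obtain ⟨h1, h2, h3⟩ := h
  refine ⟨hx, h1, h2, h3, ?_⟩
  have h4 := TubularSystem.sub_proj hx
  change x - T.proj x = T.rho x • T.dir x at h4
  have h3' : T.rho x = p.2.2 := h3
  have h1' : T.proj x = p.1 := h1
  rw [h1', h3', show x - p.1 = p.2.2 • ∑ k, p.2.1 k • T.frame ν k p.1 from add_sub_cancel_left _ _]
    at h4
  exact (smul_right_injective (Eu n) (h3' ▸ TubularSystem.rho_pos hx).ne' h4).symm

theorem TubularSystem.coords {x : Eu n} (hx : x ∈ T.U ν \ S) :
    (T.proj x, T.omega (T.frame ν) x, T.rho x) ∈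
      (S ∩ T.U ν) ×ˢ (sphere (0 : Eu d) 1 ×ˢ Ioo 0 (T.radius ν)) ∧
    T.dir x = ∑ k, T.omega (T.frame ν) x k • T.frame ν k (T.proj x) := by
  obtain ⟨p, hp, rfl⟩ := (T.coord_bij ν).surjOn hx
  obtain ⟨-, h1, h2, h3, h4⟩ := TubularSystem.param hp
  refine ⟨?_, ?_⟩
  · simp only [h1, h2, h3]
    exact hp
  · simp only [h1, h2, h4]

theorem TubularSystem.rho_lt {x : Eu n} (hx : x ∈ T.U ν \ S) : T.rho x < T.radius ν :=
  (TubularSystem.coords hx).1.2.2.2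

/-- The tube coordinates range over a full product, so the third one may be changed to any s below
the radius without leaving U ν \ S. -/
theorem TubularSystem.ray_spec {x : Eu n} (hx : x ∈ T.U ν \ S) {s : ℝ}
    (hs : s ∈ Ioo 0 (T.radius ν)) :
    T.ray s x ∈ T.U ν \ S ∧ T.proj (T.ray s x) = T.proj x ∧
      T.omega (T.frame ν) (T.ray s x) = T.omega (T.frame ν) x ∧ T.rho (T.ray s x) = s ∧
      T.dir (T.ray s x) = T.dir x := by
  obtain ⟨h1, h2⟩ := TubularSystem.coords hx
  have h := TubularSystem.param (T := T) (ν := ν)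
    (p := (T.proj x, T.omega (T.frame ν) x, s)) ⟨h1.1, h1.2.1, hs⟩
  simp only [← h2] at h
  exact h

/-- A function smooth on the tube may blow up at the boundary of the tube, so uniform bounds need a
compact set inside it. As U ν is bounded and S closed, S ∩ closure (U ν) is compact and ε has a
positive minimum there; the closed thickening by half this minimum lies in the tube. Whole segments
are included for the sake of Taylor's formula. -/
theorem TubularSystem.exists_core (hS : IsClosed S) (T : TubularSystem S d) (ν : ℕ) :
    ∃ δ : ℝ, 0 < δ ∧ δ ≤ T.radius ν ∧ ∃ Q : Set (Eu n), IsCompact Q ∧ Q ⊆ tube S T.eps ∧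
      ∀ x ∈ T.shell ν δ, segment ℝ (T.proj x) x ⊆ Q := by
  have hK : IsCompact (S ∩ closure (T.U ν)) :=
    (T.U_bounded ν).isCompact_closure.inter_left hS
  have hne : (S ∩ closure (T.U ν)).Nonempty :=
    (T.U_meets ν).mono (inter_subset_inter_right _ subset_closure)
  obtain ⟨ξ₀, hξ₀, hmin⟩ := hK.exists_isMinOn hne (T.eps_cont.mono inter_subset_left)
  have he := T.eps_pos ξ₀ hξ₀.1
  refine ⟨min (T.eps ξ₀ / 2) (T.radius ν), lt_min (half_pos he) (T.radius_pos ν), min_le_right _ _,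
    cthickening (T.eps ξ₀ / 2) (S ∩ closure (T.U ν)), hK.cthickening, ?_, ?_⟩
  · rw [hK.cthickening_eq_biUnion_closedBall (half_pos he).le]
    refine iUnion₂_subset fun ξ hξ x hx => ?_
    show ∃ ξ ∈ S, ‖x - ξ‖ < T.eps ξ
    refine ⟨ξ, hξ.1, ?_⟩
    rw [mem_closedBall, dist_eq_norm] at hx
    have : T.eps ξ₀ ≤ T.eps ξ := hmin hξ
    linarith
  · intro x hx
    have hp := TubularSystem.proj_mem' hx.1
    have hball : segment ℝ (T.proj x) x ⊆ closedBall (T.proj x) (T.eps ξ₀ / 2) :=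
      (convex_closedBall _ _).segment_subset (mem_closedBall_self (half_pos he).le) (by
        rw [mem_closedBall, dist_eq_norm]
        exact (hx.2.trans_le (min_le_left _ _)).le)
    exact hball.trans (closedBall_subset_cthickening
      (show T.proj x ∈ S ∩ closure (T.U ν) from ⟨hp.1, subset_closure hp.2⟩) _)

/-- A radius below which the tube over `U ν` is relatively compact in the tubular neighbourhood. -/
def TubularSystem.coreRadius (hS : IsClosed S) (T : TubularSystem S d) (ν : ℕ) : ℝ :=
  (TubularSystem.exists_core hS T ν).choose

/-- The part of `U ν \ S` below the core radius. -/
def TubularSystem.core (hS : IsClosed S) (T : TubularSystem S d) (ν : ℕ) : Set (Eu n) :=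
  T.shell ν (TubularSystem.coreRadius hS T ν)

theorem TubularSystem.coreRadius_pos (hS : IsClosed S) : 0 < TubularSystem.coreRadius hS T ν :=
  (TubularSystem.exists_core hS T ν).choose_spec.1

theorem TubularSystem.coreRadius_le (hS : IsClosed S) :
    TubularSystem.coreRadius hS T ν ≤ T.radius ν :=
  (TubularSystem.exists_core hS T ν).choose_spec.2.1

theorem TubularSystem.core_spec (hS : IsClosed S) (T : TubularSystem S d) (ν : ℕ) :
    ∃ Q : Set (Eu n), IsCompact Q ∧ Q ⊆ tube S T.eps ∧
      ∀ x ∈ TubularSystem.core hS T ν, segment ℝ (T.proj x) x ⊆ Q :=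
  (TubularSystem.exists_core hS T ν).choose_spec.2.2

theorem TubularSystem.core_pos (hS : IsClosed S) :
    ∀ x ∈ TubularSystem.core hS T ν, 0 < T.rho x := fun _ hx => TubularSystem.rho_pos hx.1

theorem OrdOn.of_compact {O Q : Set (Eu n)} (hO : IsOpen O) (hQ : IsCompact Q) (hQO : Q ⊆ O)
    (p : ℕ) : ∀ (k : ℤ) {F : Eu n → ℂ}, ContDiffOn ℝ ∞ F O → OrdOn (fun _ => 1) Q p k F := by
  have key : ∀ (k : ℤ) {F : Eu n → ℂ}, ContDiffOn ℝ ∞ F O →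
      ∃ C : ℝ, ∀ x ∈ Q, ‖F x‖ ≤ C * (1 : ℝ) ^ k := fun k F hF => by
    simpa using hQ.exists_bound_of_continuousOn (hF.continuousOn.mono hQO)
  induction p with
  | zero => exact fun k F hF => key k hF
  | succ p ih => exact fun k F hF => ⟨key k hF, fun i => ih _ (pderiv_smooth hO i hF)⟩

/-- On a compact part of the tube all derivatives are bounded. This is more than O(ρ^(-j)) for
derivatives of order j, because ρ is bounded on the core. -/
theorem OrdOn.of_smooth_tube (hS : IsClosed S) (p : ℕ) {F : Eu n → ℂ}
    (hF : ContDiffOn ℝ ∞ F (tube S T.eps)) : OrdOn T.rho (TubularSystem.core hS T ν) p 0 F := by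
  obtain ⟨Q, hQ, hQt, hsub⟩ := TubularSystem.core_spec hS T ν
  have h1 := (OrdOn.of_compact (tube_open S T.eps) hQ hQt p 0 hF).mono_set
    (E' := TubularSystem.core hS T ν) fun x hx => hsub x hx (right_mem_segment ℝ _ _)
  have h2 := OrdOn.change_weight (r' := T.rho) (k₀ := 0) (s := 0) (fun x _ => one_pos) ?_ le_rfl h1
  · simpa using h2
  · intro k hk
    obtain ⟨l, rfl⟩ := Int.eq_ofNat_of_zero_le (neg_nonneg.2 hk) |>.imp fun l hl =>
      neg_eq_iff_eq_neg.1 hl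
    refine ⟨TubularSystem.coreRadius hS T ν ^ l, fun x hx => ?_⟩
    have h0 := TubularSystem.core_pos hS x hx
    rw [one_zpow, add_zero, zpow_neg, zpow_natCast, ← div_eq_mul_inv, one_le_div (by positivity)]
    have := hx.2.le
    gcongr

/-! ### Derivatives of the normal vector, of powers of the distance, and of the ray maps -/

variable (T)

/-- The coordinates of `π`. -/
def TubularSystem.projC (l : Fin n) : Eu n → ℂ := coordFn T.proj l

/-- The coordinates of `x - π(x)`. -/
def TubularSystem.normC (l : Fin n) : Eu n → ℂ := coordFn (fun x => x - T.proj x) l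

/-- The power `ρ_x^j`. -/
def TubularSystem.rhoPow (j : ℤ) : Eu n → ℂ := fun x => (T.rho x : ℂ) ^ j

variable {T}

theorem TubularSystem.projC_smooth (l : Fin n) : ContDiffOn ℝ ∞ (T.projC l) (tube S T.eps) :=
  coordFn_smooth T.proj_smooth l

theorem TubularSystem.normC_smooth (l : Fin n) : ContDiffOn ℝ ∞ (T.normC l) (tube S T.eps) :=
  coordFn_smooth (contDiffOn_id.sub T.proj_smooth) l

theorem TubularSystem.pderiv_normC (i l : Fin n) : EqOn (pderiv i (T.normC l))
    (fun x => (if l = i then 1 else 0) - pderiv i (T.projC l) x) (tube S T.eps) := by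
  intro x hx
  have hO := tube_open S T.eps
  have hd : DifferentiableAt ℝ T.proj x :=
    (T.proj_smooth.contDiffAt (hO.mem_nhds hx)).differentiableAt (by simp)
  have h := pderiv_coordFn (τ := fun x => x - T.proj x) hO
    (contDiff_id.contDiffOn.sub T.proj_smooth) i l hx
  simp only [TubularSystem.normC, TubularSystem.projC]
  rw [h, pderiv_coordFn hO T.proj_smooth i l hx]
  beta_reduce
  rw [fderiv_fun_sub differentiableAt_fun_id hd]
  by_cases hli : l = i <;> simp [hli]

theorem OrdOn.normC (hS : IsClosed S) (l : Fin n) (p : ℕ) :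
    OrdOn T.rho (TubularSystem.core hS T ν) p 1 (T.normC l) := by
  have h : ∃ C : ℝ, ∀ x ∈ TubularSystem.core hS T ν, ‖T.normC l x‖ ≤ C * T.rho x ^ (1 : ℤ) := by
    refine ⟨1, fun x _ => ?_⟩
    rw [one_mul, zpow_one]
    simp only [TubularSystem.normC, coordFn, Complex.norm_real]
    exact PiLp.norm_apply_le _ _
  cases p with
  | zero => exact h
  | succ p => exact ⟨h, fun i => OrdOn.of_smooth_tube hS p
      (pderiv_smooth (tube_open S T.eps) i (TubularSystem.normC_smooth l))⟩

theorem TubularSystem.rho_smooth : ContDiffOn ℝ ∞ T.rho (T.U ν \ S) :=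
  (contDiffOn_id.sub (T.proj_smooth.mono TubularSystem.sub_tube)).norm ℝ fun _ hx =>
    norm_pos_iff.1 (TubularSystem.rho_pos hx)

theorem TubularSystem.rhoPow_smooth (j : ℤ) : ContDiffOn ℝ ∞ (T.rhoPow j) (T.U ν \ S) := by
  have := TubularSystem.term_smooth (T := T) (ν := ν) (a := fun _ => 1) contDiffOn_const j
  exact this.congr fun x _ => by simp [TubularSystem.rhoPow, TubularSystem.term]

/-- Differentiating ρ² = ∑ (x - π(x))_l² gives ρ ∂_i ρ as a sum of products of functions smooth
across S. Inserting this into ∂_i ρ^j = j ρ^(j-1) ∂_i ρ leaves ρ^(j-2) as the only singular factor.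
-/
theorem TubularSystem.pderiv_rhoPow (hS : IsClosed S) (i : Fin n) (j : ℤ) :
    EqOn (pderiv i (T.rhoPow j)) (fun x => j * (T.rhoPow (j - 2) x *
      ∑ l, T.normC l x * pderiv i (T.normC l) x)) (T.U ν \ S) := by
  intro x hx
  have hO := TubularSystem.diff_open (T := T) hS ν
  have h0 := TubularSystem.rho_pos hx
  have hd : HasFDerivAt T.rho (fderiv ℝ T.rho x) x :=
    ((TubularSystem.rho_smooth.contDiffAt (hO.mem_nhds hx)).differentiableAt (by simp)).hasFDerivAt
  have hpow : ∀ j : ℤ, pderiv i (T.rhoPow j) x = j * (T.rho x : ℂ) ^ (j - 1) *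
      (fderiv ℝ T.rho x (EuclideanSpace.single i 1) : ℝ) := fun j => by
    have h1 := Complex.ofRealCLM.hasFDerivAt.comp x
      ((hasDerivAt_zpow j (T.rho x) (Or.inl h0.ne')).comp_hasFDerivAt x hd)
    have h2 : T.rhoPow j = Complex.ofRealCLM ∘ ((fun y => y ^ j) ∘ T.rho) := by
      ext y
      simp [TubularSystem.rhoPow]
    rw [pderiv, h2, h1.fderiv]
    simp
  have hsq : T.rhoPow 2 = fun x => ∑ l, T.normC l x * T.normC l x := by
    ext y
    simp only [TubularSystem.rhoPow, TubularSystem.normC, coordFn]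
    rw [show (2 : ℤ) = (2 : ℕ) from rfl, zpow_natCast, ← Complex.ofReal_pow, TubularNbhd.rho,
      EuclideanSpace.norm_sq_eq]
    push_cast
    refine Finset.sum_congr rfl fun l _ => ?_
    rw [← Complex.ofReal_pow, Real.norm_eq_abs, sq_abs]
    push_cast
    ring
  have hn : ∀ l, ContDiffOn ℝ ∞ (T.normC l) (T.U ν \ S) := fun l =>
    (TubularSystem.normC_smooth l).mono TubularSystem.sub_tube
  have h2 := hpow 2
  rw [hsq, pderiv_fun_sum hO i _ (fun l _ => (hn l).mul (hn l)) hx] at h2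
  beta_reduce at h2
  rw [Finset.sum_congr rfl fun l _ => pderiv_mul hO i (hn l) (hn l) hx] at h2
  have h3 : (T.rho x : ℂ) * (fderiv ℝ T.rho x (EuclideanSpace.single i 1) : ℝ) =
      ∑ l, T.normC l x * pderiv i (T.normC l) x := by
    have : ∑ l, (pderiv i (T.normC l) x * T.normC l x + T.normC l x * pderiv i (T.normC l) x) =
        2 * ∑ l, T.normC l x * pderiv i (T.normC l) x := by
      rw [Finset.mul_sum]
      exact Finset.sum_congr rfl fun l _ => by ring
    rw [this] at h2
    norm_num at h2
    rw [mul_assoc] at h2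
    exact (mul_left_cancel₀ two_ne_zero h2).symm
  beta_reduce
  rw [hpow, ← h3, TubularSystem.rhoPow, mul_assoc, ← mul_assoc ((T.rho x : ℂ) ^ (j - 2)),
    ← zpow_add_one₀ (Complex.ofReal_ne_zero.2 h0.ne')]
  congr 3
  ring

theorem OrdOn.rhoPow (hS : IsClosed S) (p : ℕ) :
    ∀ j : ℤ, OrdOn T.rho (TubularSystem.core hS T ν) p j (T.rhoPow j) := by
  have hO := TubularSystem.diff_open (T := T) hS ν
  have key : ∀ j : ℤ, ∃ C : ℝ, ∀ x ∈ TubularSystem.core hS T ν,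
      ‖T.rhoPow j x‖ ≤ C * T.rho x ^ j := fun j => by
    refine ⟨1, fun x hx => ?_⟩
    rw [TubularSystem.rhoPow, norm_zpow, Complex.norm_real,
      Real.norm_of_nonneg (TubularSystem.rho_pos hx.1).le, one_mul]
  have hn : ∀ l, ContDiffOn ℝ ∞ (T.normC l) (T.U ν \ S) := fun l =>
    (TubularSystem.normC_smooth l).mono TubularSystem.sub_tube
  induction p with
  | zero => exact key
  | succ p ih =>
    refine fun j => ⟨key j, fun i => OrdOn.congr hO TubularSystem.shell_sub
      (TubularSystem.pderiv_rhoPow hS i j).symm ?_⟩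
    have h1 : ∀ l, ContDiffOn ℝ ∞ (fun x => T.normC l x * pderiv i (T.normC l) x) (T.U ν \ S) :=
      fun l => (hn l).mul (pderiv_smooth hO i (hn l))
    have h2 : OrdOn T.rho (TubularSystem.core hS T ν) p 1
        (fun x => ∑ l, T.normC l x * pderiv i (T.normC l) x) :=
      OrdOn.sum hO TubularSystem.shell_sub _ (fun l _ => h1 l) fun l _ =>
        OrdOn.mul hO TubularSystem.shell_sub (TubularSystem.core_pos hS) (k := 1) (l := 0) (hn l)
          (pderiv_smooth hO i (hn l)) (OrdOn.normC hS l p) (OrdOn.of_smooth_tube hS p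
            (pderiv_smooth (tube_open S T.eps) i (TubularSystem.normC_smooth l)))
    have h3 := OrdOn.mul hO TubularSystem.shell_sub (TubularSystem.core_pos hS)
      (TubularSystem.rhoPow_smooth (j - 2)) (ContDiffOn.sum fun l _ => h1 l) (ih (j - 2)) h2
    have h4 := OrdOn.comb hO TubularSystem.shell_sub (j : ℂ) 0
      ((TubularSystem.rhoPow_smooth (j - 2)).mul (ContDiffOn.sum fun l _ => h1 l))
      ((TubularSystem.rhoPow_smooth (j - 2)).mul (ContDiffOn.sum fun l _ => h1 l)) h3 h3
    simp only [zero_mul, add_zero] at h4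
    rwa [show j - 2 + 1 = j - 1 by ring] at h4

theorem TubularSystem.coordFn_ray (s : ℝ) (l : Fin n) : coordFn (T.ray s) l =
    fun x => 1 * T.projC l x + s * (T.rhoPow (-1) x * T.normC l x) := by
  ext x
  simp [coordFn, TubularSystem.ray, TubularSystem.dir, TubularSystem.projC, TubularSystem.normC,
    TubularSystem.rhoPow]

theorem TubularSystem.ray_smooth (s : ℝ) : ContDiffOn ℝ ∞ (T.ray s) (T.U ν \ S) := by
  have hp : ContDiffOn ℝ ∞ T.proj (T.U ν \ S) := T.proj_smooth.mono TubularSystem.sub_tube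
  have h : ContDiffOn ℝ ∞ (fun x => s • (T.rho x)⁻¹ • (x - T.proj x)) (T.U ν \ S) :=
    ContDiffOn.const_smul s ((TubularSystem.rho_smooth.inv fun x hx =>
      (TubularSystem.rho_pos hx).ne').smul (contDiff_id.contDiffOn.sub hp))
  exact hp.add h

/-- In π + s ρ⁻¹ (x - π) the orders -1 and 1 of the last two factors cancel. -/
theorem OrdOn.coordFn_ray (hS : IsClosed S) (s : ℝ) (l : Fin n) (p : ℕ) :
    OrdOn T.rho (TubularSystem.core hS T ν) p 0 (coordFn (T.ray s) l) := by
  have hO := TubularSystem.diff_open (T := T) hS ν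
  have hn : ContDiffOn ℝ ∞ (T.normC l) (T.U ν \ S) :=
    (TubularSystem.normC_smooth l).mono TubularSystem.sub_tube
  rw [TubularSystem.coordFn_ray]
  exact OrdOn.comb hO TubularSystem.shell_sub 1 s
    ((TubularSystem.projC_smooth l).mono TubularSystem.sub_tube)
    ((TubularSystem.rhoPow_smooth (-1)).mul hn)
    (OrdOn.of_smooth_tube hS p (TubularSystem.projC_smooth l))
    (OrdOn.mul hO TubularSystem.shell_sub (TubularSystem.core_pos hS) (k := -1) (l := 1)
      (TubularSystem.rhoPow_smooth (-1)) hn (OrdOn.rhoPow hS p (-1)) (OrdOn.normC hS l p))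

end Tube

/-! ### Taylor expansion along the normal rays -/

section Taylor

variable {n : ℕ}

/-- The `j`-th Taylor term `D^j F(ξ)(w, …, w) / j!`. -/
def taylorTerm : ℕ → (Eu n → ℂ) → Eu n → Eu n → ℂ
  | 0, F, ξ, _ => F ξ
  | j + 1, F, ξ, w => ((j : ℂ) + 1)⁻¹ * ∑ k, (w k : ℂ) * taylorTerm j (pderiv k F) ξ w

theorem taylorTerm_succ (j : ℕ) (F : Eu n → ℂ) (ξ w : Eu n) :
    ((j : ℂ) + 1) * taylorTerm (j + 1) F ξ w = ∑ k, (w k : ℂ) * taylorTerm j (pderiv k F) ξ w := by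
  rw [taylorTerm, mul_inv_cancel_left₀ (by exact_mod_cast j.succ_ne_zero)]

theorem taylorTerm_smul (j : ℕ) (F : Eu n → ℂ) (ξ w : Eu n) (t : ℝ) :
    taylorTerm j F ξ (t • w) = (t : ℂ) ^ j * taylorTerm j F ξ w := by
  induction j generalizing F with
  | zero => simp [taylorTerm]
  | succ j ih =>
    simp only [taylorTerm, ih, Finset.mul_sum]
    refine Finset.sum_congr rfl fun k _ => ?_
    simp only [PiLp.smul_apply, smul_eq_mul, Complex.ofReal_mul]
    ring

theorem taylorTerm_congr {O : Set (Eu n)} (hO : IsOpen O) (j : ℕ) {F G : Eu n → ℂ}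
    (h : EqOn F G O) {ξ : Eu n} (hξ : ξ ∈ O) (w : Eu n) :
    taylorTerm j F ξ w = taylorTerm j G ξ w := by
  induction j generalizing F G with
  | zero => exact h hξ
  | succ j ih =>
    simp only [taylorTerm]
    congr 1
    exact Finset.sum_congr rfl fun k _ => by rw [ih (pderiv_congr hO k h)]

/-- All partial derivatives of `F` of order exactly `q` are bounded by `M` on `Z`. -/
def DerivBound (Z : Set (Eu n)) (M : ℝ) : ℕ → (Eu n → ℂ) → Prop
  | 0, F => ∀ y ∈ Z, ‖F y‖ ≤ M
  | q + 1, F => ∀ k, DerivBound Z M q (pderiv k F)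

theorem hasDerivAt_comp_line {F : Eu n → ℂ} {ξ w : Eu n} {t : ℝ}
    (hF : DifferentiableAt ℝ F (ξ + t • w)) :
    HasDerivAt (fun s : ℝ => F (ξ + s • w)) (∑ k, (w k : ℂ) * pderiv k F (ξ + t • w)) t := by
  have h1 : HasDerivAt (fun s : ℝ => ξ + s • w) w t := by
    simpa using ((hasDerivAt_id t).smul_const w).const_add ξ
  rw [← fderiv_apply_eq_sum]
  exact hF.hasFDerivAt.comp_hasDerivAt t h1

theorem sum_norm_coord_le (w : Eu n) : ∑ k, |w k| ≤ n * ‖w‖ := by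
  have : ∑ k : Fin n, |w k| ≤ ∑ _k : Fin n, ‖w‖ := Finset.sum_le_sum fun k _ => by
    rw [← Real.norm_eq_abs]
    exact PiLp.norm_apply_le w k
  simpa using this

/-- Along the segment, the derivative in t of the remainder at t • w is ∑ w_k times the shorter
remainder of ∂_k F, to which the induction hypothesis applies; the mean value inequality on [0, 1]
finishes. Each step costs ∑ |w_k| ≤ n ‖w‖; the factorial is given away. -/
theorem taylor_bound {O : Set (Eu n)} (hO : IsOpen O) {Z : Set (Eu n)} (hZ : Z ⊆ O) {M : ℝ}
    (hM : 0 ≤ M) (q : ℕ) : ∀ {F : Eu n → ℂ} {ξ w : Eu n}, ContDiffOn ℝ ∞ F O →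
      DerivBound Z M q F → (∀ t ∈ Icc (0 : ℝ) 1, ξ + t • w ∈ Z) →
      ‖F (ξ + w) - ∑ j ∈ Finset.range q, taylorTerm j F ξ w‖ ≤ (n * ‖w‖) ^ q * M := by
  induction q with
  | zero =>
    intro F ξ w _ hb hs
    simpa using hb _ (by simpa using hs 1 (by simp))
  | succ q ih =>
    intro F ξ w hF hb hs
    let g : ℝ → ℂ := fun t => F (ξ + t • w) - ∑ j ∈ Finset.range (q + 1), taylorTerm j F ξ (t • w)
    let g' : ℝ → ℂ := fun t => ∑ k, (w k : ℂ) * (pderiv k F (ξ + t • w) -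
      ∑ j ∈ Finset.range q, taylorTerm j (pderiv k F) ξ (t • w))
    have hg : ∀ t ∈ Icc (0 : ℝ) 1, HasDerivWithinAt g (g' t) (Icc 0 1) t := by
      intro t ht
      have h1 := hasDerivAt_comp_line (w := w)
        ((hF.contDiffAt (hO.mem_nhds (hZ (hs t ht)))).differentiableAt (by simp))
      have h2 : HasDerivAt (fun t : ℝ => ∑ j ∈ Finset.range (q + 1), taylorTerm j F ξ (t • w))
          (∑ j ∈ Finset.range q, (((j : ℂ) + 1) * (t : ℂ) ^ j) * taylorTerm (j + 1) F ξ w) t := by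
        simp only [taylorTerm_smul, Finset.sum_range_succ' _ q, pow_zero]
        refine (HasDerivAt.fun_sum fun j _ => ?_).add_const _
        refine HasDerivAt.mul_const ?_ _
        have := ((hasDerivAt_pow (j + 1) (t : ℂ)).comp_ofReal)
        simpa using this
      suffices h : g' t = ∑ k, (w k : ℂ) * pderiv k F (ξ + t • w) - ∑ j ∈ Finset.range q,
          (((j : ℂ) + 1) * (t : ℂ) ^ j) * taylorTerm (j + 1) F ξ w by
        rw [h]
        exact (h1.sub h2).hasDerivWithinAt
      simp only [g', mul_sub, Finset.sum_sub_distrib]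
      congr 1
      simp only [Finset.mul_sum]
      rw [Finset.sum_comm]
      refine Finset.sum_congr rfl fun j _ => ?_
      rw [mul_right_comm, taylorTerm_succ, Finset.sum_mul]
      refine Finset.sum_congr rfl fun k _ => ?_
      rw [taylorTerm_smul]
      ring
    have hg' : ∀ t ∈ Ico (0 : ℝ) 1, ‖g' t‖ ≤ (n * ‖w‖) ^ (q + 1) * M := by
      intro t ht
      have ht' : t ∈ Icc (0 : ℝ) 1 := ⟨ht.1, ht.2.le⟩
      have h1 : ∀ k, ‖(w k : ℂ) * (pderiv k F (ξ + t • w) -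
          ∑ j ∈ Finset.range q, taylorTerm j (pderiv k F) ξ (t • w))‖ ≤
          |w k| * ((n * ‖w‖) ^ q * M) := fun k => by
        rw [norm_mul, Complex.norm_real, Real.norm_eq_abs]
        gcongr
        refine (ih (pderiv_smooth hO k hF) (hb k) fun s hs' => ?_).trans ?_
        · rw [smul_smul]
          exact hs _ ⟨mul_nonneg hs'.1 ht.1, mul_le_one₀ hs'.2 ht.1 ht.2.le⟩
        · rw [norm_smul, Real.norm_of_nonneg ht.1]
          have ht0 := ht.1
          exact mul_le_mul_of_nonneg_right (pow_le_pow_left₀ (by positivity)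
            (mul_le_mul_of_nonneg_left (mul_le_of_le_one_left (norm_nonneg _) ht.2.le)
              (Nat.cast_nonneg n)) q) hM
      refine (norm_sum_le _ _).trans ((Finset.sum_le_sum fun k _ => h1 k).trans ?_)
      rw [← Finset.sum_mul, pow_succ', mul_assoc]
      gcongr
      exact sum_norm_coord_le w
    have := norm_image_sub_le_of_norm_deriv_le_segment_01' hg hg'
    -- The term j = 0 cancels F ξ, and the others vanish by homogeneity.
    have h0 : g 0 = 0 := by
      simp only [g, zero_smul, add_zero]
      rw [Finset.sum_range_succ', Finset.sum_eq_zero]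
      · simp [taylorTerm]
      · intro j _
        have := taylorTerm_smul (j + 1) F ξ w 0
        simpa using this
    simpa [h0, g] using this

theorem DerivBound.of_ordOn {Z : Set (Eu n)} (q : ℕ) : ∀ {F : Eu n → ℂ} {k : ℤ},
    OrdOn (fun _ => 1) Z q k F → ∃ M, 0 ≤ M ∧ DerivBound Z M q F := by
  have mono : ∀ (q : ℕ) {F : Eu n → ℂ} {M M' : ℝ}, M ≤ M' → DerivBound Z M q F →
      DerivBound Z M' q F := fun q => by
    induction q with
    | zero => exact fun h hb y hy => (hb y hy).trans h
    | succ q ih => exact fun h hb k => ih h (hb k)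
  induction q with
  | zero =>
    intro F k h
    obtain ⟨C, hC0, hC⟩ := OrdOn.bound_nonneg (fun _ _ => one_pos) h
    exact ⟨C, hC0, fun y hy => by simpa using hC y hy⟩
  | succ q ih =>
    intro F k h
    choose M hM0 hM using fun i => ih (h.2 i)
    exact ⟨∑ i, M i, Finset.sum_nonneg fun i _ => hM0 i, fun i => mono q
      (Finset.single_le_sum (f := M) (fun i _ => hM0 i) (Finset.mem_univ i)) (hM i)⟩

/-! ### Taylor expansion at the nearest point of S -/

variable {d : ℕ} {S : Set (Eu n)} (T : TubularSystem S d) {ν : ℕ}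

/-- The Taylor term of `F` at `π(x)` in the normal direction `x - π(x)`. -/
def TubularSystem.normalTaylor (j : ℕ) (F : Eu n → ℂ) (x : Eu n) : ℂ :=
  taylorTerm j F (T.proj x) (x - T.proj x)

variable {T}

theorem TubularSystem.proj_mem_tube {x : Eu n} (hx : x ∈ tube S T.eps) :
    T.proj x ∈ tube S T.eps :=
  ⟨T.proj x, T.proj_mem x hx, by simpa using T.eps_pos _ (T.proj_mem x hx)⟩

theorem TubularSystem.normalTaylor_zero (F : Eu n → ℂ) :
    T.normalTaylor 0 F = F ∘ T.proj := rfl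

theorem TubularSystem.normalTaylor_succ (j : ℕ) (F : Eu n → ℂ) :
    T.normalTaylor (j + 1) F =
      fun x => ((j : ℂ) + 1)⁻¹ * ∑ k, T.normC k x * T.normalTaylor j (pderiv k F) x := rfl

theorem TubularSystem.normalTaylor_smooth (j : ℕ) : ∀ {F : Eu n → ℂ},
    ContDiffOn ℝ ∞ F (tube S T.eps) → ContDiffOn ℝ ∞ (T.normalTaylor j F) (tube S T.eps) := by
  induction j with
  | zero => exact fun hF => hF.comp T.proj_smooth fun x hx => TubularSystem.proj_mem_tube hx
  | succ j ih =>
    intro F hF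
    rw [TubularSystem.normalTaylor_succ]
    exact contDiffOn_const.mul (ContDiffOn.sum fun k _ => (TubularSystem.normC_smooth k).mul
      (ih (pderiv_smooth (tube_open S T.eps) k hF)))

theorem OrdOn.normalTaylor (hS : IsClosed S) (p j : ℕ) : ∀ {F : Eu n → ℂ},
    ContDiffOn ℝ ∞ F (tube S T.eps) →
      OrdOn T.rho (TubularSystem.core hS T ν) p j (T.normalTaylor j F) := by
  have hO := TubularSystem.diff_open (T := T) hS ν
  induction j with
  | zero => exact fun hF => OrdOn.of_smooth_tube hS p (TubularSystem.normalTaylor_smooth 0 hF)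
  | succ j ih =>
    intro F hF
    have hd : ∀ k, ContDiffOn ℝ ∞ (pderiv k F) (tube S T.eps) := fun k =>
      pderiv_smooth (tube_open S T.eps) k hF
    have h1 : ∀ k, ContDiffOn ℝ ∞ (fun x => T.normC k x * T.normalTaylor j (pderiv k F) x)
        (T.U ν \ S) := fun k => ((TubularSystem.normC_smooth k).mul
          (TubularSystem.normalTaylor_smooth j (hd k))).mono TubularSystem.sub_tube
    have h2 : OrdOn T.rho (TubularSystem.core hS T ν) p ((j + 1 : ℕ) : ℤ)
        (fun x => ∑ k, T.normC k x * T.normalTaylor j (pderiv k F) x) :=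
      OrdOn.sum hO TubularSystem.shell_sub _ (fun k _ => h1 k) fun k _ => by
        have := OrdOn.mul hO TubularSystem.shell_sub (TubularSystem.core_pos hS)
          ((TubularSystem.normC_smooth (T := T) k).mono TubularSystem.sub_tube)
          ((TubularSystem.normalTaylor_smooth j (hd k)).mono TubularSystem.sub_tube)
          (OrdOn.normC hS k p) (ih (hd k))
        rwa [add_comm] at this
    have h3 := OrdOn.comb hO TubularSystem.shell_sub ((j : ℂ) + 1)⁻¹ 0
      (ContDiffOn.sum fun k _ => h1 k) (ContDiffOn.sum fun k _ => h1 k) h2 h2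
    simp only [zero_mul, add_zero] at h3
    exact h3

/-- The point x enters through the base point π(x) and through the direction x - π(x). Moving the
base point differentiates F; moving the direction differentiates a homogeneous polynomial of degree
j, whose k-th partial derivative is the term of degree j - 1 of ∂_k F. For j = 0 there is no
dependence on the direction. -/
theorem TubularSystem.pderiv_normalTaylor (i : Fin n) (j : ℕ) : ∀ {F : Eu n → ℂ},
    ContDiffOn ℝ ∞ F (tube S T.eps) →
    EqOn (pderiv i (T.normalTaylor j F))
      (fun x => ∑ k, pderiv i (T.projC k) x * T.normalTaylor j (pderiv k F) x +
        ∑ k, pderiv i (T.normC k) x *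
          (if j = 0 then 0 else T.normalTaylor (j - 1) (pderiv k F) x)) (tube S T.eps) := by
  have hO := tube_open S T.eps
  induction j with
  | zero =>
    intro F hF x hx
    simp only [TubularSystem.normalTaylor_zero, if_true, mul_zero, Finset.sum_const_zero, add_zero]
    exact pderiv_comp hO hO T.proj_smooth (fun x hx => TubularSystem.proj_mem_tube hx) hF i hx
  | succ j ih =>
    intro F hF x hx
    have hd : ∀ k, ContDiffOn ℝ ∞ (pderiv k F) (tube S T.eps) := fun k => pderiv_smooth hO k hF
    have hw := TubularSystem.normC_smooth (T := T)
    have ht : ∀ k, ContDiffOn ℝ ∞ (T.normalTaylor j (pderiv k F)) (tube S T.eps) := fun k =>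
      TubularSystem.normalTaylor_smooth j (hd k)
    have hcomm : ∀ (m : ℕ) (k l : Fin n), T.normalTaylor m (pderiv k (pderiv l F)) x =
        T.normalTaylor m (pderiv l (pderiv k F)) x := fun m k l =>
      taylorTerm_congr hO m (pderiv_comm hO k l hF) (TubularSystem.proj_mem_tube hx) _
    have hs : ∀ m k, ∑ l, T.normC l x * T.normalTaylor m (pderiv l (pderiv k F)) x =
        ((m : ℂ) + 1) * T.normalTaylor (m + 1) (pderiv k F) x := fun m k =>
      (taylorTerm_succ m (pderiv k F) (T.proj x) (x - T.proj x)).symm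
    have hs' : ∀ k, ∑ l, T.normC l x *
        (if j = 0 then 0 else T.normalTaylor (j - 1) (pderiv l (pderiv k F)) x) =
        (j : ℂ) * T.normalTaylor j (pderiv k F) x := fun k => by
      cases j with
      | zero => simp
      | succ m => simpa using hs m k
    rw [TubularSystem.normalTaylor_succ, pderiv_const_mul hO i
      (ContDiffOn.sum fun k _ => (hw k).mul (ht k)) _ hx]
    beta_reduce
    rw [pderiv_fun_sum hO i _ (fun k _ => (hw k).mul (ht k)) hx]
    beta_reduce
    rw [Finset.sum_congr rfl fun l _ => (pderiv_mul hO i (hw l) (ht l) hx).trans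
      (congrArg (fun z => pderiv i (T.normC l) x * T.normalTaylor j (pderiv l F) x +
        T.normC l x * z) (ih (hd l) hx))]
    have h1 : ∀ l, T.normC l x * ∑ k, pderiv i (T.projC k) x *
        T.normalTaylor j (pderiv k (pderiv l F)) x =
        ∑ k, pderiv i (T.projC k) x * (T.normC l x *
          T.normalTaylor j (pderiv l (pderiv k F)) x) := fun l => by
      rw [Finset.mul_sum]
      exact Finset.sum_congr rfl fun k _ => by rw [hcomm j k l]; ring
    have h2 : ∀ l, T.normC l x * ∑ k, pderiv i (T.normC k) x *
        (if j = 0 then 0 else T.normalTaylor (j - 1) (pderiv k (pderiv l F)) x) =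
        ∑ k, pderiv i (T.normC k) x * (T.normC l x *
          (if j = 0 then 0 else T.normalTaylor (j - 1) (pderiv l (pderiv k F)) x)) := fun l => by
      rw [Finset.mul_sum]
      exact Finset.sum_congr rfl fun k _ => by rw [hcomm (j - 1) k l]; ring
    simp only [mul_add, Finset.sum_add_distrib, h1, h2]
    rw [Finset.sum_comm, Finset.sum_comm (f := fun l k => pderiv i (T.normC k) x * (T.normC l x *
          (if j = 0 then 0 else T.normalTaylor (j - 1) (pderiv l (pderiv k F)) x)))]
    simp only [← Finset.mul_sum, hs, hs', if_neg j.succ_ne_zero, Nat.add_sub_cancel]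
    -- The direction contributes once through the outer product rule and j times through the
    -- induction hypothesis, which together cancel the factor 1/(j + 1).
    have hj : (j : ℂ) + 1 ≠ 0 := by exact_mod_cast j.succ_ne_zero
    have h3 : ∑ k, pderiv i (T.projC k) x * (((j : ℂ) + 1) * T.normalTaylor (j + 1) (pderiv k F) x) =
        ((j : ℂ) + 1) * ∑ k, pderiv i (T.projC k) x * T.normalTaylor (j + 1) (pderiv k F) x := by
      rw [Finset.mul_sum]
      exact Finset.sum_congr rfl fun k _ => by ring
    have h4 : ∑ k, pderiv i (T.normC k) x * ((j : ℂ) * T.normalTaylor j (pderiv k F) x) =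
        (j : ℂ) * ∑ k, pderiv i (T.normC k) x * T.normalTaylor j (pderiv k F) x := by
      rw [Finset.mul_sum]
      exact Finset.sum_congr rfl fun k _ => by ring
    rw [h3, h4]
    field_simp
    ring

/-- The remainder of the Taylor expansion in normal direction. -/
def TubularSystem.taylorRem (T : TubularSystem S d) (N : ℕ) (F : Eu n → ℂ) (x : Eu n) : ℂ :=
  F x - ∑ j ∈ Finset.range N, T.normalTaylor j F x

theorem TubularSystem.taylorRem_smooth (N : ℕ) {F : Eu n → ℂ}
    (hF : ContDiffOn ℝ ∞ F (tube S T.eps)) : ContDiffOn ℝ ∞ (T.taylorRem N F) (tube S T.eps) :=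
  hF.sub (ContDiffOn.sum fun j _ => TubularSystem.normalTaylor_smooth j hF)

/-- Because ∂_i (x - π)_k = δ_ik - ∂_i π_k, the direction part of the term of degree j + 1 is the
term of degree j of ∂_i F minus the base point part of degree j. The base point parts telescope and
only the one of top degree N remains. -/
theorem TubularSystem.pderiv_taylorRem (i : Fin n) (N : ℕ) {F : Eu n → ℂ}
    (hF : ContDiffOn ℝ ∞ F (tube S T.eps)) :
    EqOn (pderiv i (T.taylorRem (N + 1) F)) (fun x => 1 * T.taylorRem N (pderiv i F) x +
      (-1) * ∑ k, pderiv i (T.projC k) x * T.normalTaylor N (pderiv k F) x) (tube S T.eps) := by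
  have hO := tube_open S T.eps
  intro x hx
  have h1 : pderiv i (T.taylorRem (N + 1) F) x =
      pderiv i F x - ∑ j ∈ Finset.range (N + 1), pderiv i (T.normalTaylor j F) x := by
    have := pderiv_sub hO i hF (ContDiffOn.sum (s := Finset.range (N + 1)) fun j _ =>
      TubularSystem.normalTaylor_smooth (T := T) j hF) hx
    beta_reduce at this
    rw [pderiv_fun_sum hO i _ (fun j _ => TubularSystem.normalTaylor_smooth (T := T) j hF) hx]
      at this
    exact this
  rw [h1, Finset.sum_congr rfl fun j _ => TubularSystem.pderiv_normalTaylor i j hF hx,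
    Finset.sum_add_distrib, Finset.sum_range_succ, Finset.sum_range_succ' _ N]
  have h2 : ∀ j, ∑ k, pderiv i (T.normC k) x * T.normalTaylor j (pderiv k F) x =
      T.normalTaylor j (pderiv i F) x -
        ∑ k, pderiv i (T.projC k) x * T.normalTaylor j (pderiv k F) x := fun j => by
    rw [Finset.sum_congr rfl fun k _ => congrArg (· * T.normalTaylor j (pderiv k F) x)
      (TubularSystem.pderiv_normC i k hx)]
    simp [sub_mul, Finset.sum_sub_distrib]
  simp only [Nat.add_eq_zero_iff, one_ne_zero, and_false, if_false, if_true, Nat.add_sub_cancel, h2,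
    Finset.sum_sub_distrib, mul_zero, Finset.sum_const_zero, TubularSystem.taylorRem]
  ring

theorem TubularSystem.taylorRem_bound (hS : IsClosed S) (N : ℕ) {F : Eu n → ℂ}
    (hF : ContDiffOn ℝ ∞ F (tube S T.eps)) : ∃ C : ℝ, ∀ x ∈ TubularSystem.core hS T ν,
      ‖T.taylorRem N F x‖ ≤ C * T.rho x ^ (N : ℤ) := by
  obtain ⟨Q, hQ, hQt, hsub⟩ := TubularSystem.core_spec hS T ν
  obtain ⟨M, hM0, hM⟩ := DerivBound.of_ordOn N
    (OrdOn.of_compact (tube_open S T.eps) hQ hQt N 0 hF)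
  refine ⟨(n : ℝ) ^ N * M, fun x hx => ?_⟩
  have := taylor_bound (tube_open S T.eps) hQt hM0 N (ξ := T.proj x) (w := x - T.proj x) hF hM
    fun t ht => hsub x hx (by rw [segment_eq_image']; exact ⟨t, ht, rfl⟩)
  rw [add_sub_cancel, mul_pow, mul_right_comm] at this
  rw [zpow_natCast]
  exact this

/-- Differentiating the remainder of order N + 1 gives one of order N plus a Taylor term of degree N
with smooth coefficients. Both have order N, so induction on N covers all derivatives. -/
theorem OrdOn.taylorRem (hS : IsClosed S) (N : ℕ) : ∀ (p : ℕ) {F : Eu n → ℂ},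
    ContDiffOn ℝ ∞ F (tube S T.eps) →
      OrdOn T.rho (TubularSystem.core hS T ν) p N (T.taylorRem N F) := by
  induction N with
  | zero => exact fun p F hF => OrdOn.of_smooth_tube hS p (TubularSystem.taylorRem_smooth 0 hF)
  | succ N ih =>
    intro p F hF
    cases p with
    | zero => exact TubularSystem.taylorRem_bound hS (N + 1) hF
    | succ p =>
      refine ⟨TubularSystem.taylorRem_bound hS (N + 1) hF, fun i => ?_⟩
      have hO := TubularSystem.diff_open (T := T) hS ν
      have hd : ∀ k, ContDiffOn ℝ ∞ (pderiv k F) (tube S T.eps) := fun k =>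
        pderiv_smooth (tube_open S T.eps) k hF
      have hp : ∀ k, ContDiffOn ℝ ∞ (pderiv i (T.projC k)) (tube S T.eps) := fun k =>
        pderiv_smooth (tube_open S T.eps) i (TubularSystem.projC_smooth k)
      have hq : ∀ k, ContDiffOn ℝ ∞ (T.normalTaylor N (pderiv k F)) (tube S T.eps) := fun k =>
        TubularSystem.normalTaylor_smooth N (hd k)
      refine OrdOn.congr hO TubularSystem.shell_sub ((TubularSystem.pderiv_taylorRem i N hF).symm.mono
        TubularSystem.sub_tube) ?_
      have hN : ((N + 1 : ℕ) : ℤ) - 1 = N := by push_cast; ring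
      rw [hN]
      refine OrdOn.comb hO TubularSystem.shell_sub 1 (-1)
        ((TubularSystem.taylorRem_smooth N (hd i)).mono TubularSystem.sub_tube)
        ((ContDiffOn.sum fun k _ => (hp k).mul (hq k)).mono TubularSystem.sub_tube)
        (ih p (hd i)) (OrdOn.sum hO TubularSystem.shell_sub _
          (fun k _ => ((hp k).mul (hq k)).mono TubularSystem.sub_tube) fun k _ => ?_)
      have := OrdOn.mul hO TubularSystem.shell_sub (TubularSystem.core_pos hS)
        ((hp k).mono TubularSystem.sub_tube) ((hq k).mono TubularSystem.sub_tube)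
        (OrdOn.of_smooth_tube hS p (hp k)) (OrdOn.normalTaylor hS p N (hd k))
      rwa [zero_add] at this

end Taylor

/-! ### Radial functions and asymptotic expansions in the distance -/

section Expansions

variable {n d : ℕ} {S : Set (Eu n)} (T : TubularSystem S d) (ν : ℕ)

/-- `g` is smooth on `U ν \ S` and `∂^α g = O(ρ^(k - |α|))` uniformly as `ρ → 0`, for all `α`. -/
def Ord (k : ℤ) (g : Eu n → ℂ) : Prop :=
  ContDiffOn ℝ ∞ g (T.U ν \ S) ∧ ∀ p : ℕ, ∃ δ : ℝ, 0 < δ ∧ OrdOn T.rho (T.shell ν δ) p k g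

/-- A smooth function on `U ν \ S` that is constant along the normal rays. -/
structure IsRadial (A : Eu n → ℂ) : Prop where
  smooth : ContDiffOn ℝ ∞ A (T.U ν \ S)
  ray_eq : ∀ x ∈ T.U ν \ S, ∀ s ∈ Ioo 0 (T.radius ν), A (T.ray s x) = A x

/-- The strong asymptotic expansion `g ∼ ∑_{j ≥ m} A_j ρ^j` with radial coefficients. -/
structure HasExp (m : ℤ) (g : Eu n → ℂ) (A : ℤ → Eu n → ℂ) : Prop where
  radial : ∀ j, IsRadial T ν (A j)
  eq_zero : ∀ j < m, ∀ x ∈ T.U ν \ S, A j x = 0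
  rem : ∀ N : ℤ, Ord T ν N (fun x => g x - ∑ j ∈ Finset.Ico m N, A j x * T.rhoPow j x)

variable {T ν}

theorem Ord.of_core (hS : IsClosed S) {k : ℤ} {g : Eu n → ℂ} (hg : ContDiffOn ℝ ∞ g (T.U ν \ S))
    (h : ∀ p, OrdOn T.rho (TubularSystem.core hS T ν) p k g) : Ord T ν k g :=
  ⟨hg, fun p => ⟨_, TubularSystem.coreRadius_pos hS, h p⟩⟩

theorem shell_rho_pos {δ : ℝ} : ∀ x ∈ T.shell ν δ, 0 < T.rho x :=
  fun _ hx => TubularSystem.rho_pos hx.1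

theorem Ord.congr (hS : IsClosed S) {k : ℤ} {f g : Eu n → ℂ} (h : EqOn f g (T.U ν \ S))
    (hf : Ord T ν k f) : Ord T ν k g :=
  ⟨hf.1.congr fun _ hx => (h hx).symm, fun p => (hf.2 p).imp fun _ hδ => ⟨hδ.1,
    OrdOn.congr (TubularSystem.diff_open (T := T) hS ν) TubularSystem.shell_sub h hδ.2⟩⟩

theorem Ord.zero (k : ℤ) : Ord T ν k 0 := ⟨contDiffOn_const, fun p => ⟨1, one_pos, OrdOn.zero p k⟩⟩

theorem Ord.comb (hS : IsClosed S) (a b : ℂ) {k : ℤ} {f g : Eu n → ℂ} (hf : Ord T ν k f)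
    (hg : Ord T ν k g) : Ord T ν k (fun x => a * f x + b * g x) := by
  refine ⟨(contDiffOn_const.mul hf.1).add (contDiffOn_const.mul hg.1), fun p => ?_⟩
  obtain ⟨δ, hδ, h⟩ := hf.2 p
  obtain ⟨δ', hδ', h'⟩ := hg.2 p
  exact ⟨min δ δ', lt_min hδ hδ', OrdOn.comb (TubularSystem.diff_open (T := T) hS ν)
    TubularSystem.shell_sub a b hf.1 hg.1
    (h.mono_set (TubularSystem.shell_mono (min_le_left _ _)))
    (h'.mono_set (TubularSystem.shell_mono (min_le_right _ _)))⟩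

theorem Ord.add (hS : IsClosed S) {k : ℤ} {f g : Eu n → ℂ} (hf : Ord T ν k f)
    (hg : Ord T ν k g) : Ord T ν k (fun x => f x + g x) := by
  simpa only [one_mul] using hf.comb hS 1 1 hg

theorem Ord.sub (hS : IsClosed S) {k : ℤ} {f g : Eu n → ℂ} (hf : Ord T ν k f)
    (hg : Ord T ν k g) : Ord T ν k (fun x => f x - g x) := by
  simpa only [one_mul, neg_mul, ← sub_eq_add_neg] using hf.comb hS 1 (-1) hg

theorem Ord.mul (hS : IsClosed S) {k l : ℤ} {f g : Eu n → ℂ} (hf : Ord T ν k f)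
    (hg : Ord T ν l g) : Ord T ν (k + l) (fun x => f x * g x) := by
  refine ⟨hf.1.mul hg.1, fun p => ?_⟩
  obtain ⟨δ, hδ, h⟩ := hf.2 p
  obtain ⟨δ', hδ', h'⟩ := hg.2 p
  exact ⟨min δ δ', lt_min hδ hδ', OrdOn.mul (TubularSystem.diff_open (T := T) hS ν)
    TubularSystem.shell_sub shell_rho_pos hf.1 hg.1
    (h.mono_set (TubularSystem.shell_mono (min_le_left _ _)))
    (h'.mono_set (TubularSystem.shell_mono (min_le_right _ _)))⟩

theorem Ord.sum (hS : IsClosed S) {k : ℤ} {ι : Type*} (s : Finset ι) {f : ι → Eu n → ℂ}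
    (hf : ∀ j ∈ s, Ord T ν k (f j)) : Ord T ν k (fun x => ∑ j ∈ s, f j x) := by
  classical
  induction s using Finset.induction_on with
  | empty => exact Ord.zero k
  | insert a s ha ih =>
    simp only [Finset.sum_insert ha]
    exact (hf a (by simp)).add hS (ih fun j hj => hf j (by simp [hj]))

theorem Ord.mono_exp {k k' : ℤ} (hk : k' ≤ k) {f : Eu n → ℂ} (hf : Ord T ν k f) : Ord T ν k' f :=
  ⟨hf.1, fun p => (hf.2 p).imp fun _ hδ => ⟨hδ.1, OrdOn.mono_exp shell_rho_pos
    (M := T.radius ν) (fun _ hx => (TubularSystem.rho_lt hx.1).le) hk hδ.2⟩⟩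

theorem Ord.pderiv (hS : IsClosed S) (i : Fin n) {k : ℤ} {f : Eu n → ℂ} (hf : Ord T ν k f) :
    Ord T ν (k - 1) (pderiv i f) :=
  ⟨pderiv_smooth (TubularSystem.diff_open (T := T) hS ν) i hf.1, fun p =>
    (hf.2 (p + 1)).imp fun _ hδ => ⟨hδ.1, hδ.2.2 i⟩⟩

theorem Ord.rhoPow (hS : IsClosed S) (j : ℤ) : Ord T ν j (T.rhoPow j) :=
  Ord.of_core hS (TubularSystem.rhoPow_smooth j) fun p => OrdOn.rhoPow hS p j

/-! ### Radial functions -/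

theorem IsRadial.const (c : ℂ) : IsRadial T ν (fun _ => c) := ⟨contDiffOn_const, fun _ _ _ _ => rfl⟩

theorem IsRadial.add {A B : Eu n → ℂ} (hA : IsRadial T ν A) (hB : IsRadial T ν B) :
    IsRadial T ν (fun x => A x + B x) :=
  ⟨hA.smooth.add hB.smooth, fun x hx s hs => by rw [hA.ray_eq x hx s hs, hB.ray_eq x hx s hs]⟩

theorem IsRadial.mul {A B : Eu n → ℂ} (hA : IsRadial T ν A) (hB : IsRadial T ν B) :
    IsRadial T ν (fun x => A x * B x) :=
  ⟨hA.smooth.mul hB.smooth, fun x hx s hs => by rw [hA.ray_eq x hx s hs, hB.ray_eq x hx s hs]⟩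

theorem IsRadial.sum {ι : Type*} (s : Finset ι) {A : ι → Eu n → ℂ}
    (h : ∀ j ∈ s, IsRadial T ν (A j)) : IsRadial T ν (fun x => ∑ j ∈ s, A j x) :=
  ⟨ContDiffOn.sum fun j hj => (h j hj).smooth, fun x hx t ht =>
    Finset.sum_congr rfl fun j hj => (h j hj).ray_eq x hx t ht⟩

theorem IsRadial.of_proj_dir {A : Eu n → ℂ} (h : ContDiffOn ℝ ∞ A (T.U ν \ S))
    {G : Eu n → Eu n → ℂ} (hA : A = fun x => G (T.proj x) (T.dir x)) : IsRadial T ν A :=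
  ⟨h, fun x hx s hs => by
    obtain ⟨-, h1, -, -, h2⟩ := TubularSystem.ray_spec hx hs
    rw [hA]
    beta_reduce
    rw [h1, h2]⟩

theorem ord_dir (hS : IsClosed S) (l : Fin n) :
    IsRadial T ν (coordFn T.dir l) ∧ Ord T ν 0 (coordFn T.dir l) := by
  have h : coordFn T.dir l = fun x => T.rhoPow (-1) x * T.normC l x := by
    ext x
    simp [coordFn, TubularSystem.dir, TubularSystem.normC, TubularSystem.rhoPow]
  have hn : Ord T ν 1 (T.normC l) :=
    Ord.of_core hS ((TubularSystem.normC_smooth l).mono TubularSystem.sub_tube) (OrdOn.normC hS l)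
  have ho : Ord T ν 0 (coordFn T.dir l) := by
    rw [h]
    exact (Ord.rhoPow hS (-1)).mul hS hn
  exact ⟨IsRadial.of_proj_dir ho.1 (G := fun _ w => (w l : ℂ)) rfl, ho⟩

theorem IsRadial.comp_ray {G : Eu n → ℂ} (hG : ContDiffOn ℝ ∞ G (T.U ν \ S))
    {s : ℝ} (hs : s ∈ Ioo 0 (T.radius ν)) : IsRadial T ν (G ∘ T.ray s) :=
  IsRadial.of_proj_dir (hG.comp (TubularSystem.ray_smooth s)
    fun _ hx => (TubularSystem.ray_spec hx hs).1) (G := fun ξ w => G (ξ + s • w)) rfl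

/-- The ray map sends the core into the level set ρ = s, where powers of ρ are constants. Hence
weighted estimates of G there are plain bounds, and the composition has order 0 on the whole core.
-/
theorem OrdOn.comp_ray (hS : IsClosed S) {G : Eu n → ℂ} (hG : ContDiffOn ℝ ∞ G (T.U ν \ S))
    {s δ : ℝ} (hs : s ∈ Ioo 0 (T.radius ν)) (hsδ : s < δ) {p : ℕ} {k : ℤ}
    (h : OrdOn T.rho (T.shell ν δ) p k G) :
    OrdOn T.rho (TubularSystem.core hS T ν) p 0 (G ∘ T.ray s) := by
  have hO := TubularSystem.diff_open (T := T) hS ν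
  have h1 : OrdOn T.rho {x ∈ T.U ν \ S | T.rho x = s} p k G :=
    h.mono_set fun x hx => show x ∈ T.shell ν δ from ⟨hx.1, lt_of_eq_of_lt hx.2 hsδ⟩
  have h2 := OrdOn.change_weight (r' := fun _ => 1) (k₀ := k) (s := 0)
    (fun x hx => TubularSystem.rho_pos hx.1)
    (fun j _ => ⟨s ^ j, fun x hx => by rw [hx.2, one_zpow, mul_one]⟩) le_rfl h1
  exact OrdOn.comp (E' := {x ∈ T.U ν \ S | T.rho x = s}) hO TubularSystem.shell_sub
    (TubularSystem.core_pos hS) hO (TubularSystem.ray_smooth s) (fun x hx => (TubularSystem.ray_spec hx hs).1)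
    (fun x hx => ⟨(TubularSystem.ray_spec hx.1 hs).1, (TubularSystem.ray_spec hx.1 hs).2.2.2.1⟩)
    (fun l => OrdOn.coordFn_ray hS s l p) hG h2

/-- The shell in `Ord` may shrink as the number of derivatives grows. A radial function equals its
composition with the map to any distance s, so choosing s inside that shell carries the estimates to
the core, which does not depend on p. -/
theorem IsRadial.ordOn_core (hS : IsClosed S) {A : Eu n → ℂ} (hA : IsRadial T ν A)
    (h : Ord T ν 0 A) (p : ℕ) : OrdOn T.rho (TubularSystem.core hS T ν) p 0 A := by
  obtain ⟨δ, hδ, hp⟩ := h.2 p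
  have hmin : 0 < min δ (T.radius ν) := lt_min hδ (T.radius_pos ν)
  have hlt : min δ (T.radius ν) / 2 < min δ (T.radius ν) := half_lt_self hmin
  have hs : min δ (T.radius ν) / 2 ∈ Ioo 0 (T.radius ν) :=
    ⟨half_pos hmin, hlt.trans_le (min_le_right _ _)⟩
  exact OrdOn.congr (TubularSystem.diff_open (T := T) hS ν) TubularSystem.shell_sub
    (fun x hx => hA.ray_eq x hx _ hs)
    (OrdOn.comp_ray hS hA.smooth hs (hlt.trans_le (min_le_left _ _)) hp)

/-! #### Algebra of expansions -/

theorem HasExp.congr (hS : IsClosed S) {m : ℤ} {f g : Eu n → ℂ} {A : ℤ → Eu n → ℂ}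
    (h : EqOn f g (T.U ν \ S)) (hf : HasExp T ν m f A) : HasExp T ν m g A :=
  ⟨hf.radial, hf.eq_zero, fun N => (hf.rem N).congr hS fun x hx => by
    rw [h hx]⟩

theorem HasExp.ord (hS : IsClosed S) {m : ℤ} {f : Eu n → ℂ} {A : ℤ → Eu n → ℂ}
    (hf : HasExp T ν m f A) : Ord T ν m f :=
  (hf.rem m).congr hS fun x _ => by simp

theorem sum_Ico_int_succ {m j : ℤ} (h : m ≤ j) (f : ℤ → ℂ) :
    ∑ i ∈ Finset.Ico m (j + 1), f i = ∑ i ∈ Finset.Ico m j, f i + f j := by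
  have : Finset.Ico m (j + 1) = insert j (Finset.Ico m j) := by
    ext i
    simp only [Finset.mem_Ico, Finset.mem_insert]
    omega
  rw [this, Finset.sum_insert (by simp), add_comm]

/-- Below m the term is zero. From m on it is the difference of two consecutive remainders, so its
estimates come with the expansion although none is assumed for the coefficients. -/
theorem HasExp.term_ord (hS : IsClosed S) {m : ℤ} {f : Eu n → ℂ} {A : ℤ → Eu n → ℂ}
    (hf : HasExp T ν m f A) (j : ℤ) : Ord T ν j (fun x => A j x * T.rhoPow j x) := by
  by_cases hj : j < m
  · refine (Ord.zero j).congr hS fun x hx => ?_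
    rw [hf.eq_zero j hj x hx, zero_mul]
    rfl
  · refine ((hf.rem j).sub hS ((hf.rem (j + 1)).mono_exp (by omega))).congr hS fun x _ => ?_
    rw [sum_Ico_int_succ (not_lt.1 hj)]
    ring

theorem HasExp.coeff_ord (hS : IsClosed S) {m : ℤ} {f : Eu n → ℂ} {A : ℤ → Eu n → ℂ}
    (hf : HasExp T ν m f A) (j : ℤ) : Ord T ν 0 (A j) := by
  have h := (hf.term_ord hS j).mul hS (Ord.rhoPow hS (-j))
  rw [add_neg_cancel] at h
  refine h.congr hS fun x hx => ?_
  have h0 : (T.rho x : ℂ) ≠ 0 := Complex.ofReal_ne_zero.2 (TubularSystem.rho_pos hx).ne'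
  simp only [TubularSystem.rhoPow]
  rw [mul_assoc, ← zpow_add₀ h0, add_neg_cancel, zpow_zero, mul_one]

theorem sum_Ico_of_eq_zero {m m' N : ℤ} (hm : m' ≤ m) {f : ℤ → ℂ} (hf : ∀ j < m, f j = 0) :
    ∑ j ∈ Finset.Ico m' N, f j = ∑ j ∈ Finset.Ico m N, f j := by
  refine (Finset.sum_subset (Finset.Ico_subset_Ico_left hm) fun j hj hj' => hf j ?_).symm
  simp only [Finset.mem_Ico] at hj hj'
  omega

theorem HasExp.mono (hS : IsClosed S) {m m' : ℤ} (hm : m' ≤ m) {f : Eu n → ℂ}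
    {A : ℤ → Eu n → ℂ} (hf : HasExp T ν m f A) : HasExp T ν m' f A :=
  ⟨hf.radial, fun j hj => hf.eq_zero j (hj.trans_le hm), fun N =>
    (hf.rem N).congr hS fun x hx => by
      rw [sum_Ico_of_eq_zero hm fun j hj => by rw [hf.eq_zero j hj x hx, zero_mul]]⟩

theorem HasExp.comb (hS : IsClosed S) {m : ℤ} {f g : Eu n → ℂ} {A B : ℤ → Eu n → ℂ} (a b : ℂ)
    (hf : HasExp T ν m f A) (hg : HasExp T ν m g B) :
    HasExp T ν m (fun x => a * f x + b * g x) (fun j x => a * A j x + b * B j x) := by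
  refine ⟨fun j => ((IsRadial.const a).mul (hf.radial j)).add ((IsRadial.const b).mul (hg.radial j)),
    fun j hj x hx => by simp [hf.eq_zero j hj x hx, hg.eq_zero j hj x hx], fun N =>
    ((hf.rem N).comb hS a b (hg.rem N)).congr hS fun x _ => ?_⟩
  simp only [mul_sub, Finset.mul_sum, add_mul, Finset.sum_add_distrib, mul_assoc]
  ring

/-- Below both leading exponents all coefficients vanish. At the first index not yet treated,
compare the two remainders along the ray through x: the coefficients are constant there, so their
difference is O(t) as t → 0. -/
theorem HasExp.unique (hS : IsClosed S) {m m' : ℤ} {f : Eu n → ℂ} {A B : ℤ → Eu n → ℂ}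
    (hf : HasExp T ν m f A) (hg : HasExp T ν m' f B) (j : ℤ) {x : Eu n} (hx : x ∈ T.U ν \ S) :
    A j x = B j x := by
  have hm := hf.mono hS (min_le_left m m')
  have hm' := hg.mono hS (min_le_right m m')
  generalize min m m' = q at hm hm'
  have key : ∀ k : ℕ, ∀ j < q + k, ∀ x ∈ T.U ν \ S, A j x = B j x := by
    intro k
    induction k with
    | zero =>
      intro j hj x hx
      have hj' : j < q := by simpa using hj
      rw [hm.eq_zero j hj' x hx, hm'.eq_zero j hj' x hx]
    | succ k ih =>
      intro j hj x hx
      rcases (show j < q + k ∨ j = q + k by push_cast at hj; omega) with h | rfl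
      · exact ih j h x hx
      -- Remainders past the index q + k are compared, so that after cancelling the earlier terms
      -- only this one is left, with a spare power of t.
      · obtain ⟨δ, hδ, h1⟩ := ((hm'.rem (q + k + 1)).sub hS (hm.rem (q + k + 1))).2 0
        obtain ⟨C, hC⟩ := h1.bound
        have hb : ∀ t ∈ Ioo 0 (min δ (T.radius ν)),
            ‖A (q + k) x - B (q + k) x‖ ≤ C * t := by
          intro t ht
          obtain ⟨hr, -, -, hrho, -⟩ := TubularSystem.ray_spec hx
            (s := t) ⟨ht.1, ht.2.trans_le (min_le_right _ _)⟩
          have h2 := hC (T.ray t x) ⟨hr, hrho.trans_lt (ht.2.trans_le (min_le_left _ _))⟩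
          have h3 : ∀ j, A j (T.ray t x) = A j x := fun j =>
            (hm.radial j).ray_eq x hx t ⟨ht.1, ht.2.trans_le (min_le_right _ _)⟩
          have h4 : ∀ j, B j (T.ray t x) = B j x := fun j =>
            (hm'.radial j).ray_eq x hx t ⟨ht.1, ht.2.trans_le (min_le_right _ _)⟩
          simp only [h3, h4, TubularSystem.rhoPow, hrho, sub_sub_sub_cancel_left] at h2
          rw [← Finset.sum_sub_distrib, Finset.sum_eq_single (q + k), ← sub_mul, norm_mul,
            norm_zpow, Complex.norm_real, Real.norm_of_nonneg ht.1.le, zpow_add_one₀ ht.1.ne',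
            mul_comm (t ^ (q + (k : ℤ))), ← mul_assoc] at h2
          · exact le_of_mul_le_mul_right h2 (zpow_pos ht.1 _)
          · intro j hj hne
            rw [Finset.mem_Ico] at hj
            rw [ih j (by omega) x hx, sub_self]
          · intro h
            exact absurd (Finset.mem_Ico.2 ⟨by omega, by omega⟩) h
        have hlim : Filter.Tendsto (fun t : ℝ => C * t) (𝓝[>] 0) (𝓝 0) := by
          have : Filter.Tendsto (fun t : ℝ => C * t) (𝓝 0) (𝓝 (C * 0)) :=
            (continuous_const.mul continuous_id).tendsto 0
          rw [mul_zero] at this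
          exact this.mono_left nhdsWithin_le_nhds
        have := ge_of_tendsto hlim (Filter.eventually_of_mem
          (Ioo_mem_nhdsGT (lt_min hδ (T.radius_pos ν))) hb)
        exact sub_eq_zero.1 (norm_le_zero_iff.1 this)
  exact key (j - q + 1).toNat j (by omega) x hx

theorem cauchy_sum (p r N : ℤ) (f : ℤ → ℤ → ℂ) :
    ∑ j ∈ Finset.Ico r (N - p), ∑ i ∈ Finset.Ico p (N - j), f i j =
      ∑ l ∈ Finset.Ico (p + r) N, ∑ j ∈ Finset.Ico r (l - p + 1), f (l - j) j := by
  rw [Finset.sum_sigma', Finset.sum_sigma']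
  refine Finset.sum_bij' (fun z _ => ⟨z.2 + z.1, z.1⟩) (fun z _ => ⟨z.2, z.1 - z.2⟩) ?_ ?_ ?_ ?_ ?_
  · simp only [Finset.mem_sigma, Finset.mem_Ico]; intros; omega
  · simp only [Finset.mem_sigma, Finset.mem_Ico]; intros; omega
  · rintro ⟨a, b⟩ _; simp
  · rintro ⟨a, b⟩ _; simp
  · rintro ⟨a, b⟩ _; simp

/-- Replace Φ by its partial sum up to N - p, then in the term with exponent j replace G by its
partial sum up to N - j. The double sum that is left is the Cauchy product truncated at N. When G
starts at order p and Φ at order r, both error terms on the right have order N. -/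
theorem cauchy_identity (p r N : ℤ) {ρ : ℂ} (hρ : ρ ≠ 0) (G Φ : ℂ) (B C : ℤ → ℂ) :
    G * Φ - ∑ l ∈ Finset.Ico (p + r) N, (∑ j ∈ Finset.Ico r (l - p + 1), B (l - j) * C j) * ρ ^ l =
      G * (Φ - ∑ j ∈ Finset.Ico r (N - p), C j * ρ ^ j) +
        ∑ j ∈ Finset.Ico r (N - p), C j * ρ ^ j *
          (G - ∑ i ∈ Finset.Ico p (N - j), B i * ρ ^ i) := by
  have h1 : ∑ l ∈ Finset.Ico (p + r) N, (∑ j ∈ Finset.Ico r (l - p + 1), B (l - j) * C j) * ρ ^ l =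
      ∑ j ∈ Finset.Ico r (N - p), C j * ρ ^ j * ∑ i ∈ Finset.Ico p (N - j), B i * ρ ^ i := by
    simp only [Finset.mul_sum]
    rw [cauchy_sum p r N fun i j => C j * ρ ^ j * (B i * ρ ^ i)]
    refine Finset.sum_congr rfl fun l _ => ?_
    rw [Finset.sum_mul]
    refine Finset.sum_congr rfl fun j _ => ?_
    rw [mul_mul_mul_comm, ← zpow_add₀ hρ, add_sub_cancel, mul_comm (B _)]
  simp only [h1, mul_sub, Finset.sum_sub_distrib, ← Finset.sum_mul]
  ring

theorem HasExp.mul (hS : IsClosed S) {p r : ℤ} {f g : Eu n → ℂ} {A B : ℤ → Eu n → ℂ}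
    (hf : HasExp T ν p f A) (hg : HasExp T ν r g B) :
    HasExp T ν (p + r) (fun x => f x * g x)
      (fun l x => ∑ j ∈ Finset.Ico r (l - p + 1), A (l - j) x * B j x) := by
  refine ⟨fun l => IsRadial.sum _ fun j _ => (hf.radial _).mul (hg.radial _), fun l hl x _ => ?_,
    fun N => ?_⟩
  · rw [Finset.Ico_eq_empty (by omega), Finset.sum_empty]
  · have h1 := (hf.ord hS).mul hS (hg.rem (N - p))
    rw [add_sub_cancel] at h1
    have h2 := Ord.sum hS (Finset.Ico r (N - p)) fun j _ => by
      have := (hg.term_ord hS j).mul hS (hf.rem (N - j))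
      rwa [add_sub_cancel] at this
    refine (h1.add hS h2).congr hS fun x hx => ?_
    exact (cauchy_identity p r N (Complex.ofReal_ne_zero.2 (TubularSystem.rho_pos hx).ne')
      (f x) (g x) (fun j => A j x) (fun j => B j x)).symm

theorem HasExp.monomial (hS : IsClosed S) {A : Eu n → ℂ} (hA : IsRadial T ν A) (h : Ord T ν 0 A)
    (m : ℤ) : HasExp T ν m (fun x => A x * T.rhoPow m x) (fun j x => if j = m then A x else 0) := by
  refine ⟨fun j => ?_, fun j hj x _ => if_neg hj.ne, fun N => ?_⟩
  · by_cases hj : j = m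
    · simpa only [hj, if_true] using hA
    · simpa only [hj, if_false] using IsRadial.const 0
  · by_cases hN : N ≤ m
    · have h1 := h.mul hS (Ord.rhoPow hS m)
      rw [zero_add] at h1
      refine (h1.mono_exp hN).congr hS fun x _ => ?_
      simp [Finset.Ico_eq_empty (not_lt.2 hN)]
    · refine (Ord.zero N).congr hS fun x _ => ?_
      simp only [ite_mul, zero_mul, Finset.sum_ite_eq', Finset.mem_Ico, le_refl, true_and,
        not_le.1 hN, if_true, sub_self]
      rfl

theorem IsRadial.taylor (hS : IsClosed S) (j : ℕ) : ∀ {F : Eu n → ℂ},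
    ContDiffOn ℝ ∞ F (tube S T.eps) →
      IsRadial T ν (fun x => taylorTerm j F (T.proj x) (T.dir x)) := by
  induction j with
  | zero => exact fun {F} hF => IsRadial.of_proj_dir ((TubularSystem.normalTaylor_smooth 0 hF).mono
      TubularSystem.sub_tube) (G := fun ξ _ => F ξ) rfl
  | succ j ih => exact fun {F} hF => (IsRadial.const _).mul (IsRadial.sum _ fun k _ =>
      (ord_dir hS k).1.mul (ih (pderiv_smooth (tube_open S T.eps) k hF)))

theorem TubularSystem.normalTaylor_eq (j : ℕ) (F : Eu n → ℂ) {x : Eu n} (hx : x ∈ T.U ν \ S) :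
    T.normalTaylor j F x = taylorTerm j F (T.proj x) (T.dir x) * T.rhoPow j x := by
  rw [TubularSystem.normalTaylor, TubularSystem.sub_proj hx, taylorTerm_smul, mul_comm,
    TubularSystem.rhoPow, zpow_natCast]

theorem sum_Ico_int_eq_range (N : ℕ) (f : ℤ → ℂ) :
    ∑ j ∈ Finset.Ico (0 : ℤ) N, f j = ∑ j ∈ Finset.range N, f j := by
  refine (Finset.sum_nbij' (fun j : ℕ => (j : ℤ)) Int.toNat ?_ ?_ ?_ ?_ ?_).symm
  · simp
  · simp only [Finset.mem_Ico, Finset.mem_range]; intros; omega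
  · simp
  · simp only [Finset.mem_Ico]; intros; omega
  · simp

/-- Taylor terms are homogeneous in the direction, so the one of degree j is ρ^j times a function of
π(x) and the unit normal direction, and such functions are radial. -/
theorem HasExp.of_smooth (hS : IsClosed S) {F : Eu n → ℂ} (hF : ContDiffOn ℝ ∞ F (tube S T.eps)) :
    HasExp T ν 0 F (fun j x => if j < 0 then 0 else taylorTerm j.toNat F (T.proj x) (T.dir x)) := by
  refine ⟨fun j => ?_, fun j hj x _ => if_pos hj, fun N => ?_⟩
  · by_cases hj : j < 0
    · simpa only [hj, if_true] using IsRadial.const 0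
    · simpa only [hj, if_false] using IsRadial.taylor hS _ hF
  · rcases le_or_gt N 0 with hN | hN
    · have h1 : Ord T ν 0 F := Ord.of_core hS (hF.mono TubularSystem.sub_tube) fun p =>
        OrdOn.of_smooth_tube hS p hF
      refine (h1.mono_exp hN).congr hS fun x _ => ?_
      simp [Finset.Ico_eq_empty (not_lt.2 hN)]
    · obtain ⟨N, rfl⟩ := Int.eq_ofNat_of_zero_le hN.le
      refine (Ord.of_core hS ((TubularSystem.taylorRem_smooth N hF).mono TubularSystem.sub_tube)
        fun p => OrdOn.taylorRem hS N p hF).congr hS fun x hx => ?_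
      rw [sum_Ico_int_eq_range, TubularSystem.taylorRem]
      congr 1
      refine Finset.sum_congr rfl fun j _ => ?_
      rw [TubularSystem.normalTaylor_eq j F hx]
      simp

/-! ### Stability of expandable functions under products and derivatives -/

variable (T ν) in
/-- `g` has some expansion with leading exponent at least `m`. -/
def Expandable (m : ℤ) (g : Eu n → ℂ) : Prop := ∃ A, HasExp T ν m g A

theorem Expandable.congr (hS : IsClosed S) {m : ℤ} {f g : Eu n → ℂ} (h : EqOn f g (T.U ν \ S))
    (hf : Expandable T ν m f) : Expandable T ν m g :=
  hf.imp fun _ hA => hA.congr hS h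

theorem Expandable.comb (hS : IsClosed S) {m : ℤ} {f g : Eu n → ℂ} (a b : ℂ)
    (hf : Expandable T ν m f) (hg : Expandable T ν m g) :
    Expandable T ν m (fun x => a * f x + b * g x) :=
  ⟨_, hf.choose_spec.comb hS a b hg.choose_spec⟩

theorem Expandable.add (hS : IsClosed S) {m : ℤ} {f g : Eu n → ℂ}
    (hf : Expandable T ν m f) (hg : Expandable T ν m g) :
    Expandable T ν m (fun x => f x + g x) := by
  simpa only [one_mul] using hf.comb hS 1 1 hg

theorem Expandable.const_mul (hS : IsClosed S) {m : ℤ} {f : Eu n → ℂ} (c : ℂ)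
    (hf : Expandable T ν m f) : Expandable T ν m (fun x => c * f x) := by
  simpa only [zero_mul, add_zero] using hf.comb hS c 0 hf

theorem Expandable.mul (hS : IsClosed S) {m m' : ℤ} {f g : Eu n → ℂ}
    (hf : Expandable T ν m f) (hg : Expandable T ν m' g) :
    Expandable T ν (m + m') (fun x => f x * g x) :=
  ⟨_, hf.choose_spec.mul hS hg.choose_spec⟩

theorem Expandable.mono (hS : IsClosed S) {m m' : ℤ} (hm : m' ≤ m) {f : Eu n → ℂ}
    (hf : Expandable T ν m f) : Expandable T ν m' f :=
  hf.imp fun _ hA => hA.mono hS hm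

theorem Expandable.zero (hS : IsClosed S) (m : ℤ) : Expandable T ν m 0 := by
  have h := (HasExp.monomial (m := m) hS (IsRadial.const (T := T) (ν := ν) 0) (Ord.zero 0))
  exact Expandable.congr hS (fun x _ => by simp) ⟨_, h⟩

theorem Expandable.sum (hS : IsClosed S) {m : ℤ} {ι : Type*} (s : Finset ι) {f : ι → Eu n → ℂ}
    (hf : ∀ j ∈ s, Expandable T ν m (f j)) : Expandable T ν m (fun x => ∑ j ∈ s, f j x) := by
  classical
  induction s using Finset.induction_on with
  | empty => exact Expandable.zero hS m
  | insert a s ha ih =>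
    simp only [Finset.sum_insert ha]
    exact (hf a (by simp)).add hS (ih fun j hj => hf j (by simp [hj]))

theorem Expandable.of_smooth (hS : IsClosed S) {F : Eu n → ℂ}
    (hF : ContDiffOn ℝ ∞ F (tube S T.eps)) : Expandable T ν 0 F := ⟨_, HasExp.of_smooth hS hF⟩

theorem Expandable.of_radial (hS : IsClosed S) {A : Eu n → ℂ} (hA : IsRadial T ν A)
    (h : Ord T ν 0 A) : Expandable T ν 0 A :=
  Expandable.congr hS (fun x _ => by simp [TubularSystem.rhoPow]) ⟨_, HasExp.monomial hS hA h 0⟩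

theorem Expandable.rhoPow (hS : IsClosed S) (j : ℤ) : Expandable T ν j (T.rhoPow j) :=
  Expandable.congr hS (fun x _ => by simp) ⟨_, HasExp.monomial hS (IsRadial.const 1)
    (Ord.of_core hS contDiffOn_const fun p => OrdOn.of_smooth_tube hS p contDiffOn_const) j⟩

theorem Expandable.normC (hS : IsClosed S) (l : Fin n) : Expandable T ν 1 (T.normC l) := by
  refine Expandable.congr hS (fun x hx => ?_) ⟨_, HasExp.monomial hS (ord_dir hS l).1 (ord_dir hS l).2 1⟩
  simp only [coordFn, TubularSystem.normC, TubularSystem.rhoPow, zpow_one]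
  rw [TubularSystem.sub_proj hx]
  simp [mul_comm]

theorem Expandable.pderiv_rhoPow (hS : IsClosed S) (i : Fin n) (j : ℤ) :
    Expandable T ν (j - 1) (ThickDist.pderiv i (T.rhoPow j)) := by
  refine Expandable.congr hS (TubularSystem.pderiv_rhoPow hS i j).symm (Expandable.const_mul hS _ ?_)
  have := (Expandable.rhoPow (T := T) (ν := ν) hS (j - 2)).mul hS (Expandable.sum hS Finset.univ
    fun l _ => (Expandable.normC (T := T) (ν := ν) hS l).mul hS (Expandable.of_smooth hS
      (pderiv_smooth (tube_open S T.eps) i (TubularSystem.normC_smooth l))))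
  rwa [show j - 2 + (1 + 0) = j - 1 by ring] at this

/-- Differentiate A = A ∘ r_s by the chain rule. The factors ∂_l A ∘ r_s are radial of order 0, and
the derivatives of r_s = π + s ρ⁻¹ (x - π) expand from exponent -1. -/
theorem Expandable.pderiv_radial (hS : IsClosed S) (i : Fin n) {A : Eu n → ℂ}
    (hA : IsRadial T ν A) (h : Ord T ν 0 A) : Expandable T ν (-1) (ThickDist.pderiv i A) := by
  have hO := TubularSystem.diff_open (T := T) hS ν
  have hc := TubularSystem.coreRadius_pos (T := T) (ν := ν) hS
  -- One fixed s has to serve derivatives of all orders, so it is taken inside the core.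
  set s := TubularSystem.coreRadius hS T ν / 2 with hs_def
  have hsδ : s < TubularSystem.coreRadius hS T ν := half_lt_self hc
  have hs : s ∈ Ioo 0 (T.radius ν) :=
    ⟨half_pos hc, hsδ.trans_le (TubularSystem.coreRadius_le hS)⟩
  have hd : ∀ l, ContDiffOn ℝ ∞ (ThickDist.pderiv l A) (T.U ν \ S) := fun l =>
    pderiv_smooth hO l hA.smooth
  have h1 : EqOn (ThickDist.pderiv i A) (fun x => ∑ l, ThickDist.pderiv i (coordFn (T.ray s) l) x *
      (ThickDist.pderiv l A ∘ T.ray s) x) (T.U ν \ S) := fun x hx => by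
    rw [← pderiv_comp hO hO (TubularSystem.ray_smooth s)
      (fun x hx => (TubularSystem.ray_spec hx hs).1) hA.smooth i hx]
    exact pderiv_congr hO i (fun x hx => (hA.ray_eq x hx s hs).symm) hx
  refine Expandable.congr hS h1.symm (Expandable.sum hS _ fun l _ => ?_)
  have h2 : Expandable T ν 0 (ThickDist.pderiv l A ∘ T.ray s) :=
    Expandable.of_radial hS (IsRadial.comp_ray (hd l) hs)
      (Ord.of_core hS (IsRadial.comp_ray (hd l) hs).smooth fun p =>
        OrdOn.comp_ray hS (hd l) hs hsδ ((hA.ordOn_core hS h (p + 1)).2 l))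
  have hn : ContDiffOn ℝ ∞ (T.normC l) (T.U ν \ S) :=
    (TubularSystem.normC_smooth l).mono TubularSystem.sub_tube
  have h3 : Expandable T ν (-1) (ThickDist.pderiv i (coordFn (T.ray s) l)) := by
    have e1 := pderiv_comb hO i ((TubularSystem.projC_smooth (T := T) l).mono TubularSystem.sub_tube)
      ((TubularSystem.rhoPow_smooth (T := T) (ν := ν) (-1)).mul hn) 1 s
      (h := coordFn (T.ray s) l) fun x _ => by rw [TubularSystem.coordFn_ray]
    refine Expandable.congr hS e1.symm (Expandable.comb hS 1 s
      ((Expandable.of_smooth hS (pderiv_smooth (tube_open S T.eps) i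
        (TubularSystem.projC_smooth l))).mono hS (by norm_num)) ?_)
    have e2 := (Expandable.pderiv_rhoPow (T := T) (ν := ν) hS i (-1)).mul hS
      (Expandable.normC (T := T) (ν := ν) hS l)
    have e3 := (Expandable.rhoPow (T := T) (ν := ν) hS (-1)).mul hS
      (Expandable.of_smooth (ν := ν) hS (pderiv_smooth (tube_open S T.eps) i
        (TubularSystem.normC_smooth (T := T) l)))
    exact Expandable.congr hS (pderiv_mul hO i (TubularSystem.rhoPow_smooth (-1)) hn).symm
      (Expandable.add hS (e2.mono hS (by norm_num)) (e3.mono hS (by norm_num)))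
  have := h3.mul hS h2
  rwa [add_zero] at this

theorem HasExp.pderiv_term (hS : IsClosed S) (i : Fin n) {m : ℤ} {f : Eu n → ℂ}
    {A : ℤ → Eu n → ℂ} (hf : HasExp T ν m f A) (j : ℤ) :
    Expandable T ν (j - 1) (ThickDist.pderiv i (fun x => A j x * T.rhoPow j x)) := by
  have hO := TubularSystem.diff_open (T := T) hS ν
  have hA := hf.radial j
  have h0 := hf.coeff_ord hS j
  refine Expandable.congr hS (pderiv_mul hO i hA.smooth (TubularSystem.rhoPow_smooth j)).symm
    (Expandable.add hS ?_ ?_)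
  · have := (Expandable.pderiv_radial hS i hA h0).mul hS (Expandable.rhoPow hS j)
    rwa [neg_add_eq_sub] at this
  · have := (Expandable.of_radial hS hA h0).mul hS (Expandable.pderiv_rhoPow hS i j)
    rwa [zero_add] at this

theorem HasExp.smooth (hS : IsClosed S) {m : ℤ} {f : Eu n → ℂ} {A : ℤ → Eu n → ℂ}
    (hf : HasExp T ν m f A) : ContDiffOn ℝ ∞ f (T.U ν \ S) := (hf.ord hS).1

/-- Differentiation costs one order of the remainder, and the derivative of the j-th term expands
from j - 1. Hence only finitely many terms contribute to each power of ρ and the expansions can be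
added. -/
theorem Expandable.pderiv (hS : IsClosed S) (i : Fin n) {m : ℤ} {f : Eu n → ℂ}
    (hf : Expandable T ν m f) : Expandable T ν (m - 1) (ThickDist.pderiv i f) := by
  have hO := TubularSystem.diff_open (T := T) hS ν
  obtain ⟨A, hA⟩ := hf
  choose E hE using hA.pderiv_term hS i
  -- The bound j < l + 2 says j - 1 ≤ l: exactly these terms reach the exponent l.
  refine ⟨fun l x => ∑ j ∈ Finset.Ico m (l + 2), E j l x, fun l => IsRadial.sum _ fun j _ =>
    (hE j).radial l, fun l hl x _ => ?_, fun N => ?_⟩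
  · rw [Finset.Ico_eq_empty (by omega), Finset.sum_empty]
  · have h1 := (hA.rem (N + 1)).pderiv hS i
    rw [add_sub_cancel_right] at h1
    refine (h1.add hS (Ord.sum hS (Finset.Ico m (N + 1)) fun j _ => (hE j).rem N)).congr hS
      fun x hx => ?_
    have ht : ∀ j, ContDiffOn ℝ ∞ (fun x => A j x * T.rhoPow j x) (T.U ν \ S) := fun j =>
      (hA.radial j).smooth.mul (TubularSystem.rhoPow_smooth j)
    have h2 := pderiv_sub hO i (hA.smooth hS) (ContDiffOn.sum
      (s := Finset.Ico m (N + 1)) fun j _ => ht j) hx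
    beta_reduce at h2 ⊢
    rw [pderiv_fun_sum hO i _ (fun j _ => ht j) hx] at h2
    rw [h2, Finset.sum_sub_distrib]
    have h3 : ∑ j ∈ Finset.Ico m (N + 1), ∑ l ∈ Finset.Ico (j - 1) N, E j l x * T.rhoPow l x =
        ∑ l ∈ Finset.Ico (m - 1) N, (∑ j ∈ Finset.Ico m (l + 2), E j l x) * T.rhoPow l x := by
      simp only [Finset.sum_mul]
      refine Finset.sum_comm' fun j l => ?_
      simp only [Finset.mem_Ico]
      omega
    rw [h3]
    ring

theorem Expandable.mderiv (hS : IsClosed S) (α : Fin n → ℕ) {m : ℤ} {f : Eu n → ℂ}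
    (hf : Expandable T ν m f) : Expandable T ν (m - mlen α) (mderiv α f) := by
  have hi : ∀ (i : Fin n) (k : ℕ) {m : ℤ} {f : Eu n → ℂ}, Expandable T ν m f →
      Expandable T ν (m - k) ((ThickDist.pderiv i)^[k] f) := fun i k => by
    induction k with
    | zero => intro m f hf; simpa using hf
    | succ k ih =>
      intro m f hf
      rw [Function.iterate_succ_apply']
      have := (ih hf).pderiv hS i
      rwa [sub_sub, ← Nat.cast_succ] at this
  unfold ThickDist.mderiv
  rw [mlen, Fin.sum_univ_def]
  generalize List.finRange n = l
  induction l with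
  | nil => simpa using hf
  | cons i l ih =>
    rw [List.map_cons, List.sum_cons, List.foldr_cons]
    have := hi i (α i) ih
    rwa [sub_sub, ← Nat.cast_add, add_comm (List.sum _)] at this

end Expansions

/-! ### Strong expansions and step spaces -/

section Steps

variable {n d : ℕ} {S : Set (Eu n)} {T : TubularSystem S d} {ν : ℕ}

theorem mderiv_eqOn_zero {O : Set (Eu n)} (hO : IsOpen O) (α : Fin n → ℕ) {f : Eu n → ℂ}
    (h : EqOn f 0 O) : EqOn (mderiv α f) 0 O := by
  have := mderiv_comb hO α 0 0 (contDiffOn_const (c := (0 : ℂ))) (contDiffOn_const (c := (0 : ℂ)))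
    (h := f) (fun x hx => by simp [h hx])
  intro x hx
  simpa using this hx

theorem mderiv_fun_sum {O : Set (Eu n)} (hO : IsOpen O) (α : Fin n → ℕ) {ι : Type*} (s : Finset ι)
    {f : ι → Eu n → ℂ} (hf : ∀ j ∈ s, ContDiffOn ℝ ∞ (f j) O) :
    EqOn (mderiv α (fun x => ∑ j ∈ s, f j x)) (fun x => ∑ j ∈ s, mderiv α (f j) x) O := by
  classical
  induction s using Finset.induction_on with
  | empty =>
    simp only [Finset.sum_empty]
    exact mderiv_eqOn_zero hO α fun _ _ => rfl
  | insert a s ha ih =>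
    intro x hx
    have hs : ∀ j ∈ s, ContDiffOn ℝ ∞ (f j) O := fun j hj => hf j (by simp [hj])
    have := mderiv_comb hO α 1 1 (hf a (by simp)) (ContDiffOn.sum hs)
      (h := fun x => ∑ j ∈ insert a s, f j x) (fun x _ => by simp [Finset.sum_insert ha]) hx
    rw [this]
    beta_reduce
    rw [ih hs hx]
    simp [Finset.sum_insert ha]

theorem mderiv_sub_sum {O : Set (Eu n)} (hO : IsOpen O) (α : Fin n → ℕ) {ι : Type*} (s : Finset ι)
    {g : Eu n → ℂ} {f : ι → Eu n → ℂ} (hg : ContDiffOn ℝ ∞ g O)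
    (hf : ∀ j ∈ s, ContDiffOn ℝ ∞ (f j) O) :
    EqOn (mderiv α (fun x => g x - ∑ j ∈ s, f j x))
      (fun x => mderiv α g x - ∑ j ∈ s, mderiv α (f j) x) O := by
  intro x hx
  have := mderiv_comb hO α 1 (-1) hg (ContDiffOn.sum hf)
    (h := fun x => g x - ∑ j ∈ s, f j x) (fun x _ => by ring) hx
  rw [this]
  beta_reduce
  rw [mderiv_fun_sum hO α s hf hx]
  ring

theorem exists_pos_le_finset {ι : Type*} (s : Finset ι) {δ : ι → ℝ} (h : ∀ i ∈ s, 0 < δ i) :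
    ∃ ε : ℝ, 0 < ε ∧ ∀ i ∈ s, ε ≤ δ i := by
  classical
  induction s using Finset.induction_on with
  | empty => exact ⟨1, one_pos, by simp⟩
  | insert a s _ ih =>
    obtain ⟨ε, hε, hs⟩ := ih fun i hi => h i (by simp [hi])
    refine ⟨min ε (δ a), lt_min hε (h a (by simp)), fun i hi => ?_⟩
    rcases Finset.mem_insert.1 hi with rfl | hi
    · exact min_le_right _ _
    · exact (min_le_left _ _).trans (hs i hi)

theorem mem_Iic_of_mlen_le {α : Fin n → ℕ} {p : ℕ} (h : mlen α ≤ p) :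
    α ∈ Finset.Iic (fun _ : Fin n => p) :=
  Finset.mem_Iic.2 fun i => (Finset.single_le_sum (f := α) (fun _ _ => Nat.zero_le _)
    (Finset.mem_univ i)).trans h

theorem StrongExp.hasExp (hS : IsClosed S) {φ : Eu n → ℂ} {m : ℤ} {a : ℤ → Eu n × Eu d → ℂ}
    (hφ : ContDiffOn ℝ ∞ φ (T.U ν \ S)) (h : T.StrongExp ν φ m a) :
    HasExp T ν m φ (fun j x => a j (T.proj x, T.omega (T.frame ν) x)) := by
  have hO := TubularSystem.diff_open (T := T) hS ν
  have ht : ∀ j, ContDiffOn ℝ ∞ (T.term ν (a j) j) (T.U ν \ S) := fun j =>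
    TubularSystem.term_smooth (h.smooth j) j
  refine ⟨fun j => ⟨?_, fun x hx s hs => ?_⟩, fun j hj x hx =>
    h.eq_zero j hj _ (TubularSystem.coord_mem hx).1, fun N =>
    ⟨hφ.sub (ContDiffOn.sum fun j _ => ht j), fun p => ?_⟩⟩
  · exact (TubularSystem.term_smooth (h.smooth j) 0).congr fun x _ => by
      simp [TubularSystem.term]
  · obtain ⟨-, h1, h2, -, -⟩ := TubularSystem.ray_spec hx hs
    rw [h1, h2]
  · choose C δ hδ hC using fun α => h.remainder α N
    -- The radius δ depends on α; only finitely many α matter for p derivatives.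
    obtain ⟨ε, hε, hεδ⟩ := exists_pos_le_finset (Finset.Iic fun _ : Fin n => p) fun α _ => hδ α
    refine ⟨ε, hε, OrdOn.of_mderiv hO TubularSystem.shell_sub
      (hφ.sub (ContDiffOn.sum fun j _ => ht j)) fun α hα => ⟨C α, fun x hx => ?_⟩⟩
    have h1 := mderiv_sub_sum hO α (Finset.Ico m N) hφ (fun j _ => ht j) hx.1
    have h2 := hC α x hx.1 (hx.2.trans_le (hεδ α (mem_Iic_of_mlen_le hα)))
    beta_reduce at h1
    rwa [← h1] at h2

/-- A radial function is determined by its values at distance radius/2. Pulling it back along the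
frame parametrisation of that level set gives a smooth function of (ξ, ω). -/
theorem HasExp.strongExp (hS : IsClosed S) {φ : Eu n → ℂ} {m : ℤ} {A : ℤ → Eu n → ℂ}
    (h : HasExp T ν m φ A) : T.StrongExp ν φ m
      (fun j p => A j (p.1 + (T.radius ν / 2) • ∑ k, p.2 k • T.frame ν k p.1)) := by
  have hO := TubularSystem.diff_open (T := T) hS ν
  have hs : T.radius ν / 2 ∈ Ioo 0 (T.radius ν) :=
    ⟨half_pos (T.radius_pos ν), half_lt_self (T.radius_pos ν)⟩
  have ht : ∀ j, ContDiffOn ℝ ∞ (fun x => A j x * T.rhoPow j x) (T.U ν \ S) := fun j =>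
    (h.radial j).smooth.mul (TubularSystem.rhoPow_smooth j)
  have hterm : ∀ j, EqOn (T.term ν (fun p => A j (p.1 + (T.radius ν / 2) •
      ∑ k, p.2 k • T.frame ν k p.1)) j) (fun x => A j x * T.rhoPow j x) (T.U ν \ S) := by
    intro j x hx
    rw [TubularSystem.term, ← (TubularSystem.coords hx).2]
    exact congrArg (· * T.rhoPow j x) ((h.radial j).ray_eq x hx _ hs)
  refine ⟨fun j => ?_, fun j hj p hp => ?_, fun α N => ?_⟩
  · refine (h.radial j).smooth.comp ?_ fun p hp => ?_
    · refine contDiff_fst.contDiffOn.add (ContDiffOn.const_smul _ (ContDiffOn.sum fun k _ => ?_))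
      have h1 : ContDiff ℝ ∞ (fun p : Eu n × Eu d => p.2 k) :=
        (EuclideanSpace.proj k : Eu d →L[ℝ] ℝ).contDiff.comp contDiff_snd
      exact h1.contDiffOn.smul ((T.frame_smooth ν k).comp contDiff_fst.contDiffOn fun p hp => hp.1)
    · exact (TubularSystem.param (p := (p.1, p.2, T.radius ν / 2)) ⟨hp.1, hp.2, hs⟩).1
  · exact h.eq_zero j hj _ (TubularSystem.param (p := (p.1, p.2, T.radius ν / 2))
      ⟨hp.1, hp.2, hs⟩).1
  · obtain ⟨δ, hδ, h1⟩ := (h.rem N).2 (0 + mlen α)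
    obtain ⟨C, hC⟩ := (h1.mderiv α).bound
    refine ⟨C, δ, hδ, fun x hx hr => ?_⟩
    have h2 := hC x ⟨hx, hr⟩
    rw [mderiv_sub_sum hO α (Finset.Ico m N) (h.smooth hS) (fun j _ => ht j) hx] at h2
    rwa [Finset.sum_congr rfl fun j _ => mderiv_congr hO α (hterm j) hx]

/-- `coeff` is an arbitrary choice of coefficients; by uniqueness it agrees with those of any known
expansion. -/
theorem coeff_term (hS : IsClosed S) {φ : Eu n → ℂ} {m : ℤ} {A : ℤ → Eu n → ℂ}
    (h : HasExp T ν m φ A) (j : ℤ) {x : Eu n} (hx : x ∈ T.U ν \ S) :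
    T.term ν (coeff T ν φ j) j x = A j x * T.rhoPow j x := by
  have he : ∃ (m : ℤ) (a : ℤ → Eu n × Eu d → ℂ), T.StrongExp ν φ m a := ⟨m, _, h.strongExp hS⟩
  have h1 := StrongExp.hasExp hS (h.smooth hS) he.choose_spec.choose_spec
  have h2 := h1.unique hS h j hx
  rw [TubularSystem.term, coeff, dif_pos he, h2]
  rfl

variable {Ω : Opens (Eu n)} {m : ℤ} {K : Compacts (Eu n)} {φ : Eu n → ℂ}

theorem IsStep.expandable (hS : IsClosed S) (hK : (K : Set (Eu n)) ⊆ Ω) (h : IsStep T Ω m K φ)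
    (ν : ℕ) : Expandable T ν m φ := by
  obtain ⟨a, ha⟩ := h.expansion ν
  exact ⟨_, StrongExp.hasExp hS ((h.smooth_compl hS hK).mono fun x hx => hx.2) ha⟩

theorem IsStep.of_expandable (hS : IsClosed S) (h1 : ContDiffOn ℝ ∞ φ ((Ω : Set (Eu n)) \ S))
    (h2 : ∀ x ∉ (K : Set (Eu n)) \ S, φ x = 0) (h3 : ∀ ν, Expandable T ν m φ) :
    IsStep T Ω m K φ :=
  ⟨h1, h2, fun ν => ⟨_, (h3 ν).choose_spec.strongExp hS⟩⟩

theorem IsStep.mderiv_eq_zero (h : IsStep T Ω m K φ) (α : Fin n → ℕ) :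
    ∀ x ∉ (K : Set (Eu n)), mderiv α φ x = 0 := fun _ hx =>
  mderiv_eqOn_zero K.isCompact.isClosed.isOpen_compl α
    (fun y hy => h.eq_zero y fun hy' => hy hy'.1) hx

/-- U ν may reach outside Ω, so expansions need the derivative on all of Sᶜ. Off Ω nothing is lost,
as φ vanishes near every point outside K. -/
theorem IsStep.derivOff_eq (hK : (K : Set (Eu n)) ⊆ Ω) (h : IsStep T Ω m K φ) (α : Fin n → ℕ) :
    EqOn (derivOff S Ω α φ) (mderiv α φ) Sᶜ := by
  intro x hx
  by_cases hΩ : x ∈ (Ω : Set (Eu n))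
  · exact indicator_of_mem (show x ∈ (Ω : Set (Eu n)) \ S from ⟨hΩ, hx⟩) _
  · rw [h.mderiv_eq_zero α x fun hxK => hΩ (hK hxK)]
    exact indicator_of_notMem (fun h => hΩ h.1) _

theorem IsStep.derivOff (hS : IsClosed S) (hK : (K : Set (Eu n)) ⊆ Ω) (h : IsStep T Ω m K φ)
    (α : Fin n → ℕ) : IsStep T Ω (m - mlen α) K (derivOff S Ω α φ) := by
  refine IsStep.of_expandable hS ?_ (fun x hx => ?_) fun ν => ?_
  · exact (mderiv_smooth (Ω.isOpen.sdiff hS) α h.smooth).congr fun x hx => indicator_of_mem hx _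
  · by_cases hxS : x ∈ S
    · exact indicator_of_notMem (fun h => h.2 hxS) _
    · rw [h.derivOff_eq hK α hxS]
      exact h.mderiv_eq_zero α x fun hxK => hx ⟨hxK, hxS⟩
  · exact ((h.expandable hS hK ν).mderiv hS α).congr hS fun x hx => (h.derivOff_eq hK α hx.2).symm

theorem IsStep.mul (hS : IsClosed S) {m' : ℤ} {K' : Compacts (Eu n)} {g : Eu n → ℂ}
    (hK : (K : Set (Eu n)) ⊆ Ω) (hK' : (K' : Set (Eu n)) ⊆ Ω) (hg : IsStep T Ω m K g)
    (hφ : IsStep T Ω m' K' φ) : IsStep T Ω (m + m') K' (g * φ) :=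
  IsStep.of_expandable hS (hg.smooth.mul hφ.smooth) (fun x hx => by simp [hφ.eq_zero x hx])
    fun ν => (hg.expandable hS hK ν).mul hS (hφ.expandable hS hK' ν)

theorem IsStep.of_smooth (hS : IsClosed S) {F : Eu n → ℂ} (hF : ContDiff ℝ ∞ F)
    (hK : (K : Set (Eu n)) ⊆ Ω) (hs : ∀ x ∉ (K : Set (Eu n)), F x = 0) :
    IsStep T Ω 0 K (((Ω : Set (Eu n)) \ S).indicator F) := by
  refine IsStep.of_expandable hS (hF.contDiffOn.congr fun x hx => indicator_of_mem hx _)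
    (fun x hx => ?_) fun ν => ?_
  · by_cases h : x ∈ (Ω : Set (Eu n)) \ S
    · rw [indicator_of_mem h]
      exact hs x fun hxK => hx ⟨hxK, h.2⟩
    · exact indicator_of_notMem h _
  · refine (Expandable.of_smooth hS hF.contDiffOn).congr hS fun x hx => ?_
    by_cases h : x ∈ (Ω : Set (Eu n))
    · exact (indicator_of_mem (show x ∈ (Ω : Set (Eu n)) \ S from ⟨h, hx.2⟩) _).symm
    · rw [indicator_of_notMem fun h' => h h'.1]
      exact hs x fun hxK => h (hK hxK)

theorem exists_cutoff (hK : (K : Set (Eu n)) ⊆ Ω) :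
    ∃ χ : 𝓓(Ω, ℂ), ∃ V : Set (Eu n), IsOpen V ∧ (K : Set (Eu n)) ⊆ V ∧ ∀ x ∈ V, χ x = 1 := by
  obtain ⟨L, hL, hKL, hLΩ⟩ := exists_compact_between K.isCompact Ω.isOpen hK
  obtain ⟨L', hL', hLL', hLΩ'⟩ := exists_compact_between hL Ω.isOpen hLΩ
  obtain ⟨f, hf0, hf1, -⟩ := exists_contMDiffMap_zero_one_of_isClosed (n := ⊤) (modelWithCornersSelf ℝ (Eu n))
    isOpen_interior.isClosed_compl hL.isClosed
    (disjoint_compl_left_iff_subset.2 hLL')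
  have hs : tsupport (fun x => (f x : ℂ)) ⊆ L' := by
    refine closure_minimal (fun x hx => ?_) hL'.isClosed
    by_contra hxL
    refine hx ?_
    have : f x = 0 := hf0 fun h => hxL (interior_subset h)
    simp [this]
  refine ⟨⟨fun x => (f x : ℂ), ?_, HasCompactSupport.of_support_subset_isCompact hL'
    (subset_closure.trans hs), hs.trans hLΩ'⟩, interior L, isOpen_interior, hKL, fun x hx => ?_⟩
  · exact Complex.ofRealCLM.contDiff.comp f.contMDiff.contDiff
  · have : f x = 1 := hf1 (interior_subset hx)
    show ((f x : ℝ) : ℂ) = 1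
    rw [this]
    simp

theorem restrictOff_isStep (hS : IsClosed S) (χ : 𝓓(Ω, ℂ)) :
    IsStep T Ω 0 ⟨tsupport χ, χ.hasCompactSupport⟩ (restrictOff S Ω χ) :=
  IsStep.of_smooth hS χ.contDiff χ.tsupport_subset fun _ hx => image_eq_zero_of_notMem_tsupport hx

/-- Multiplying by a cutoff equal to 1 near K turns a multiplier into a test function with the same
values, hence the same derivatives, near K. -/
theorem exists_isStep_of_mem_multipliers {hS : IsClosed S} {ψ : Eu n → ℂ}
    (hψ : ψ ∈ multipliers hS T Ω) (hK : (K : Set (Eu n)) ⊆ Ω) :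
    ∃ (V : Set (Eu n)) (g : Eu n → ℂ) (p : ℤ) (L : Compacts (Eu n)), IsOpen V ∧
      (K : Set (Eu n)) ⊆ V ∧ EqOn g ψ V ∧ (L : Set (Eu n)) ⊆ Ω ∧ IsStep T Ω p L g := by
  obtain ⟨χ, V, hV, hKV, hχ⟩ := exists_cutoff hK
  obtain ⟨p, L, hL, hg⟩ := hψ.2.2 χ
  exact ⟨V, _, p, L, hV, hKV, fun x hx => by simp [hχ x hx], hL, hg⟩

theorem derivOff_mem_multipliers {hS : IsClosed S} {ψ : Eu n → ℂ} (hψ : ψ ∈ multipliers hS T Ω)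
    (α : Fin n → ℕ) : derivOff S Ω α ψ ∈ multipliers hS T Ω := by
  have hO := Ω.isOpen.sdiff hS
  refine ⟨(mderiv_smooth hO α hψ.1).congr fun x hx => indicator_of_mem hx _,
    fun x hx => indicator_of_notMem hx _, fun χ => ?_⟩
  obtain ⟨V, g, p, L, hV, hKV, hgψ, hL, hg⟩ :=
    exists_isStep_of_mem_multipliers hψ (K := ⟨tsupport χ, χ.hasCompactSupport⟩) χ.tsupport_subset
  refine ⟨0 + (p - mlen α), L, hL, ?_⟩
  have h1 := IsStep.mul hS χ.tsupport_subset hL (restrictOff_isStep hS χ) (hg.derivOff hS hL α)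
  convert h1 using 1
  ext x
  by_cases hx : x ∈ (Ω : Set (Eu n)) \ S
  · simp only [Pi.mul_apply, restrictOff, ThickDist.derivOff, indicator_of_mem hx]
    by_cases hxχ : x ∈ tsupport χ
    · rw [mderiv_congr hV α hgψ (hKV hxχ)]
    · rw [image_eq_zero_of_notMem_tsupport hxχ, zero_mul, zero_mul]
  · simp only [Pi.mul_apply, restrictOff, ThickDist.derivOff, indicator_of_notMem hx, mul_zero]

theorem mul_isStep {hS : IsClosed S} {ψ : Eu n → ℂ} (hψ : ψ ∈ multipliers hS T Ω)
    (hK : (K : Set (Eu n)) ⊆ Ω) : ∃ (g : Eu n → ℂ) (p : ℤ) (L : Compacts (Eu n)),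
      (L : Set (Eu n)) ⊆ Ω ∧ IsStep T Ω p L g ∧
        ∀ {m : ℤ} {φ : Eu n → ℂ}, IsStep T Ω m K φ → ψ * φ = g * φ := by
  obtain ⟨V, g, p, L, hV, hKV, hgψ, hL, hg⟩ := exists_isStep_of_mem_multipliers hψ hK
  refine ⟨g, p, L, hL, hg, fun hφ => funext fun x => ?_⟩
  by_cases hx : x ∈ (K : Set (Eu n))
  · rw [Pi.mul_apply, Pi.mul_apply, hgψ (hKV hx)]
  · rw [Pi.mul_apply, Pi.mul_apply, hφ.eq_zero x fun h => hx h.1, mul_zero, mul_zero]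

end Steps

/-! ### Estimates for the seminorms -/

section Estimates

variable {n d : ℕ} {S : Set (Eu n)}

/-- The remainder of the expansion of `F` after the terms with exponents in `[r, q)`. -/
def expRem (T : TubularSystem S d) (ν : ℕ) (r q : ℤ) (F : Eu n → ℂ) (x : Eu n) : ℂ :=
  F x - ∑ j ∈ Finset.Ico r q, T.term ν (coeff T ν F j) j x

variable {T : TubularSystem S d} {ν : ℕ}

theorem HasExp.expRem_eq (hS : IsClosed S) {m : ℤ} {F : Eu n → ℂ} {A : ℤ → Eu n → ℂ}
    (h : HasExp T ν m F A) (r q : ℤ) {x : Eu n} (hx : x ∈ T.U ν \ S) :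
    expRem T ν r q F x = F x - ∑ j ∈ Finset.Ico r q, A j x * T.rhoPow j x := by
  rw [expRem, Finset.sum_congr rfl fun j _ => coeff_term hS h j hx]

theorem expRem_congr (hS : IsClosed S) {m r q : ℤ} {F G : Eu n → ℂ} (h : EqOn F G (T.U ν \ S))
    (hF : Expandable T ν m F) : EqOn (expRem T ν r q F) (expRem T ν r q G) (T.U ν \ S) := by
  obtain ⟨A, hA⟩ := hF
  intro x hx
  rw [hA.expRem_eq hS r q hx, (hA.congr hS h).expRem_eq hS r q hx, h hx]

theorem expRem_comb (hS : IsClosed S) {m r q : ℤ} {F G : Eu n → ℂ} (a b : ℂ)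
    (hF : Expandable T ν m F) (hG : Expandable T ν m G) {x : Eu n} (hx : x ∈ T.U ν \ S) :
    expRem T ν r q (fun x => a * F x + b * G x) x =
      a * expRem T ν r q F x + b * expRem T ν r q G x := by
  obtain ⟨A, hA⟩ := hF
  obtain ⟨B, hB⟩ := hG
  rw [hA.expRem_eq hS r q hx, hB.expRem_eq hS r q hx, (hA.comb hS a b hB).expRem_eq hS r q hx]
  simp only [mul_sub, Finset.mul_sum, add_mul, Finset.sum_add_distrib, mul_assoc]
  ring

theorem expRem_sum (hS : IsClosed S) {m r q : ℤ} {ι : Type*} (s : Finset ι) {F : ι → Eu n → ℂ}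
    (hF : ∀ i ∈ s, Expandable T ν m (F i)) {x : Eu n} (hx : x ∈ T.U ν \ S) :
    expRem T ν r q (fun x => ∑ i ∈ s, F i x) x = ∑ i ∈ s, expRem T ν r q (F i) x := by
  classical
  induction s using Finset.induction_on with
  | empty =>
    have h0 : Expandable T ν m 0 := Expandable.zero hS m
    have := expRem_comb (r := r) (q := q) hS 0 0 h0 h0 hx
    simpa using this
  | insert a s ha ih =>
    have hs : ∀ i ∈ s, Expandable T ν m (F i) := fun i hi => hF i (by simp [hi])
    have := expRem_comb (r := r) (q := q) hS 1 1 (hF a (by simp)) (Expandable.sum hS s hs) hx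
    simp only [one_mul] at this
    simp only [Finset.sum_insert ha]
    rw [this, ih hs]

/-- Coefficients are bounded on the core, and every ray meets the core. -/
theorem HasExp.exists_coeff_bound (hS : IsClosed S) {m : ℤ} {F : Eu n → ℂ} {A : ℤ → Eu n → ℂ}
    (h : HasExp T ν m F A) (j : ℤ) : ∃ C : ℝ, ∀ x ∈ T.U ν \ S, ‖A j x‖ ≤ C := by
  obtain ⟨C, hC⟩ := ((h.radial j).ordOn_core hS (h.coeff_ord hS j) 0).bound
  have hc := TubularSystem.coreRadius_pos (T := T) (ν := ν) hS
  have hs : TubularSystem.coreRadius hS T ν / 2 ∈ Ioo 0 (T.radius ν) :=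
    ⟨half_pos hc, (half_lt_self hc).trans_le (TubularSystem.coreRadius_le hS)⟩
  refine ⟨C, fun x hx => ?_⟩
  obtain ⟨h1, -, -, h2, -⟩ := TubularSystem.ray_spec hx hs
  have := hC (T.ray (TubularSystem.coreRadius hS T ν / 2) x) ⟨h1, by rw [h2]; exact half_lt_self hc⟩
  rwa [zpow_zero, mul_one, (h.radial j).ray_eq x hx _ hs] at this

theorem exists_zpow_bound {δ R : ℝ} (hδ : 0 < δ) (j : ℤ) :
    ∃ C : ℝ, ∀ ρ ∈ Icc δ R, ρ ^ j ≤ C := by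
  obtain ⟨C, hC⟩ := isCompact_Icc.exists_bound_of_continuousOn (s := Icc δ R)
    (f := fun ρ : ℝ => ρ ^ j) (continuousOn_id.zpow₀ j fun ρ hρ => Or.inl (hδ.trans_le hρ.1).ne')
  exact ⟨C, fun ρ hρ => (le_abs_self _).trans (hC ρ hρ)⟩

theorem TubularSystem.rho_le_infDist {x : Eu n} (hx : x ∈ T.U ν \ S) :
    T.rho x ≤ infDist x S := by
  refine (le_infDist ((T.U_meets ν).mono inter_subset_left)).2 fun y hy => ?_
  rw [dist_eq_norm]
  by_cases h : y = T.proj x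
  · rw [h]; rfl
  · exact (T.proj_closest x (TubularSystem.sub_tube hx) y hy h).le

/-- For ρ < δ this is the expansion. For ρ ≥ δ every ingredient is bounded: F by compactness of L
away from S, the coefficients by `HasExp.exists_coeff_bound`, and powers of ρ because ρ stays in a
compact interval of positive numbers. -/
theorem Expandable.exists_expRem_bound (hS : IsClosed S) {m : ℤ} {F : Eu n → ℂ}
    (hF : Expandable T ν m F) (hc : ContinuousOn F Sᶜ) {L : Set (Eu n)} (hL : IsCompact L)
    (hFL : ∀ x ∉ L, F x = 0) (q : ℤ) :
    ∃ C : ℝ, ∀ x ∈ T.U ν \ S, ‖expRem T ν m q F x‖ ≤ C * T.rho x ^ q := by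
  obtain ⟨A, hA⟩ := hF
  obtain ⟨δ, hδ, h0⟩ := (hA.rem q).2 0
  obtain ⟨C₀, hC₀⟩ := h0.bound
  have hcl : IsClosed {x : Eu n | δ ≤ infDist x S} :=
    isClosed_le continuous_const (continuous_infDist_pt S)
  obtain ⟨C₁, hC₁⟩ := (hL.inter_right hcl).exists_bound_of_continuousOn (f := F)
    (hc.mono fun x hx hxS => by
      have h1 : δ ≤ infDist x S := hx.2
      rw [infDist_zero_of_mem hxS] at h1
      exact absurd hδ (not_lt.2 h1))
  choose a ha using fun j => hA.exists_coeff_bound hS j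
  choose b hb using fun j : ℤ => exists_zpow_bound (R := T.radius ν) hδ j
  -- The factor |b (-q)| turns a plain bound into a multiple of ρ^q, since 1 = ρ^(-q) ρ^q ≤ |b (-q)|
  -- ρ^q when ρ ≥ δ.
  refine ⟨max C₀ ((max C₁ 0 + ∑ j ∈ Finset.Ico m q, |a j| * |b j|) * |b (-q)|), fun x hx => ?_⟩
  have hρ := TubularSystem.rho_pos hx
  rw [hA.expRem_eq hS m q hx]
  rcases lt_or_ge (T.rho x) δ with h | h
  · exact (hC₀ x ⟨hx, h⟩).trans (mul_le_mul_of_nonneg_right (le_max_left _ _) (zpow_pos hρ q).le)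
  · have hmem : T.rho x ∈ Icc δ (T.radius ν) := ⟨h, (TubularSystem.rho_lt hx).le⟩
    have hb' : ∀ j, T.rho x ^ j ≤ |b j| := fun j => (hb j _ hmem).trans (le_abs_self _)
    have h1 : ‖F x‖ ≤ max C₁ 0 := by
      by_cases hxL : x ∈ L
      · exact (hC₁ x ⟨hxL, h.trans (TubularSystem.rho_le_infDist hx)⟩).trans (le_max_left _ _)
      · rw [hFL x hxL, norm_zero]
        exact le_max_right _ _
    have h2 : ‖∑ j ∈ Finset.Ico m q, A j x * T.rhoPow j x‖ ≤
        ∑ j ∈ Finset.Ico m q, |a j| * |b j| := by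
      refine norm_sum_le_of_le _ fun j _ => ?_
      rw [norm_mul, TubularSystem.rhoPow, norm_zpow, Complex.norm_real, Real.norm_of_nonneg hρ.le]
      exact mul_le_mul ((ha j x hx).trans (le_abs_self _)) (hb' j) (zpow_pos hρ j).le (abs_nonneg _)
    have h3 : 1 ≤ |b (-q)| * T.rho x ^ q := by
      have := mul_le_mul_of_nonneg_right (hb' (-q)) (zpow_pos hρ q).le
      rwa [← zpow_add₀ hρ.ne', neg_add_cancel, zpow_zero] at this
    have h4 := (norm_sub_le _ _).trans (add_le_add h1 h2)
    have h5 : 0 ≤ max C₁ 0 + ∑ j ∈ Finset.Ico m q, |a j| * |b j| := (norm_nonneg _).trans h4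
    refine h4.trans ((le_mul_of_one_le_right h5 h3).trans ?_)
    rw [← mul_assoc]
    exact mul_le_mul_of_nonneg_right (le_max_right _ _) (zpow_pos hρ q).le

/-- Apply the Cauchy identity. The terms of Φ occurring in it are differences of consecutive
remainders of Φ, so finitely many remainder bounds for Φ suffice, with a constant depending only on
G. -/
theorem Expandable.expRem_mul_bound (hS : IsClosed S) {p : ℤ} {G : Eu n → ℂ}
    (hG : Expandable T ν p G)
    (hb : ∀ q : ℤ, ∃ C : ℝ, ∀ x ∈ T.U ν \ S, ‖expRem T ν p q G x‖ ≤ C * T.rho x ^ q) (r q : ℤ) :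
    ∃ (s : Finset ℤ) (C : ℝ), 0 ≤ C ∧ ∀ Φ, Expandable T ν r Φ → ∀ M : ℝ, 0 ≤ M →
      ∀ x ∈ T.U ν \ S, (∀ j ∈ s, ‖expRem T ν r j Φ x‖ ≤ M * T.rho x ^ j) →
        ‖expRem T ν (p + r) q (fun x => G x * Φ x) x‖ ≤ C * M * T.rho x ^ q := by
  choose a ha using hb
  obtain ⟨B, hB⟩ := hG
  set R := T.radius ν
  -- The exponent q - p controls the remainder of Φ that multiplies G; j and j + 1 control the j-th
  -- term, with factor 1 + R because ρ^(j+1) ≤ R ρ^j.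
  refine ⟨insert (q - p) (Finset.Ico r (q - p) ∪ (Finset.Ico r (q - p)).image (· + 1)),
    |a p| + ∑ j ∈ Finset.Ico r (q - p), (1 + R) * |a (q - j)|, ?_, fun Φ hΦ M hM x hx hs => ?_⟩
  · have := (T.radius_pos ν).le
    positivity
  obtain ⟨A, hA⟩ := hΦ
  have hρ := TubularSystem.rho_pos hx
  have hz : ∀ j : ℤ, 0 < T.rho x ^ j := fun j => zpow_pos hρ j
  have ha' : ∀ j, ‖expRem T ν p j G x‖ ≤ |a j| * T.rho x ^ j := fun j =>
    (ha j x hx).trans (mul_le_mul_of_nonneg_right (le_abs_self _) (hz j).le)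
  have hid := cauchy_identity p r q (Complex.ofReal_ne_zero.2 hρ.ne') (G x) (Φ x)
    (fun j => B j x) (fun j => A j x)
  have e0 : expRem T ν (p + r) q (fun x => G x * Φ x) x = _ :=
    ((hB.mul hS hA).expRem_eq hS (p + r) q hx).trans hid
  have e1 : ∀ j, Φ x - ∑ i ∈ Finset.Ico r j, A i x * (T.rho x : ℂ) ^ i = expRem T ν r j Φ x :=
    fun j => (hA.expRem_eq hS r j hx).symm
  have e2 : ∀ j, G x - ∑ i ∈ Finset.Ico p j, B i x * (T.rho x : ℂ) ^ i = expRem T ν p j G x :=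
    fun j => (hB.expRem_eq hS p j hx).symm
  -- With an empty sum subtracted, the remainder bound at p bounds G itself.
  have e3 : G x = expRem T ν p p G x := by simp [expRem]
  have hterm : ∀ j ∈ Finset.Ico r (q - p), ‖A j x * (T.rho x : ℂ) ^ j‖ ≤
      (1 + R) * M * T.rho x ^ j := by
    intro j hj
    have e4 : A j x * (T.rho x : ℂ) ^ j = expRem T ν r j Φ x - expRem T ν r (j + 1) Φ x := by
      rw [← e1, ← e1, sum_Ico_int_succ (Finset.mem_Ico.1 hj).1]
      ring
    rw [e4]
    refine (norm_sub_le _ _).trans ((add_le_add (hs j ?_) (hs (j + 1) ?_)).trans ?_)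
    · exact Finset.mem_insert_of_mem (Finset.mem_union_left _ hj)
    · exact Finset.mem_insert_of_mem (Finset.mem_union_right _ (Finset.mem_image_of_mem _ hj))
    · rw [zpow_add_one₀ hρ.ne']
      have : T.rho x ≤ R := (TubularSystem.rho_lt hx).le
      nlinarith [mul_le_mul_of_nonneg_left this (mul_nonneg hM (hz j).le)]
  rw [e0, e1, Finset.sum_congr rfl fun j _ => by rw [e2], add_mul, add_mul, Finset.sum_mul,
    Finset.sum_mul]
  refine (norm_add_le _ _).trans (add_le_add ?_ (norm_sum_le_of_le _ fun j hj => ?_))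
  · rw [norm_mul]
    have h1 := mul_le_mul (e3 ▸ ha' p) (hs (q - p) (Finset.mem_insert_self _ _)) (norm_nonneg _)
      (mul_nonneg (abs_nonneg _) (hz p).le)
    refine h1.trans (le_of_eq ?_)
    have h2 : T.rho x ^ q = T.rho x ^ p * T.rho x ^ (q - p) := by
      rw [← zpow_add₀ hρ.ne', add_sub_cancel]
    rw [h2]
    ring
  · rw [norm_mul]
    have h1 := mul_le_mul (hterm j hj) (ha' (q - j)) (norm_nonneg _)
      ((norm_nonneg _).trans (hterm j hj))
    refine h1.trans (le_of_eq ?_)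
    have h2 : T.rho x ^ q = T.rho x ^ j * T.rho x ^ (q - j) := by
      rw [← zpow_add₀ hρ.ne', add_sub_cancel]
    rw [h2]
    ring

end Estimates

/-! ### Continuity between step spaces -/

section StepBounds

variable {n d : ℕ} {S : Set (Eu n)} {T : TubularSystem S d} {Ω : Opens (Eu n)} {m : ℤ}
  {K : Compacts (Eu n)} {q : ℤ} {k ν : ℕ}

/-- The estimates expressed by a bound on the seminorm `stepNorm T m K q k ν φ`. -/
structure StepBound (T : TubularSystem S d) (m : ℤ) (K : Compacts (Eu n)) (q : ℤ) (k ν : ℕ)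
    (M : ℝ) (φ : Eu n → ℂ) : Prop where
  near : ∀ α : Fin n → ℕ, mlen α ≤ k → ∀ x ∈ ((K : Set (Eu n)) ∩ T.U ν) \ S,
    ‖expRem T ν (m - mlen α) q (mderiv α φ) x‖ ≤ M * T.rho x ^ q
  away : ∀ α : Fin n → ℕ, mlen α ≤ k → ∀ x ∈ (K : Set (Eu n)) \ ⋃ μ, T.U μ, ‖mderiv α φ x‖ ≤ M

theorem StepBound.stepNorm_le {M : ℝ} {φ : Eu n → ℂ} (h : StepBound T m K q k ν M φ) :
    stepNorm T m K q k ν φ ≤ ENNReal.ofReal M + ENNReal.ofReal M := by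
  refine add_le_add (iSup₂_le fun α hα => iSup₂_le fun x hx => ENNReal.ofReal_le_ofReal ?_)
    (iSup₂_le fun α hα => iSup₂_le fun x hx => ENNReal.ofReal_le_ofReal (h.away α hα x hx))
  have hρ := TubularSystem.rho_pos (T := T) (ν := ν) ⟨hx.1.2, hx.2⟩
  have h1 := mul_le_mul_of_nonneg_left (h.near α hα x hx) (zpow_pos hρ (-q)).le
  rwa [mul_left_comm, ← zpow_add₀ hρ.ne', neg_add_cancel, zpow_zero, mul_one] at h1

theorem StepBound.of_stepNorm_le {M : ℝ} (hM : 0 ≤ M) {φ : Eu n → ℂ}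
    (h : stepNorm T m K q k ν φ ≤ ENNReal.ofReal M) : StepBound T m K q k ν M φ := by
  have h1 := le_self_add.trans h
  have h2 := le_add_self.trans h
  simp only [iSup_le_iff] at h1 h2
  refine ⟨fun α hα x hx => ?_, fun α hα x hx => (ENNReal.ofReal_le_ofReal_iff hM).1 (h2 α hα x hx)⟩
  have hρ := TubularSystem.rho_pos (T := T) (ν := ν) ⟨hx.1.2, hx.2⟩
  have h3 := (ENNReal.ofReal_le_ofReal_iff hM).1 (h1 α hα x hx)
  have h4 := mul_le_mul_of_nonneg_right h3 (zpow_pos hρ q).le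
  rwa [mul_right_comm, ← zpow_add₀ hρ.ne', neg_add_cancel, zpow_zero, one_mul] at h4

theorem IsStep.expandable_mderiv (hS : IsClosed S) (hK : (K : Set (Eu n)) ⊆ Ω) {φ : Eu n → ℂ}
    (h : IsStep T Ω m K φ) (ν : ℕ) (α : Fin n → ℕ) :
    Expandable T ν (m - mlen α) (mderiv α φ) :=
  (h.expandable hS hK ν).mderiv hS α

theorem stepNorm_add_le (hS : IsClosed S) (hK : (K : Set (Eu n)) ⊆ Ω) {φ ψ : Eu n → ℂ}
    (hφ : IsStep T Ω m K φ) (hψ : IsStep T Ω m K ψ) :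
    stepNorm T m K q k ν (φ + ψ) ≤ stepNorm T m K q k ν φ + stepNorm T m K q k ν ψ := by
  have hd : ∀ α, EqOn (mderiv α (φ + ψ)) (fun x => 1 * mderiv α φ x + 1 * mderiv α ψ x) Sᶜ :=
    fun α => mderiv_comb hS.isOpen_compl α 1 1 (hφ.smooth_compl hS hK) (hψ.smooth_compl hS hK)
      fun x _ => by simp
  have hSU : ∀ x ∉ ⋃ μ, T.U μ, x ∈ Sᶜ := fun x hx hxS => hx (T.U_cover hxS)
  rw [stepNorm, stepNorm, stepNorm, add_add_add_comm]
  refine add_le_add (iSup₂_le fun α hα => iSup₂_le fun x hx => ?_)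
    (iSup₂_le fun α hα => iSup₂_le fun x hx => ?_)
  · have hxU : x ∈ T.U ν \ S := ⟨hx.1.2, hx.2⟩
    have h1 := hφ.expandable_mderiv hS hK ν α
    have h2 := hψ.expandable_mderiv hS hK ν α
    have h3 : expRem T ν (m - mlen α) q (mderiv α (φ + ψ)) x =
        expRem T ν (m - mlen α) q (mderiv α φ) x + expRem T ν (m - mlen α) q (mderiv α ψ) x := by
      rw [← expRem_congr hS (fun y hy => (hd α hy.2).symm) (h1.comb hS 1 1 h2) hxU,
        expRem_comb hS 1 1 h1 h2 hxU, one_mul, one_mul]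
    refine le_trans ?_ (add_le_add
      (le_iSup₂_of_le α hα (le_iSup₂_of_le x hx le_rfl))
      (le_iSup₂_of_le α hα (le_iSup₂_of_le x hx le_rfl)))
    have hz := (zpow_pos (TubularSystem.rho_pos hxU) (-q)).le
    rw [← ENNReal.ofReal_add (by positivity) (by positivity), ← mul_add]
    refine ENNReal.ofReal_le_ofReal (mul_le_mul_of_nonneg_left ?_ hz)
    exact (congrArg norm h3).trans_le (norm_add_le _ _)
  · refine le_trans ?_ (add_le_add
      (le_iSup₂_of_le α hα (le_iSup₂_of_le x hx le_rfl))
      (le_iSup₂_of_le α hα (le_iSup₂_of_le x hx le_rfl)))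
    rw [← ENNReal.ofReal_add (norm_nonneg _) (norm_nonneg _), hd α (hSU x hx.2)]
    simp only [one_mul]
    exact ENNReal.ofReal_le_ofReal (norm_add_le _ _)

theorem IsStep.sub (hS : IsClosed S) (hK : (K : Set (Eu n)) ⊆ Ω) {φ ψ : Eu n → ℂ}
    (hφ : IsStep T Ω m K φ) (hψ : IsStep T Ω m K ψ) : IsStep T Ω m K (φ - ψ) := by
  have h := hφ.comb hS hK hψ 1 (-1)
  simp only [one_mul, neg_mul, ← sub_eq_add_neg] at h
  exact h

theorem stepNorm_zero (hS : IsClosed S) : stepNorm T m K q k ν 0 = 0 := by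
  have h0 : ∀ α : Fin n → ℕ, mderiv α (0 : Eu n → ℂ) = 0 := fun α => funext fun x =>
    mderiv_eqOn_zero isOpen_univ α (fun _ _ => rfl) (mem_univ x)
  have h : StepBound T m K q k ν 0 (0 : Eu n → ℂ) := by
    refine ⟨fun α _ x hx => ?_, fun α _ x _ => by simp [h0]⟩
    have h1 : Expandable T ν 0 0 := Expandable.zero hS 0
    have h2 := expRem_comb (r := m - mlen α) (q := q) hS 0 0 h1 h1 (x := x) ⟨hx.1.2, hx.2⟩
    simp only [zero_mul, add_zero] at h2
    have h3 : expRem T ν (m - mlen α) q (0 : Eu n → ℂ) x = 0 := h2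
    rw [h0, h3, norm_zero, zero_mul]
  simpa using h.stepNorm_le

/-- The topology is generated by balls with arbitrary centres. The triangle inequality
`stepNorm_add_le` reduces the preimage of such a ball to smallness of F x - F x₀. -/
theorem continuous_step (hS : IsClosed S) (hK : (K : Set (Eu n)) ⊆ Ω) {X : Type*}
    [TopologicalSpace X] (F : X → Step T Ω m K)
    (h : ∀ (q : ℤ) (k ν : ℕ) (x₀ : X) (ε : ℝ), 0 < ε →
      ∀ᶠ x in 𝓝 x₀, StepBound T m K q k ν ε ((F x).1 - (F x₀).1)) : Continuous F := by
  refine continuous_generateFrom_iff.2 ?_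
  rintro _ ⟨φ, q, k, ν, r, -, rfl⟩
  refine isOpen_iff_mem_nhds.2 fun x₀ hx₀ => ?_
  have hx₀' : stepNorm T m K q k ν ((F x₀).1 - φ.1) < r := hx₀
  obtain ⟨ε, hε, hlt⟩ := ENNReal.lt_iff_exists_add_pos_lt.1 hx₀'
  -- `stepNorm` is a sum of two suprema, each of which is at most ε / 2.
  have hε2 : (0 : ℝ) < ε / 2 := half_pos (NNReal.coe_pos.2 hε)
  filter_upwards [h q k ν x₀ (ε / 2) hε2] with x hx
  have h1 := hx.stepNorm_le
  rw [← ENNReal.ofReal_add hε2.le hε2.le, add_halves, ENNReal.ofReal_coe_nnreal] at h1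
  have h2 : (F x).1 - φ.1 = ((F x₀).1 - φ.1) + ((F x).1 - (F x₀).1) := by abel
  show stepNorm T m K q k ν ((F x).1 - φ.1) < r
  rw [h2]
  exact ((stepNorm_add_le hS hK ((F x₀).2.sub hS hK φ.2) ((F x).2.sub hS hK (F x₀).2)).trans
    (by gcongr)).trans_lt hlt

theorem eventually_stepBound (hS : IsClosed S) (φ₀ : Step T Ω m K) (q : ℤ) (k ν : ℕ) {ε : ℝ}
    (hε : 0 < ε) : ∀ᶠ φ in 𝓝 φ₀, StepBound T m K q k ν ε (φ.1 - φ₀.1) := by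
  have ho : IsOpen {ψ : Step T Ω m K | stepNorm T m K q k ν (ψ.1 - φ₀.1) < ENNReal.ofReal ε} :=
    isOpen_generateFrom_of_mem ⟨φ₀, q, k, ν, _, ENNReal.ofReal_pos.2 hε, rfl⟩
  have hm : φ₀ ∈ {ψ : Step T Ω m K | stepNorm T m K q k ν (ψ.1 - φ₀.1) < ENNReal.ofReal ε} := by
    simpa [stepNorm_zero hS] using hε
  filter_upwards [ho.mem_nhds hm] with φ hφ
  exact StepBound.of_stepNorm_le hε.le hφ.le

variable (T Ω) in
/-- `A` maps `𝒟_*^{[m;K]}` to `𝒟_*^{[m';K]}`, bounding each seminorm by finitely many others. -/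
structure StepMap (m m' : ℤ) (K : Compacts (Eu n)) (A : (Eu n → ℂ) → Eu n → ℂ) : Prop where
  isStep : ∀ φ, IsStep T Ω m K φ → IsStep T Ω m' K (A φ)
  map_sub : ∀ φ ψ, IsStep T Ω m K φ → IsStep T Ω m K ψ → A (φ - ψ) = A φ - A ψ
  bound : ∀ (q : ℤ) (k ν : ℕ), ∃ (s : Finset ℤ) (k' : ℕ) (C : ℝ), ∀ φ, IsStep T Ω m K φ →
    ∀ M : ℝ, 0 ≤ M → (∀ j ∈ s, StepBound T m K j k' ν M φ) → StepBound T m' K q k ν (C * M) (A φ)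

theorem StepBound.mono {M M' : ℝ} (hM : M ≤ M') {φ : Eu n → ℂ} (h : StepBound T m K q k ν M φ) :
    StepBound T m K q k ν M' φ :=
  ⟨fun α hα x hx => (h.near α hα x hx).trans (mul_le_mul_of_nonneg_right hM
    (zpow_pos (TubularSystem.rho_pos (T := T) (ν := ν) ⟨hx.1.2, hx.2⟩) q).le),
    fun α hα x hx => (h.away α hα x hx).trans hM⟩

/-- The map between step spaces given by a `StepMap`. -/
def StepMap.restrict {m' : ℤ} {A : (Eu n → ℂ) → Eu n → ℂ} (hA : StepMap T Ω m m' K A)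
    (φ : Step T Ω m K) : Step T Ω m' K := ⟨A φ.1, hA.isStep φ.1 φ.2⟩

theorem StepMap.continuous (hS : IsClosed S) (hK : (K : Set (Eu n)) ⊆ Ω) {m' : ℤ}
    {A : (Eu n → ℂ) → Eu n → ℂ} (hA : StepMap T Ω m m' K A) : Continuous hA.restrict := by
  refine continuous_step hS hK _ fun q k ν φ₀ ε hε => ?_
  obtain ⟨s, k', C, hC⟩ := hA.bound q k ν
  have hp : 0 < |C| + 1 := by positivity
  have hev := (Filter.eventually_all_finset s).2 fun j _ =>
    eventually_stepBound hS φ₀ j k' ν (div_pos hε hp)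
  filter_upwards [hev] with φ hφ
  have h1 := hC _ (φ.2.sub hS hK φ₀.2) _ (div_pos hε hp).le hφ
  rw [hA.map_sub _ _ φ.2 φ₀.2] at h1
  refine h1.mono ?_
  rw [mul_div_assoc', div_le_iff₀ hp]
  nlinarith [le_abs_self C]

end StepBounds

/-! ### Examples of maps between step spaces -/

section StepMaps

variable {n d : ℕ} {S : Set (Eu n)} {T : TubularSystem S d} {Ω : Opens (Eu n)} {m : ℤ}
  {K : Compacts (Eu n)} {q : ℤ} {k ν : ℕ}

/-- The derivatives ∂^β of ∂^α φ are derivatives of φ of order at most k + |α|, and the lower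
summation limits m - |α| - |β| match. The bound therefore holds with constant 1. -/
theorem stepMap_derivOff (hS : IsClosed S) (hK : (K : Set (Eu n)) ⊆ Ω) (m : ℤ) (α : Fin n → ℕ) :
    StepMap T Ω m (m - mlen α) K (derivOff S Ω α) := by
  refine ⟨fun φ hφ => hφ.derivOff hS hK α, fun φ ψ hφ hψ => ?_, fun q k ν =>
    ⟨{q}, k + mlen α, 1, fun φ hφ M _ h => ?_⟩⟩
  · ext x
    by_cases hx : x ∈ (Ω : Set (Eu n)) \ S
    · have := mderiv_comb (Ω.isOpen.sdiff hS) α 1 (-1) hφ.smooth hψ.smooth (h := φ - ψ)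
        (fun y _ => by simp [sub_eq_add_neg]) hx
      simp only [derivOff, Pi.sub_apply, indicator_of_mem hx, this]
      ring
    · simp only [derivOff, Pi.sub_apply, indicator_of_notMem hx, sub_zero]
  · have h1 := h q (Finset.mem_singleton_self q)
    have heq : ∀ β, EqOn (mderiv (β + α) φ) (mderiv β (derivOff S Ω α φ)) Sᶜ := fun β x hx => by
      rw [mderiv_congr hS.isOpen_compl β (hφ.derivOff_eq hK α) hx,
        mderiv_add hS.isOpen_compl β α (hφ.smooth_compl hS hK) hx]
    have hlen : ∀ β : Fin n → ℕ, mlen β ≤ k → mlen (β + α) ≤ k + mlen α := fun β hβ => by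
      rw [mlen_add]; omega
    rw [one_mul]
    refine ⟨fun β hβ x hx => ?_, fun β hβ x hx => ?_⟩
    · rw [← expRem_congr hS ((heq β).mono fun y hy => hy.2) (hφ.expandable_mderiv hS hK ν (β + α))
        (show x ∈ T.U ν \ S from ⟨hx.1.2, hx.2⟩)]
      have h2 := h1.near (β + α) (hlen β hβ) x hx
      rwa [mlen_add, Nat.cast_add, add_comm (mlen β : ℤ), ← sub_sub] at h2
    · rw [← heq β fun hxS => hx.2 (T.U_cover hxS)]
      exact h1.away (β + α) (hlen β hβ) x hx

/-- For estimates the binomial coefficients are irrelevant. The product rule is applied one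
derivative at a time, which doubles the index type and lets it depend on α alone. -/
theorem exists_mderiv_mul (N : ℕ) : ∀ α : Fin n → ℕ, mlen α = N →
    ∃ (ι : Type) (_ : Fintype ι) (b c : ι → Fin n → ℕ), (∀ i, mlen (b i) + mlen (c i) = mlen α) ∧
      ∀ {O : Set (Eu n)}, IsOpen O → ∀ {f g : Eu n → ℂ}, ContDiffOn ℝ ∞ f O → ContDiffOn ℝ ∞ g O →
        EqOn (mderiv α (f * g)) (fun x => ∑ i, mderiv (b i) f x * mderiv (c i) g x) O := by
  induction N with
  | zero =>
    intro α hα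
    have h0 : α = 0 := funext fun i => Nat.le_zero.1
      ((Finset.single_le_sum (f := α) (fun _ _ => Nat.zero_le _) (Finset.mem_univ i)).trans hα.le)
    subst h0
    refine ⟨Unit, inferInstance, fun _ => 0, fun _ => 0, fun _ => by simp [mlen], ?_⟩
    intro O hO f g hf hg x hx
    simp [mderiv_zero]
  | succ N ih =>
    intro α hα
    obtain ⟨i, hi⟩ : ∃ i, α i ≠ 0 := by
      by_contra! h
      simp [mlen, h] at hα
    obtain ⟨α', rfl⟩ : ∃ α' : Fin n → ℕ, α = Pi.single i 1 + α' := by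
      refine ⟨α - Pi.single i 1, (add_tsub_cancel_of_le fun j => ?_).symm⟩
      by_cases hj : j = i
      · subst hj; simpa using Nat.one_le_iff_ne_zero.2 hi
      · simp [Pi.single_eq_of_ne hj]
    rw [mlen_add, mlen_single] at hα
    obtain ⟨ι, _, b, c, hbc, H⟩ := ih α' (by omega)
    refine ⟨ι ⊕ ι, inferInstance, Sum.elim (fun j => Pi.single i 1 + b j) b,
      Sum.elim c fun j => Pi.single i 1 + c j, ?_, ?_⟩
    · rintro (j | j)
      · simp only [Sum.elim_inl, mlen_add, mlen_single, ← hbc j]; omega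
      · simp only [Sum.elim_inr, mlen_add, mlen_single, ← hbc j]; omega
    · intro O hO f g hf hg x hx
      have hsm := fun j => mderiv_smooth hO (b j) hf
      have hsm' := fun j => mderiv_smooth hO (c j) hg
      have h1 : ∀ (β : Fin n → ℕ) {u : Eu n → ℂ}, ContDiffOn ℝ ∞ u O →
          pderiv i (mderiv β u) x = mderiv (Pi.single i 1 + β) u x := fun β u hu => by
        rw [← mderiv_add hO _ β hu hx, mderiv_single hO i (mderiv_smooth hO β hu) hx]
      rw [← h1 α' (u := f * g) (hf.mul hg), pderiv_congr hO i (H hO hf hg) hx,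
        pderiv_fun_sum hO i Finset.univ (fun j _ => (hsm j).mul (hsm' j)) hx]
      simp only [Fintype.sum_sum_type, Sum.elim_inl, Sum.elim_inr, ← Finset.sum_add_distrib]
      refine Finset.sum_congr rfl fun j _ => ?_
      have h2 := pderiv_mul hO i (hsm j) (hsm' j) hx
      rw [← h1 _ hf, ← h1 _ hg]
      exact h2

theorem StepBound.mono_order {k' : ℕ} (hk : k ≤ k') {M : ℝ} {φ : Eu n → ℂ}
    (h : StepBound T m K q k' ν M φ) : StepBound T m K q k ν M φ :=
  ⟨fun α hα => h.near α (hα.trans hk), fun α hα => h.away α (hα.trans hk)⟩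

theorem IsStep.mul_bound (hS : IsClosed S) (hK : (K : Set (Eu n)) ⊆ Ω) {p : ℤ}
    {L : Compacts (Eu n)} (hL : (L : Set (Eu n)) ⊆ Ω) {g : Eu n → ℂ} (hg : IsStep T Ω p L g)
    (m q : ℤ) (ν : ℕ) (α : Fin n → ℕ) : ∃ (s : Finset ℤ) (C : ℝ), 0 ≤ C ∧ ∀ φ,
      IsStep T Ω m K φ → ∀ M : ℝ, 0 ≤ M → (∀ j ∈ s, StepBound T m K j (mlen α) ν M φ) →
        (∀ x ∈ ((K : Set (Eu n)) ∩ T.U ν) \ S,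
          ‖expRem T ν (p + m - mlen α) q (mderiv α (g * φ)) x‖ ≤ C * M * T.rho x ^ q) ∧
        ∀ x ∈ (K : Set (Eu n)) \ ⋃ μ, T.U μ, ‖mderiv α (g * φ) x‖ ≤ C * M := by
  classical
  obtain ⟨ι, _, b, c, hbc, H⟩ := exists_mderiv_mul _ α rfl
  have hgs := hg.smooth_compl hS hL
  have hgc : ∀ i, ContinuousOn (mderiv (b i) g) Sᶜ := fun i =>
    (mderiv_smooth hS.isOpen_compl (b i) hgs).continuousOn
  choose s C hC hs using fun i => (hg.expandable_mderiv hS hL ν (b i)).expRem_mul_bound hS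
    (fun j => (hg.expandable_mderiv hS hL ν (b i)).exists_expRem_bound hS (hgc i) L.isCompact
      (hg.mderiv_eq_zero (b i)) j) (m - mlen (c i)) q
  have hKU : IsCompact ((K : Set (Eu n)) \ ⋃ μ, T.U μ) :=
    K.isCompact.diff (isOpen_iUnion T.U_open)
  have hSU : (K : Set (Eu n)) \ ⋃ μ, T.U μ ⊆ Sᶜ := fun x hx hxS => hx.2 (T.U_cover hxS)
  choose a ha using fun i => hKU.exists_bound_of_continuousOn ((hgc i).mono hSU)
  have hle : ∀ i, mlen (c i) ≤ mlen α := fun i => by rw [← hbc i]; omega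
  have hlen : ∀ i, p - mlen (b i) + (m - mlen (c i)) = p + m - mlen α := fun i => by
    rw [← hbc i]; push_cast; ring
  -- The estimate away from the U μ is part of every `StepBound`, whatever its exponent; inserting 0
  -- guarantees that one is available.
  refine ⟨insert 0 (Finset.univ.biUnion s), ∑ i, (C i + |a i|),
    Finset.sum_nonneg fun i _ => add_nonneg (hC i) (abs_nonneg _), fun φ hφ M hM hb => ?_⟩
  have hφs := hφ.smooth_compl hS hK
  have hE := H hS.isOpen_compl hgs hφs
  refine ⟨fun x hx => ?_, fun x hx => ?_⟩
  · have hxU : x ∈ T.U ν \ S := ⟨hx.1.2, hx.2⟩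
    have hex : ∀ i ∈ Finset.univ, Expandable T ν (p + m - mlen α)
        (fun x => mderiv (b i) g x * mderiv (c i) φ x) := fun i _ => hlen i ▸
      (hg.expandable_mderiv hS hL ν (b i)).mul hS (hφ.expandable_mderiv hS hK ν (c i))
    rw [← expRem_congr hS (fun y hy => (hE hy.2).symm) (Expandable.sum hS _ hex) hxU,
      expRem_sum hS _ hex hxU, Finset.sum_mul, Finset.sum_mul]
    refine norm_sum_le_of_le _ fun i _ => ?_
    have h1 := hs i _ (hφ.expandable_mderiv hS hK ν (c i)) M hM x hxU fun j hj =>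
      (hb j (Finset.mem_insert_of_mem
        (Finset.mem_biUnion.2 ⟨i, Finset.mem_univ i, hj⟩))).near (c i) (hle i) x hx
    rw [hlen i] at h1
    refine h1.trans (mul_le_mul_of_nonneg_right (mul_le_mul_of_nonneg_right ?_ hM)
      (zpow_pos (TubularSystem.rho_pos hxU) q).le)
    exact le_add_of_nonneg_right (abs_nonneg _)
  · rw [hE (hSU hx), Finset.sum_mul]
    refine norm_sum_le_of_le _ fun i _ => ?_
    rw [norm_mul]
    refine (mul_le_mul ((ha i x hx).trans (le_abs_self _))
      ((hb 0 (Finset.mem_insert_self _ _)).away (c i) (hle i) x hx) (norm_nonneg _)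
      (abs_nonneg _)).trans (mul_le_mul_of_nonneg_right ?_ hM)
    exact le_add_of_nonneg_left (hC i)

theorem stepMap_mul (hS : IsClosed S) (hK : (K : Set (Eu n)) ⊆ Ω) {p : ℤ}
    {L : Compacts (Eu n)} (hL : (L : Set (Eu n)) ⊆ Ω) {g : Eu n → ℂ} (hg : IsStep T Ω p L g)
    (m : ℤ) : StepMap T Ω m (p + m) K (g * ·) := by
  classical
  refine ⟨fun φ hφ => hg.mul hS hL hK hφ, fun φ ψ _ _ => mul_sub g φ ψ, fun q k ν => ?_⟩
  choose s C hC hs using hg.mul_bound hS hK hL m q ν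
  set I := Finset.Iic fun _ : Fin n => k
  refine ⟨I.biUnion s, k, ∑ α ∈ I, C α, fun φ hφ M hM hb => ?_⟩
  have key := fun (α : Fin n → ℕ) (hα : mlen α ≤ k) => hs α φ hφ M hM fun j hj =>
    (hb j (Finset.mem_biUnion.2 ⟨α, mem_Iic_of_mlen_le hα, hj⟩)).mono_order hα
  have hle : ∀ α : Fin n → ℕ, mlen α ≤ k → C α * M ≤ (∑ α ∈ I, C α) * M := fun α hα =>
    mul_le_mul_of_nonneg_right (Finset.single_le_sum (fun α _ => hC α) (mem_Iic_of_mlen_le hα)) hM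
  refine ⟨fun α hα x hx => ((key α hα).1 x hx).trans ?_, fun α hα x hx =>
    ((key α hα).2 x hx).trans (hle α hα)⟩
  exact mul_le_mul_of_nonneg_right (hle α hα)
    (zpow_pos (TubularSystem.rho_pos (T := T) (ν := ν) ⟨hx.1.2, hx.2⟩) q).le

/-! #### Restriction of classical test functions -/

theorem norm_iteratedFDeriv_pderiv_le {g : Eu n → ℂ} (hg : ContDiff ℝ ∞ g) (i : Fin n) (N : ℕ)
    (x : Eu n) : ‖iteratedFDeriv ℝ N (pderiv i g) x‖ ≤ ‖iteratedFDeriv ℝ (N + 1) g x‖ := by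
  have h1 : ContDiff ℝ ∞ (fderiv ℝ g) := hg.fderiv_right (by simp)
  have h2 := norm_iteratedFDeriv_clm_apply_const (c := EuclideanSpace.single i (1 : ℝ)) (n := N)
    (h1.contDiffAt (x := x)) (by exact_mod_cast le_top)
  rw [norm_iteratedFDeriv_fderiv] at h2
  have h3 : ‖iteratedFDeriv ℝ N (pderiv i g) x‖ ≤ _ := h2
  simpa using h3

theorem pderiv_smooth_univ {g : Eu n → ℂ} (hg : ContDiff ℝ ∞ g) (i : Fin n) :
    ContDiff ℝ ∞ (pderiv i g) :=
  contDiffOn_univ.1 (pderiv_smooth isOpen_univ i hg.contDiffOn)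

theorem norm_iteratedFDeriv_mderiv_le {g : Eu n → ℂ} (hg : ContDiff ℝ ∞ g) (α : Fin n → ℕ) (N : ℕ)
    (x : Eu n) : ‖iteratedFDeriv ℝ N (mderiv α g) x‖ ≤ ‖iteratedFDeriv ℝ (N + mlen α) g x‖ := by
  have hit : ∀ (i : Fin n) (k N : ℕ) {u : Eu n → ℂ}, ContDiff ℝ ∞ u →
      ContDiff ℝ ∞ ((pderiv i)^[k] u) ∧ ‖iteratedFDeriv ℝ N ((pderiv i)^[k] u) x‖ ≤
        ‖iteratedFDeriv ℝ (N + k) u x‖ := by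
    intro i k
    induction k with
    | zero => exact fun N u hu => ⟨hu, le_rfl⟩
    | succ k ih =>
      intro N u hu
      obtain ⟨h1, h2⟩ := ih N (pderiv_smooth_univ hu i)
      exact ⟨h1, h2.trans (norm_iteratedFDeriv_pderiv_le hu i (N + k) x)⟩
  have key : ∀ (l : List (Fin n)) (N : ℕ),
      ContDiff ℝ ∞ (l.foldr (fun i g => (pderiv i)^[α i] g) g) ∧
      ‖iteratedFDeriv ℝ N (l.foldr (fun i g => (pderiv i)^[α i] g) g) x‖ ≤
        ‖iteratedFDeriv ℝ (N + (l.map α).sum) g x‖ := by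
    intro l
    induction l with
    | nil => exact fun N => ⟨hg, le_rfl⟩
    | cons i l ih =>
      intro N
      obtain ⟨h1, h2⟩ := hit i (α i) N (ih N).1
      refine ⟨h1, h2.trans ?_⟩
      rw [List.map_cons, List.sum_cons, ← add_assoc]
      exact (ih (N + α i)).2
  have h := (key (List.finRange n) N).2
  rwa [← List.ofFn_eq_map, List.sum_ofFn] at h

theorem DerivBound.of_iteratedFDeriv {M : ℝ} (N : ℕ) : ∀ {F : Eu n → ℂ}, ContDiff ℝ ∞ F →
    (∀ x, ‖iteratedFDeriv ℝ N F x‖ ≤ M) → DerivBound univ M N F := by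
  induction N with
  | zero => exact fun {F} _ h y _ => by simpa using h y
  | succ N ih => exact fun {F} hF h i => ih (pderiv_smooth_univ hF i) fun x =>
      (norm_iteratedFDeriv_pderiv_le hF i N x).trans (h x)

/-- For q ≥ 0 this is Taylor's formula of order q. For q < 0 nothing is subtracted and the bound on
F suffices, because ρ is below the radius and so 1 ≤ radius^(-q) ρ^q. -/
theorem expRem_smooth_bound (hS : IsClosed S) {F : Eu n → ℂ} (hF : ContDiff ℝ ∞ F) {r : ℤ}
    (hr : r ≤ 0) (q : ℤ) {M : ℝ} (hM : 0 ≤ M) (hb : ∀ x, ‖iteratedFDeriv ℝ q.toNat F x‖ ≤ M)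
    {x : Eu n} (hx : x ∈ T.U ν \ S) : ‖expRem T ν r q F x‖ ≤
      ((n : ℝ) ^ q.toNat + T.radius ν ^ (-q)) * M * T.rho x ^ q := by
  have hρ := TubularSystem.rho_pos hx
  have hR := T.radius_pos ν
  rw [(HasExp.of_smooth hS hF.contDiffOn).expRem_eq hS r q hx,
    sum_Ico_of_eq_zero hr fun j hj => by rw [if_pos hj, zero_mul]]
  rcases le_or_gt 0 q with hq | hq
  · obtain ⟨N, rfl⟩ := Int.eq_ofNat_of_zero_le hq
    have h1 := taylor_bound (ξ := T.proj x) (w := x - T.proj x) isOpen_univ Subset.rfl hM N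
      hF.contDiffOn (DerivBound.of_iteratedFDeriv N hF hb) fun _ _ => mem_univ _
    rw [add_sub_cancel] at h1
    rw [sum_Ico_int_eq_range, Finset.sum_congr rfl fun j _ => ?_]
    · refine h1.trans ?_
      rw [mul_pow, zpow_natCast, Int.toNat_natCast, mul_right_comm]
      refine mul_le_mul_of_nonneg_right (mul_le_mul_of_nonneg_right ?_ hM) (by positivity)
      exact le_add_of_nonneg_right (zpow_pos hR _).le
    · rw [if_neg (by simp), Int.toNat_natCast]
      exact (TubularSystem.normalTaylor_eq j F hx).symm
  · rw [Finset.Ico_eq_empty (not_lt.2 hq.le), Finset.sum_empty, sub_zero]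
    have h0 : q.toNat = 0 := Int.toNat_of_nonpos hq.le
    have h1 := hb x
    rw [h0, norm_iteratedFDeriv_zero] at h1
    have h2 : 1 ≤ T.radius ν ^ (-q) * T.rho x ^ q := by
      have h3 : T.rho x ^ q = (T.rho x ^ (-q))⁻¹ := by rw [zpow_neg, inv_inv]
      rw [h3, ← div_eq_mul_inv, one_le_div (zpow_pos hρ _)]
      exact zpow_le_zpow_left₀ (by omega) hρ.le (TubularSystem.rho_lt hx).le
    refine h1.trans ?_
    rw [mul_right_comm]
    refine le_mul_of_one_le_left hM (h2.trans (mul_le_mul_of_nonneg_right ?_ (zpow_pos hρ q).le))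
    exact le_add_of_nonneg_left (by positivity)

theorem stepBound_restrict (hS : IsClosed S) (hK : (K : Set (Eu n)) ⊆ Ω) (q : ℤ) (k ν : ℕ) :
    ∃ C : ℝ, 0 ≤ C ∧ ∀ F : Eu n → ℂ, ContDiff ℝ ∞ F → (∀ x ∉ (K : Set (Eu n)), F x = 0) →
      ∀ M : ℝ, 0 ≤ M → (∀ i ∈ Finset.range (k + q.toNat + 1), ∀ x, ‖iteratedFDeriv ℝ i F x‖ ≤ M) →
        StepBound T 0 K q k ν (C * M) (((Ω : Set (Eu n)) \ S).indicator F) := by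
  have hR := T.radius_pos ν
  refine ⟨1 + ((n : ℝ) ^ q.toNat + T.radius ν ^ (-q)), by positivity, fun F hF hFK M hM hb => ?_⟩
  have hn : (0 : ℝ) ≤ (n : ℝ) ^ q.toNat + T.radius ν ^ (-q) := by positivity
  have heq : EqOn F (((Ω : Set (Eu n)) \ S).indicator F) Sᶜ := fun x hx => by
    by_cases h : x ∈ (Ω : Set (Eu n))
    · exact (indicator_of_mem (show x ∈ (Ω : Set (Eu n)) \ S from ⟨h, hx⟩) _).symm
    · rw [indicator_of_notMem fun h' => h h'.1, hFK x fun hxK => h (hK hxK)]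
  have hd := fun α => mderiv_congr hS.isOpen_compl α heq
  have hsm : ∀ α, ContDiff ℝ ∞ (mderiv α F) := fun α =>
    contDiffOn_univ.1 (mderiv_smooth isOpen_univ α hF.contDiffOn)
  have hb' : ∀ (α : Fin n → ℕ) (N : ℕ), N ≤ q.toNat → mlen α ≤ k → ∀ x,
      ‖iteratedFDeriv ℝ N (mderiv α F) x‖ ≤ M := fun α N hN hα x =>
    (norm_iteratedFDeriv_mderiv_le hF α N x).trans (hb _ (Finset.mem_range.2 (by omega)) x)
  refine ⟨fun α hα x hx => ?_, fun α hα x hx => ?_⟩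
  · have hxU : x ∈ T.U ν \ S := ⟨hx.1.2, hx.2⟩
    rw [← expRem_congr hS ((hd α).mono fun y hy => hy.2)
      (Expandable.of_smooth hS (hsm α).contDiffOn) hxU]
    refine (expRem_smooth_bound hS (hsm α) (by omega) q hM (hb' α _ le_rfl hα) hxU).trans ?_
    refine mul_le_mul_of_nonneg_right (mul_le_mul_of_nonneg_right ?_ hM)
      (zpow_pos (TubularSystem.rho_pos hxU) q).le
    exact le_add_of_nonneg_left zero_le_one
  · rw [← hd α fun hxS => hx.2 (T.U_cover hxS)]
    have h := hb' α 0 (Nat.zero_le _) hα x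
    rw [norm_iteratedFDeriv_zero] at h
    exact h.trans (le_mul_of_one_le_left hM (le_add_of_nonneg_right hn))

end StepMaps

/-! ### Transposes -/

section Transposes

variable {n d : ℕ} {S : Set (Eu n)} {hS : IsClosed S} {T : TubularSystem S d} {Ω : Opens (Eu n)}

instance : IsScalarTower ℝ ℂ (ThickTest hS T Ω) :=
  inferInstanceAs (IsScalarTower ℝ ℂ (testSubmodule hS T Ω))

theorem continuous_incl (m : ℤ) {K : Compacts (Eu n)} (hK : (K : Set (Eu n)) ⊆ Ω) :
    Continuous (Step.incl hS m hK : Step T Ω m K → ThickTest hS T Ω) :=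
  continuous_sInf_rng.2 fun _ ht => ht.1 m K hK

/-- The topology of ℂ pulled back along A is a locally convex vector space topology for which all
inclusions are continuous; hence the inductive limit topology is finer. -/
theorem continuous_of_incl (A : ThickTest hS T Ω →ₗ[ℂ] ℂ)
    (h : ∀ (m : ℤ) (K : Compacts (Eu n)) (hK : (K : Set (Eu n)) ⊆ Ω),
      Continuous fun φ : Step T Ω m K => A (Step.incl hS m hK φ)) : Continuous A := by
  refine continuous_iff_le_induced.2 (sInf_le ⟨fun m K hK => continuous_induced_rng.2 (h m K hK),
    topologicalAddGroup_induced A, continuousSMul_induced A, ?_⟩)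
  exact LocallyConvexSpace.induced (A.restrictScalars ℝ)

theorem IsTranspose.transpose_spec {V : Type} [AddCommGroup V] [Module ℂ V] [TopologicalSpace V]
    {A : V → Eu n → ℂ} {f : ThickDistribution hS T Ω} (h : ∃ g, IsTranspose A f g) :
    IsTranspose A f (transpose A f) := by
  rw [transpose, dif_pos h]
  exact h.choose_spec

/-- Operators that are linear on `𝒟_{*,S}(Ω)` and agree on each step space with some `StepMap`
have transposes. -/
theorem isTranspose_of_stepMap {A : (Eu n → ℂ) → Eu n → ℂ}
    (hadd : ∀ φ ψ : ThickTest hS T Ω, A (φ.1 + ψ.1) = A φ.1 + A ψ.1)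
    (hsmul : ∀ (c : ℂ) (φ : ThickTest hS T Ω), A (c • φ.1) = c • A φ.1)
    (hstep : ∀ (m : ℤ) (K : Compacts (Eu n)), (K : Set (Eu n)) ⊆ Ω →
      ∃ (m' : ℤ) (B : (Eu n → ℂ) → Eu n → ℂ), StepMap T Ω m m' K B ∧
        ∀ φ, IsStep T Ω m K φ → A φ = B φ) (f : ThickDistribution hS T Ω) :
    IsTranspose (fun φ : ThickTest hS T Ω => A φ.1) f
      (transpose (fun φ : ThickTest hS T Ω => A φ.1) f) := by
  have hmem : ∀ φ : ThickTest hS T Ω, A φ.1 ∈ testSubmodule hS T Ω := by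
    rintro ⟨φ, m, K, hK, hφ⟩
    obtain ⟨m', B, hB, hAB⟩ := hstep m K hK
    exact ⟨m', K, hK, (hAB φ hφ).symm ▸ hB.isStep φ hφ⟩
  let A' : ThickTest hS T Ω →ₗ[ℂ] ThickTest hS T Ω :=
    { toFun := fun φ => ⟨A φ.1, hmem φ⟩
      map_add' := fun φ ψ => Subtype.ext (hadd φ ψ)
      map_smul' := fun c φ => Subtype.ext (hsmul c φ) }
  refine IsTranspose.transpose_spec ⟨⟨(f : ThickTest hS T Ω →ₗ[ℂ] ℂ) ∘ₗ A',
    continuous_of_incl _ fun m K hK => ?_⟩, fun φ => ⟨hmem φ, rfl⟩⟩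
  obtain ⟨m', B, hB, hAB⟩ := hstep m K hK
  refine (f.continuous.comp ((continuous_incl m' hK).comp (hB.continuous hS hK))).congr
    fun φ => congrArg f (Subtype.ext ?_)
  exact (hAB φ.1 φ.2).symm

theorem ThickTest.smooth (φ : ThickTest hS T Ω) : φ.1 ∈ smoothOn ((Ω : Set (Eu n)) \ S) := by
  obtain ⟨φ, m, K, hK, hφ⟩ := φ
  exact ⟨hφ.smooth, fun x hx => hφ.eq_zero x fun h => hx ⟨hK h.1, h.2⟩⟩

theorem derivOff_eq_multiOp (α : Fin n → ℕ) (f : smoothOn ((Ω : Set (Eu n)) \ S)) :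
    derivOff S Ω α f.1 = (multiOp (Ω.isOpen.sdiff hS) α f).1 :=
  (multiOp_apply _ α f).symm

theorem isTranspose_derivOff (α : Fin n → ℕ) (f : ThickDistribution hS T Ω) :
    IsTranspose (fun φ : ThickTest hS T Ω => derivOff S Ω α φ.1) f
      (transpose (fun φ : ThickTest hS T Ω => derivOff S Ω α φ.1) f) := by
  refine isTranspose_of_stepMap (fun φ ψ => ?_) (fun c φ => ?_)
    (fun m K hK => ⟨_, _, stepMap_derivOff hS hK m α, fun _ _ => rfl⟩) f
  · have h := map_add (multiOp (Ω.isOpen.sdiff hS) α) ⟨φ.1, φ.smooth⟩ ⟨ψ.1, ψ.smooth⟩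
    have h' := congrArg Subtype.val h
    rw [Submodule.coe_add, ← derivOff_eq_multiOp (hS := hS), ← derivOff_eq_multiOp (hS := hS),
      ← derivOff_eq_multiOp (hS := hS)] at h'
    exact h'
  · have h := map_smul (multiOp (Ω.isOpen.sdiff hS) α) c ⟨φ.1, φ.smooth⟩
    have h' := congrArg Subtype.val h
    rw [Submodule.coe_smul, ← derivOff_eq_multiOp (hS := hS), ← derivOff_eq_multiOp (hS := hS)] at h'
    exact h'

theorem isTranspose_mul {ψ : Eu n → ℂ} (hψ : ψ ∈ multipliers hS T Ω)
    (f : ThickDistribution hS T Ω) :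
    IsTranspose (fun φ : ThickTest hS T Ω => ψ * φ.1) f (thickMul ψ f) := by
  refine isTranspose_of_stepMap (A := fun φ => ψ * φ) (fun _ _ => mul_add _ _ _)
    (fun _ _ => mul_smul_comm _ _ _) (fun m K hK => ?_) f
  obtain ⟨g, p, L, hL, hg, h⟩ := mul_isStep hψ hK
  exact ⟨_, _, stepMap_mul hS hK hL hg m, fun φ hφ => h hφ⟩

theorem isTranspose_restrictOff (f : ThickDistribution hS T Ω) :
    IsTranspose (restrictOff S Ω) f (thickProj f) := by
  have hmem : ∀ φ : 𝓓(Ω, ℂ), restrictOff S Ω φ ∈ testSubmodule hS T Ω := fun φ =>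
    ⟨_, _, φ.tsupport_subset, restrictOff_isStep hS φ⟩
  have hadd : ∀ φ ψ : 𝓓(Ω, ℂ), restrictOff S Ω (φ + ψ) = restrictOff S Ω φ + restrictOff S Ω ψ :=
    fun φ ψ => indicator_add _ _ _
  have hsmul : ∀ (c : ℂ) (φ : 𝓓(Ω, ℂ)), restrictOff S Ω (c • φ) = c • restrictOff S Ω φ :=
    fun c φ => indicator_const_smul ((Ω : Set (Eu n)) \ S) c (φ : Eu n → ℂ)
  let A' : 𝓓(Ω, ℂ) →ₗ[ℂ] ThickTest hS T Ω :=
    { toFun := fun φ => ⟨restrictOff S Ω φ, hmem φ⟩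
      map_add' := fun φ ψ => Subtype.ext (hadd φ ψ)
      map_smul' := fun c φ => Subtype.ext (hsmul c φ) }
  refine IsTranspose.transpose_spec ⟨⟨(f : ThickTest hS T Ω →ₗ[ℂ] ℂ) ∘ₗ A', ?_⟩,
    fun φ => ⟨hmem φ, rfl⟩⟩
  -- The classical test function space is an inductive limit as well, so continuity is checked on
  -- functions supported in a fixed K, which land in the step with m = 0.
  refine (TestFunction.continuous_iff_continuous_comp ((f : ThickTest hS T Ω →ₗ[ℂ] ℂ) ∘ₗ A')).2
    fun K hK => ?_
  let F : 𝓓_{K}(Eu n, ℂ) → Step T Ω 0 K := fun φ => ⟨((Ω : Set (Eu n)) \ S).indicator φ,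
    IsStep.of_smooth hS φ.contDiff hK fun x hx => φ.zero_on_compl hx⟩
  suffices hF : Continuous F from f.continuous.comp ((continuous_incl 0 hK).comp hF)
  refine continuous_step hS hK F fun q k ν φ₀ ε hε => ?_
  obtain ⟨C, hC, H⟩ := stepBound_restrict (T := T) hS hK q k ν
  have hp : 0 < ε / (C + 1) := by positivity
  have hev : ∀ᶠ φ in 𝓝 φ₀, ∀ i ∈ Finset.range (k + q.toNat + 1),
      ContDiffMapSupportedIn.seminorm ℝ (Eu n) ℂ ⊤ K i (φ - φ₀) < ε / (C + 1) := by
    refine (Filter.eventually_all_finset _).2 fun i _ => ?_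
    have hc : Continuous fun φ : 𝓓_{K}(Eu n, ℂ) =>
        ContDiffMapSupportedIn.seminorm ℝ (Eu n) ℂ ⊤ K i (φ - φ₀) :=
      ((ContDiffMapSupportedIn.withSeminorms ℝ (Eu n) ℂ ⊤ K).continuous_seminorm i).comp
        (continuous_id.sub continuous_const)
    exact hc.continuousAt.eventually (eventually_lt_nhds (by simpa using hp))
  filter_upwards [hev] with φ hφ
  have h1 := H (φ - φ₀ : 𝓓_{K}(Eu n, ℂ)) (φ - φ₀).contDiff
    (fun x hx => (φ - φ₀).zero_on_compl hx) _ hp.le fun i hi x =>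
      (ContDiffMapSupportedIn.norm_iteratedFDeriv_apply_le_seminorm_top ℝ).trans (hφ i hi).le
  have h2 : ((Ω : Set (Eu n)) \ S).indicator (φ - φ₀ : 𝓓_{K}(Eu n, ℂ)) = (F φ).1 - (F φ₀).1 :=
    indicator_sub _ _ _
  rw [h2] at h1
  refine h1.mono ?_
  rw [mul_div_assoc', div_le_iff₀ (by positivity)]
  nlinarith

theorem coe_testDeriv (α : Fin n → ℕ) (φ : 𝓓(Ω, ℂ)) : (testDeriv Ω α φ : Eu n → ℂ) = mderiv α φ := by
  have h1 : ∀ (i : Fin n) (u : 𝓓(Ω, ℂ)), ((TestFunction.lineDerivCLM ℂ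
      (EuclideanSpace.single i 1) : 𝓓(Ω, ℂ) →L[ℂ] 𝓓(Ω, ℂ)) u : Eu n → ℂ) = pderiv i u := fun i u => by
    ext x
    rw [TestFunction.lineDerivCLM_apply_of_le (by simp), pderiv,
      ((u.contDiff.differentiable (by simp)) x).lineDeriv_eq_fderiv]
  have h2 : ∀ (i : Fin n) (k : ℕ) (u : 𝓓(Ω, ℂ)), (((TestFunction.lineDerivCLM ℂ
      (EuclideanSpace.single i 1) : 𝓓(Ω, ℂ) →L[ℂ] 𝓓(Ω, ℂ)) ^ k) u : Eu n → ℂ) =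
        (pderiv i)^[k] u := fun i k => by
    induction k with
    | zero => exact fun u => rfl
    | succ k ih =>
      intro u
      rw [pow_succ, mul_apply_eq_comp, ih, h1]
      rfl
  have key : ∀ l : List (Fin n), (((l.map fun i => (TestFunction.lineDerivCLM ℂ
      (EuclideanSpace.single i 1) : 𝓓(Ω, ℂ) →L[ℂ] 𝓓(Ω, ℂ)) ^ α i).prod φ : 𝓓(Ω, ℂ)) : Eu n → ℂ) =
        l.foldr (fun i g => (pderiv i)^[α i] g) φ := by
    intro l
    induction l with
    | nil => rfl
    | cons i l ih =>
      rw [List.map_cons, List.prod_cons, mul_apply_eq_comp, h2, ih]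
      rfl
  exact key _

/-! ### The two identities by duality -/

theorem derivOff_restrictOff (hS : IsClosed S) (α : Fin n → ℕ) (φ : 𝓓(Ω, ℂ)) :
    derivOff S Ω α (restrictOff S Ω φ) = restrictOff S Ω (testDeriv Ω α φ) := by
  refine indicator_congr fun x hx => ?_
  rw [coe_testDeriv]
  exact mderiv_congr (Ω.isOpen.sdiff hS) α (fun y hy => indicator_of_mem hy _) hx

theorem apply_congr (f : ThickDistribution hS T Ω) {φ ψ : Eu n → ℂ} (h : φ = ψ)
    (hφ : φ ∈ testSubmodule hS T Ω) (hψ : ψ ∈ testSubmodule hS T Ω) :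
    f ⟨φ, hφ⟩ = f ⟨ψ, hψ⟩ := by
  subst h
  rfl

theorem thickDeriv_apply (α : Fin n → ℕ) (f : ThickDistribution hS T Ω) (φ : ThickTest hS T Ω) :
    ∃ h : derivOff S Ω α φ.1 ∈ testSubmodule hS T Ω,
      thickDeriv α f φ = (-1 : ℂ) ^ mlen α * f ⟨_, h⟩ := by
  obtain ⟨h, e⟩ := isTranspose_derivOff α f φ
  exact ⟨h, congrArg ((-1 : ℂ) ^ mlen α * ·) e⟩

theorem thickProj_thickDeriv (α : Fin n → ℕ) (f : ThickDistribution hS T Ω) :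
    thickProj (thickDeriv α f) = distDeriv α (thickProj f) := by
  ext φ
  obtain ⟨h1, e1⟩ := isTranspose_restrictOff (thickDeriv α f) φ
  obtain ⟨h2, e2⟩ := thickDeriv_apply α f ⟨_, h1⟩
  obtain ⟨h3, e3⟩ := isTranspose_restrictOff f (testDeriv Ω α φ)
  have e4 : distDeriv α (thickProj f) φ = (-1 : ℂ) ^ mlen α * thickProj f (testDeriv Ω α φ) := rfl
  rw [e1, e2, e4, e3, apply_congr f (derivOff_restrictOff hS α φ) h2 h3]

theorem sum_mul_apply (f : ThickDistribution hS T Ω) {ι : Type*} (s : Finset ι) (c : ι → ℂ)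
    (u : ι → ThickTest hS T Ω) (a : ℂ) (v : ThickTest hS T Ω)
    (h : ∑ i ∈ s, c i • (u i).1 = a • v.1) : ∑ i ∈ s, c i * f (u i) = a * f v := by
  let J : ThickTest hS T Ω →ₗ[ℂ] (Eu n → ℂ) := (testSubmodule hS T Ω).subtype
  have h1 : J (∑ i ∈ s, c i • u i) = J (a • v) := by
    rw [map_sum, map_smul, Finset.sum_congr rfl fun i _ => map_smul J (c i) (u i)]
    exact h
  have h2 := congrArg f (Subtype.ext h1 : ∑ i ∈ s, c i • u i = a • v)
  rw [map_sum, map_smul, Finset.sum_congr rfl fun i _ => map_smul f (c i) (u i)] at h2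
  exact h2

/-- Evaluated at φ, both sides are f applied to combinations of test functions; these agree by
`multiOp_leibniz_transposed`. That identity only needs ψ and φ to be smooth on Ω \ S and zero
elsewhere. -/
theorem thickDeriv_thickMul {ψ : Eu n → ℂ} (hψ : ψ ∈ multipliers hS T Ω) (α : Fin n → ℕ)
    (f : ThickDistribution hS T Ω) : thickDeriv α (thickMul ψ f) =
      ∑ β ∈ Finset.Iic α, (∏ i, ((α i).choose (β i) : ℂ)) •
        thickMul (derivOff S Ω β ψ) (thickDeriv (α - β) f) := by
  have hO := Ω.isOpen.sdiff hS
  ext φ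
  obtain ⟨h1, e1⟩ := thickDeriv_apply α (thickMul ψ f) φ
  obtain ⟨h2, e2⟩ := isTranspose_mul hψ f ⟨_, h1⟩
  have hβ : ∀ β, ∃ h : derivOff S Ω (α - β) (derivOff S Ω β ψ * φ.1) ∈ testSubmodule hS T Ω,
      thickMul (derivOff S Ω β ψ) (thickDeriv (α - β) f) φ =
        (-1 : ℂ) ^ mlen (α - β) * f ⟨_, h⟩ := fun β => by
    obtain ⟨h3, e3⟩ := isTranspose_mul (derivOff_mem_multipliers hψ β) (thickDeriv (α - β) f) φ
    obtain ⟨h4, e4⟩ := thickDeriv_apply (α - β) f ⟨_, h3⟩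
    exact ⟨h4, e3.trans e4⟩
  choose h e using hβ
  have key := congrArg Subtype.val
    (multiOp_leibniz_transposed hO α ⟨ψ, hψ.1, hψ.2.1⟩ ⟨φ.1, φ.smooth⟩)
  rw [Submodule.coe_sum] at key
  have key' := sum_mul_apply f (Finset.Iic α)
    (fun β => (∏ i, ((α i).choose (β i) : ℂ)) * (-1) ^ mlen (α - β)) (fun β => ⟨_, h β⟩)
    ((-1 : ℂ) ^ mlen α) ⟨_, h2⟩ (by
      refine Eq.trans (Finset.sum_congr rfl fun β _ => ?_) (key.trans ?_)
      · rw [Submodule.coe_smul, ← derivOff_eq_multiOp (hS := hS), smoothMul_apply,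
          ← derivOff_eq_multiOp (hS := hS)]
      · rw [Submodule.coe_smul, smoothMul_apply, ← derivOff_eq_multiOp (hS := hS)])
  rw [e1, e2, ← key', sum_apply]
  refine Finset.sum_congr rfl fun β _ => ?_
  rw [smul_apply, e β, smul_eq_mul, mul_assoc]

end Transposes

end

end ThickDist

theorem mainTheorem5 {n d : ℕ} (hd : 1 ≤ d) (S : Set (ThickDist.Eu n)) (hS : IsClosed S)
    (hSd : ThickDist.IsSubmanifold S d) (T : ThickDist.TubularSystem S d)
    (Ω : Opens (ThickDist.Eu n)) (hΩ : ((Ω : Set (ThickDist.Eu n)) ∩ S).Nonempty)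
    (f : ThickDist.ThickDistribution hS T Ω) (α : Fin n → ℕ) :
    -- the projection and the thick derivative are well defined by duality
    ThickDist.IsTranspose (ThickDist.restrictOff S Ω) f (ThickDist.thickProj f) ∧
    (∀ φ : ThickDist.ThickTest hS T Ω,
      ∃ h : ThickDist.derivOff S Ω α φ.1 ∈ ThickDist.testSubmodule hS T Ω,
        ThickDist.thickDeriv α f φ = (-1 : ℂ) ^ ThickDist.mlen α * f ⟨_, h⟩) ∧
    -- the projection commutes with derivatives
    ThickDist.thickProj (ThickDist.thickDeriv α f) =
      ThickDist.distDeriv α (ThickDist.thickProj f) ∧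
    ∀ ψ ∈ ThickDist.multipliers hS T Ω,
      -- derivatives of `ψ` are multipliers, and multiplication is well defined by duality
      ThickDist.derivOff S Ω α ψ ∈ ThickDist.multipliers hS T Ω ∧
      ThickDist.IsTranspose (fun φ : ThickDist.ThickTest hS T Ω => ψ * φ.1) f
        (ThickDist.thickMul ψ f) ∧
      -- the Leibniz rule
      ThickDist.thickDeriv α (ThickDist.thickMul ψ f) =
        ∑ β ∈ Finset.Iic α, (∏ i, ((α i).choose (β i) : ℂ)) •
          ThickDist.thickMul (ThickDist.derivOff S Ω β ψ) (ThickDist.thickDeriv (α - β) f) := by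
  exact ⟨ThickDist.isTranspose_restrictOff f, ThickDist.thickDeriv_apply α f,
    ThickDist.thickProj_thickDeriv α f, fun ψ hψ => ⟨ThickDist.derivOff_mem_multipliers hψ α,
      ThickDist.isTranspose_mul hψ f, ThickDist.thickDeriv_thickMul hψ α f⟩⟩
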